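/- **Setting.** Let $\boldsymbol q = R_1\Join\dots\Join R_m$ be an acyclic full conjunctive (join) query over a set $\mathbf A$ of $d$ real-valued attributes (every attribute occurs in some relation; acyclic means that a join tree exists), and let $\mathbf A_u\subseteq\mathbf A$ with $d_u=|\mathbf A_u|$; these are fixed (data complexity). Let $\mathcal D$ be a database instance in which every relation is a set of $N\ge 2$ tuples, let $\boldsymbol q(\mathcal D)\subset\mathbb R^d$ be the set of join results, and let $\boldsymbol q_u(\mathcal D)$ be the multiset of the projections of the tuples of $\boldsymbol q(\mathcal D)$ onto $\mathbf A_u$. For a finite set $S\subset\mathbb R^{d_u}$ and a (multi)set $P$ of points with weights $w$ put $\mathbf v_S(P)=\sum_{p\in P}w(p)\min_{s\in S}\|p-s\|$, with $w\equiv1$ for $\boldsymbol q_u(\mathcal D)$. Let $\mathrm{OPT}_k(P)$ be the minimum of $\mathbf v_S(P)$ over all $S\subset\mathbb R^{d_u}$ with $|S|=k$, and $\mathrm{OPT}^{\rm disc}_k(P)$ the minimum over all sets $S$ of $k$ distinct points of $P$. The algorithm has access to a $\gamma$-approximation algorithm $\mathsf{Alg}$ ($\gamma\ge1$) for weighted geometric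 (respectively discrete) $k$-median on finite weighted point sets in $\mathbb R^{d_u}$, which takes $T_\gamma(n)$ time on $n$ points, with $T_\gamma$ non-decreasing. The model is the randomized real RAM: unit-cost exact real arithmetic, square roots and comparisons (no rounding), words of $O(\log(N+|X|+k))$ bits, uniformly random words, and $T_\gamma(n)$ time for a call of $\mathsf{Alg}$ on $n$ points. **Theorem.** Let $\alpha>1$ and $\varepsilon\in(0,1)$ be constants. Given $\mathcal D$, an integer $k\ge1$, a nonempty finite set $X\subset\mathbb R^{d_u}$ and a number $r$ with $$\mathbf v_X(\boldsymbol q_u(\mathcal D))\le r\le\alpha\cdot\mathrm{OPT}_k(\boldsymbol q_u(\mathcal D)),$$ the following holds. 1. (Geometric version.) If $\mathsf{Alg}$ is a $\gamma$-approximation algorithm for geometric $k$-median, then there is a randomized algorithm that computes a set $\mathcal S\subset\mathbb R^{d_u}$ of $k$ points and a number $r_u$ such that, with high probability, $$\mathbf v_{\mathcal S}(\boldsymbol q_u(\mathcal D))\le r_u\le(1+\varepsilon)\,\gamma\cdot\mathrm{OPT}_k(\boldsymbol q_u(\mathcal D)).$$ 2. (Discrete version.) If $k$ is at most the number of distinct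 points of $\boldsymbol q_u(\mathcal D)$ and $\mathsf{Alg}$ is a $\gamma$-approximation algorithm for discrete $k$-median, then there is a randomized algorithm that computes a set $\mathcal S\subseteq\boldsymbol q_u(\mathcal D)$ of $k$ points and a number $r_u$ such that, with high probability, $$\mathbf v_{\mathcal S}(\boldsymbol q_u(\mathcal D))\le r_u\le(2+\varepsilon)\,\gamma\cdot\mathrm{OPT}^{\rm disc}_k(\boldsymbol q_u(\mathcal D)).$$ Here "with high probability" means: for every constant $c$ the algorithm can be chosen so that the assertion holds with probability at least $1-N^{-c}$. In both cases the algorithm always halts within time $$O\Bigl(|X|\,N\log N+|X|^2\log^3 N\cdot\min\{\log^{d_u}|X|,\ |X|\log N\}+T_\gamma\bigl(O(|X|\log N)\bigr)\Bigr),$$ where the constants depend only on $\boldsymbol q$, $\mathbf A_u$, $\alpha$, $\varepsilon$ and $c$ (so the last term is $O(T_\gamma(|X|\log N))$ whenever $T_\gamma(O(n))=O(T_\gamma(n))$). One and the same algorithm, which uses $\mathsf{Alg}$ as a black box, works for all $\mathcal D$, $N$, $k$, $X$, $r$, $\alpha$, $\varepsilon$, $\gamma$ and $\mathsf{Alg}$.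 -/

import Mathlib

open scoped ENNReal

noncomputable section

/-! ### A randomized real RAM

Memory consists of finitely many named arrays (the names are fixed in the program) of machine words
(natural numbers) and of real numbers. Programs are structured commands built from word and
real arithmetic, comparisons, random words, and calls to a given solver (a subroutine). -/

structure Mem where
  /-- `word a i` is entry `i` of word array `a`. -/
  word : ℕ → ℕ → ℕ
  /-- `real a i` is entry `i` of real array `a`. -/
  real : ℕ → ℕ → ℝ

def Mem.setWord (s : Mem) (a i v : ℕ) : Mem :=
  { s with word := Function.update s.word a (Function.update (s.word a) i v) }

def Mem.setReal (s : Mem) (a i : ℕ) (v : ℝ) : Mem :=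
  { s with real := Function.update s.real a (Function.update (s.real a) i v) }

/-- Overwrite the first `n` entries of real array `a` by those of `f`. -/
def Mem.copyReal (s : Mem) (a n : ℕ) (f : ℕ → ℝ) : Mem :=
  { s with real := Function.update s.real a (fun i => if i < n then f i else s.real a i) }

/-- Word expressions; `sub` is truncated, `div` and `mod` are those of `ℕ`. -/
inductive WExp where
  | const (n : ℕ)
  | get (a : ℕ) (i : WExp)
  | add (e f : WExp)
  | sub (e f : WExp)
  | mul (e f : WExp)
  | div (e f : WExp)
  | mod (e f : WExp)

def WExp.eval (s : Mem) : WExp → ℕ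
  | .const n => n
  | .get a i => s.word a (i.eval s)
  | .add e f => e.eval s + f.eval s
  | .sub e f => e.eval s - f.eval s
  | .mul e f => e.eval s * f.eval s
  | .div e f => e.eval s / f.eval s
  | .mod e f => e.eval s % f.eval s

/-- Real expressions. There is no rounding from reals to words and there are no real constants in
programs other than those that arise from natural numbers. -/
inductive RExp where
  | ofWord (e : WExp)
  | get (a : ℕ) (i : WExp)
  | add (e f : RExp)
  | sub (e f : RExp)
  | mul (e f : RExp)
  | div (e f : RExp)
  | sqrt (e : RExp)

def RExp.eval (s : Mem) : RExp → ℝ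
  | .ofWord e => (e.eval s : ℝ)
  | .get a i => s.real a (i.eval s)
  | .add e f => e.eval s + f.eval s
  | .sub e f => e.eval s - f.eval s
  | .mul e f => e.eval s * f.eval s
  | .div e f => e.eval s / f.eval s
  | .sqrt e => Real.sqrt (e.eval s)

inductive Test where
  | wordLt (e f : WExp)
  | realLt (e f : RExp)
  | neg (b : Test)
  | conj (b c : Test)

def Test.eval (s : Mem) : Test → Prop
  | .wordLt e f => e.eval s < f.eval s
  | .realLt e f => e.eval s < f.eval s
  | .neg b => ¬ b.eval s
  | .conj b c => b.eval s ∧ c.eval s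

inductive Cmd where
  | skip
  /-- `word a [i] := e` -/
  | setWord (a : ℕ) (i e : WExp)
  /-- `real a [i] := e` -/
  | setReal (a : ℕ) (i : WExp) (e : RExp)
  /-- `word a [i] :=` a uniformly random element of `{0, …, e - 1}` -/
  | rand (a : ℕ) (i e : WExp)
  /-- run the solver on the `n` weighted points stored in the real arrays `pts` (coordinates) and
  `wts` (weights), and write its answer to real array `out` -/
  | solve (n : WExp) (pts wts out : ℕ)
  | seq (c₁ c₂ : Cmd)
  | ite (b : Test) (c₁ c₂ : Cmd)
  | loop (b : Test) (c : Cmd)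

/-- A subroutine on weighted point sets: on `n` points, given by an array of coordinates and an
array of weights, it takes `time n` steps and returns `outLen` real numbers. -/
structure Solver where
  time : ℕ → ℕ
  outLen : ℕ
  answer : ℕ → (ℕ → ℝ) → (ℕ → ℝ) → ℕ → ℝ

/-- The law of a run that is given a budget of steps: the final memory and the unused part of the
budget, or `none` if the run crashed or did not halt within the budget. -/
abbrev Run := PMF (Option (Mem × ℕ))

def Run.crash : Run := PMF.pure none

/-- Pay `cost` steps out of the budget `t` and continue with memory `s`. -/
def Run.pay (cost t : ℕ) (s : Mem) : Run :=
  if cost ≤ t then PMF.pure (some (s, t - cost)) else Run.crash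

def Run.andThen (x : Run) (f : ℕ → Mem → Run) : Run :=
  x.bind fun o => match o with
    | none => Run.crash
    | some (s, t) => f t s

open Classical in
/-- `while test do body` with budget `t`; every evaluation of the test costs one step. The first
argument only makes the recursion well-founded: it never matters as long as it is at least `t`. -/
def Run.iterate (test : Mem → Prop) (body : ℕ → Mem → Run) : ℕ → ℕ → Mem → Run
  | 0, _, _ => Run.crash
  | _ + 1, 0, _ => Run.crash
  | n + 1, t + 1, s =>
    if test s then (body t s).andThen (fun t' s' => Run.iterate test body n t' s')
    else PMF.pure (some (s, t))

open Classical in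
/-- The law of the run of a command with budget `t` from memory `s`. Assignments, random
choices and evaluations of tests cost one step each (a program contains finitely many expressions,
so this is unit cost per operation up to a constant factor), a call of the solver on `n` points costs
`1 + o.time n` steps. Storing a word larger than `W` crashes the machine. -/
def Cmd.run (W : ℕ) (o : Solver) : Cmd → ℕ → Mem → Run
  | .skip, t, s => Run.pay 1 t s
  | .setWord a i e, t, s =>
    if e.eval s ≤ W then Run.pay 1 t (s.setWord a (i.eval s) (e.eval s)) else Run.crash
  | .setReal a i e, t, s => Run.pay 1 t (s.setReal a (i.eval s) (e.eval s))
  | .rand a i e, t, s =>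
    match e.eval s with
    | 0 => Run.crash
    | n + 1 =>
      if n ≤ W then
        (PMF.uniformOfFintype (Fin (n + 1))).bind fun v => Run.pay 1 t (s.setWord a (i.eval s) v)
      else Run.crash
  | .solve n pts wts out, t, s =>
    Run.pay (1 + o.time (n.eval s)) t
      (s.copyReal out o.outLen (o.answer (n.eval s) (s.real pts) (s.real wts)))
  | .seq c₁ c₂, t, s => (Cmd.run W o c₁ t s).andThen (fun t' s' => Cmd.run W o c₂ t' s')
  | .ite _ _ _, 0, _ => Run.crash
  | .ite b c₁ c₂, t + 1, s =>
    if b.eval s then Cmd.run W o c₁ t s else Cmd.run W o c₂ t s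
  | .loop b c, t, s => Run.iterate (fun s' => b.eval s') (fun t' s' => Cmd.run W o c t' s') t t s

/-- Started from `s`, the program `p` always halts within `t` steps, without storing words larger
than `W`, and its final memory satisfies `good` with probability at least `1 - δ`. -/
def Cmd.Succeeds (p : Cmd) (W : ℕ) (o : Solver) (t : ℕ) (s : Mem) (δ : ℝ)
    (good : Mem → Prop) : Prop :=
  none ∉ (p.run W o t s).support ∧
    1 - δ ≤ ((p.run W o t s).toOuterMeasure {x | ∃ s' t', x = some (s', t') ∧ good s'}).toReal

/-! ### Points and their representation in memory -/

/-- The Euclidean space `ℝ^B` over a set `B` of the `d` attributes. -/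
abbrev Pt {d : ℕ} (B : Finset (Fin d)) := EuclideanSpace ℝ B

/-- The projection of a tuple onto the attributes in `B`. -/
def proj {d : ℕ} (B : Finset (Fin d)) (t : Fin d → ℝ) : Pt B := WithLp.toLp 2 fun a => t a

open Classical in
/-- Points are stored one after the other, `d` entries each; entries for attributes outside `B` are
not used and set to `0`. -/
def encode {d : ℕ} {B : Finset (Fin d)} {n : ℕ} (x : Fin n → Pt B) (i : ℕ) : ℝ :=
  if h : ∃ (_ : i / d < n) (h₂ : i % d < d), (⟨i % d, h₂⟩ : Fin d) ∈ B then
    x ⟨i / d, h.1⟩ ⟨⟨i % d, h.2.1⟩, h.2.2⟩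
  else 0

/-- The `i`-th point that is stored in an array. -/
def decode {d : ℕ} (B : Finset (Fin d)) (f : ℕ → ℝ) (i : ℕ) : Pt B :=
  WithLp.toLp 2 fun a => f (i * d + (a : Fin d))

/-! ### `k`-median clustering -/

section Clustering
variable {E : Type*} [PseudoMetricSpace E]

/-- `v_S(P) = ∑_{p ∈ P} w(p) φ(p, S)`, where `φ(p, S)` is the distance from `p` to the nearest point
of `S`, for a collection `P` of points with weights. -/
def medianCost (S : Set E) (P : Multiset (E × ℝ)) : ℝ :=
  (P.map fun p => p.2 * Metric.infDist p.1 S).sum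

/-- The optimum of geometric `k`-median: the least cost of a set of `k` points of the space. -/
def medianOpt (k : ℕ) (P : Multiset (E × ℝ)) : ℝ :=
  ⨅ S : {S : Finset E // S.card = k}, medianCost (S : Set E) P

/-- The optimum of discrete `k`-median: the least cost of a set of `k` of the given points. -/
def medianOptDisc (k : ℕ) (P : Multiset (E × ℝ)) : ℝ :=
  ⨅ S : {S : Finset E // S.card = k ∧ ∀ x ∈ S, ∃ w, (x, w) ∈ P}, medianCost (S : Set E) P

/-- The inputs of a weighted clustering algorithm: a nonempty finite set of points (listed without
repetition) with positive weights. -/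
def IsWeightedSet (P : List (E × ℝ)) : Prop :=
  P ≠ [] ∧ (P.map Prod.fst).Nodup ∧ ∀ p ∈ P, 0 < p.2

/-- `alg` is a `γ`-approximation algorithm for weighted geometric `k`-median. -/
def IsGeometricApprox (k : ℕ) (γ : ℝ) (alg : List (E × ℝ) → Fin k → E) : Prop :=
  ∀ P : List (E × ℝ), IsWeightedSet P →
    Function.Injective (alg P) ∧ medianCost (Set.range (alg P)) P ≤ γ * medianOpt k (P : Multiset (E × ℝ))

/-- `alg` is a `γ`-approximation algorithm for weighted discrete `k`-median. -/
def IsDiscreteApprox (k : ℕ) (γ : ℝ) (alg : List (E × ℝ) → Fin k → E) : Prop :=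
  ∀ P : List (E × ℝ), IsWeightedSet P → k ≤ P.length →
    Function.Injective (alg P) ∧ (∀ i, alg P i ∈ P.map Prod.fst) ∧
      medianCost (Set.range (alg P)) P ≤ γ * medianOptDisc k (P : Multiset (E × ℝ))

end Clustering

/-- The `k`-median algorithm `alg`, with running time `T`, as a subroutine. -/
def clusteringSolver {d : ℕ} {B : Finset (Fin d)} {k : ℕ}
    (alg : List (Pt B × ℝ) → Fin k → Pt B) (T : ℕ → ℕ) : Solver where
  time := T
  outLen := k * d
  answer n pts wts := encode (alg (List.ofFn fun i : Fin n => (decode B pts i, wts i)))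

/-! ### Join queries -/

/-- A full conjunctive query `R_1 ⋈ … ⋈ R_m` over `d` attributes: `attrs j` is the set of attributes
of `R_j`, and every attribute occurs in some relation. -/
structure JoinQuery (d m : ℕ) where
  attrs : Fin m → Finset (Fin d)
  covers : ∀ a, ∃ j, a ∈ attrs j

namespace JoinQuery

variable {d m : ℕ} (q : JoinQuery d m)

/-- There is a join tree: a tree on the relations in which the relations that contain any given
attribute form a connected part. -/
def Acyclic : Prop :=
  ∃ G : SimpleGraph (Fin m), G.IsTree ∧ ∀ a, (G.induce {j | a ∈ q.attrs j}).Connected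

/-- A database instance: every relation is a set of `N` tuples, given by an enumeration. -/
abbrev Instance (N : ℕ) := (j : Fin m) → Fin N ↪ Pt (q.attrs j)

variable {q} {N : ℕ}

/-- `q(D)`, the tuples whose projection onto the attributes of every relation is in the relation. -/
def results (D : q.Instance N) : Set (Fin d → ℝ) :=
  {t | ∀ j, proj (q.attrs j) t ∈ Set.range (D j)}

theorem results_finite (D : q.Instance N) : (results D).Finite := by
  choose j hj using q.covers
  refine Set.Finite.subset
    (Set.Finite.pi' (t := fun a => Set.range fun l => D (j a) l ⟨a, hj a⟩)
      (fun a => Set.finite_range _)) ?_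
  intro t ht a
  obtain ⟨l, hl⟩ := ht (j a)
  refine ⟨l, ?_⟩
  simp [hl, proj]

/-- `q_u(D)`, the multiset of the projections of the tuples in `q(D)` onto the attributes in `B`. -/
def projected (D : q.Instance N) (B : Finset (Fin d)) : Multiset (Pt B) :=
  (results_finite D).toFinset.val.map (proj B)

/-- `q_u(D)` as an unweighted point set: all weights are `1`. -/
def data (D : q.Instance N) (B : Finset (Fin d)) : Multiset (Pt B × ℝ) :=
  (projected D B).map fun p => (p, 1)

/-- The input: word array `0` holds `N, |X|, k`, real array `0` holds `α, ε, r`, real array `1`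
holds `X`, and real array `j + 2` holds the tuples of the `j`-th relation. -/
def input (D : q.Instance N) {B : Finset (Fin d)} {s : ℕ} (X : Fin s → Pt B) (k : ℕ)
    (α ε r : ℝ) : Mem where
  word a i := if a = 0 then [N, s, k].getD i 0 else 0
  real a i :=
    if a = 0 then [α, ε, r].getD i 0
    else if a = 1 then encode X i
    else if h : a - 2 < m then encode (D ⟨a - 2, h⟩) i
    else 0

end JoinQuery

/-- The output: the centers are read off real array `1` … -/
def outCenters {d : ℕ} (B : Finset (Fin d)) (k : ℕ) (s : Mem) (i : Fin k) : Pt B :=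
  decode B (s.real 1) i

/-- … and the estimate of their cost is entry `0` of real array `0`. -/
def outEstimate (s : Mem) : ℝ := s.real 0 0

/-- The time bound
`K (|X| N log N + |X|² log³ N min {log^{d_u} |X|, |X| log N} + T(K |X| log N))`. -/
def timeBound (K dᵤ N s : ℕ) (T : ℕ → ℕ) : ℝ :=
  K * ((s : ℝ) * N * Real.log N
    + (s : ℝ) ^ 2 * Real.log N ^ 3 * min (Real.log s ^ dᵤ) (s * Real.log N)
    + T ⌈K * (s * Real.log N)⌉₊)

end

/-! ### Memory updates -/

namespace Mem

variable (s : Mem) (a b i : ℕ)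

/-! The algorithm is deterministic, so its failure probability is `0` for every `c`. It replaces the
multiset of projected results by a small weighted set whose cost is almost the same for every set of
centers, and clusters that set with the solver.

Existence of the summary. The cost of `X` is at most `r`, so every single result lies within `r` of
a point of `X` (`exists_abs_sub_le`), and disjoint cubes of side `3 r`, only `O(|X|)` of them,
contain all results (`Cmd.ends_rootStage`). A cube of side `ℓ` is halved in all directions while a
point of `X` lies within `κ ℓ` of it, where `κ = 6 d α / ε`; halving stops altogether once `μ ℓ ≤ ε
r`, where `μ = 6 d α N ^ m`. Moving a result inside its leaf shifts its projection by at most `d ℓ`.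
In a leaf far from `X` this is at most `ε / (6 α)` times the distance of the result to `X`; in a
small leaf it is at most `ε r / (6 α N ^ m)`. There are at most `N ^ m` results, so the shifts sum
to at most `e = ε r / (3 α)`. Distance to a set is 1-Lipschitz, hence one representative per leaf,
weighted by the number of results there, changes no cost by more than `e`
(`IsSummary.abs_medianCost_sub_le`). Since `r ≤ α OPT`, this gives `3 e ≤ ε OPT`.

From the summary to the data. The cost on the summary plus `e` bounds the true cost from above. In
the geometric case it is at most `γ (OPT + e) + e`. In the discrete case, moving centers to nearest
points of the summary loses a factor two, and the bound is `2 γ (OPT + e) + e`, with the discrete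
optimum; here the factor `3` in `3 e` is used up (`geometric_estimate`, `discrete_estimate`).

Running time. By packing, disjoint cubes of one side near `n` points number `O(n)`
(`length_le_of_disjoint_of_near`). So every level has `O(|X|)` cubes, `O(log N)` levels suffice
(`exists_levels`), and there are `O(|X| log N)` leaves. In one leaf the results are counted, and one
of them is found, in time `O(N)`: the relations are removed in the order given by a join tree, and
each passes its weights on to its parent (`joinWeight_insert`, `Cmd.ends_joinCmd`). Sorting all
values once turns join keys into array addresses. The tests for nearness and the final evaluation of
the cost take `O((|X| log N)^2)` steps, which the terms of the bound absorb (`log_sq_le`).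

On the machine, `Cmd.Ends` is a total-correctness triple with a step bound and a frame condition:
arrays that are not targets of a command keep their contents. -/

@[simp] theorem setWord_word_self (v : ℕ) :
    (s.setWord a i v).word a = Function.update (s.word a) i v := by simp [setWord]

@[simp] theorem setWord_word_of_ne (v : ℕ) (h : b ≠ a) : (s.setWord a i v).word b = s.word b := by
  simp [setWord, h]

@[simp] theorem setWord_real (v : ℕ) : (s.setWord a i v).real = s.real := rfl

@[simp] theorem setReal_real_self (v : ℝ) :
    (s.setReal a i v).real a = Function.update (s.real a) i v := by simp [setReal]

@[simp] theorem setReal_real_of_ne (v : ℝ) (h : b ≠ a) : (s.setReal a i v).real b = s.real b := by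
  simp [setReal, h]

@[simp] theorem setReal_word (v : ℝ) : (s.setReal a i v).word = s.word := rfl

end Mem

/-! ### Expressions -/

namespace WExp

instance (n : ℕ) : OfNat WExp n := ⟨.const n⟩
instance : Add WExp := ⟨.add⟩
instance : Sub WExp := ⟨.sub⟩
instance : Mul WExp := ⟨.mul⟩
instance : Mod WExp := ⟨.mod⟩

/-- The word variable kept in entry `0` of word array `a`. -/
abbrev var (a : ℕ) : WExp := .get a (.const 0)

variable (s : Mem) (e f : WExp)

@[simp] theorem eval_const (n : ℕ) : (WExp.const n).eval s = n := rfl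
@[simp] theorem eval_ofNat (n : ℕ) : (ofNat(n) : WExp).eval s = n := rfl
@[simp] theorem eval_get (a : ℕ) : (WExp.get a e).eval s = s.word a (e.eval s) := rfl
@[simp] theorem eval_add : (e + f).eval s = e.eval s + f.eval s := rfl
@[simp] theorem eval_sub : (e - f).eval s = e.eval s - f.eval s := rfl
@[simp] theorem eval_mul : (e * f).eval s = e.eval s * f.eval s := rfl
@[simp] theorem eval_mod : (e % f).eval s = e.eval s % f.eval s := rfl

theorem eval_congr {s t : Mem} (h : t.word = s.word) (e : WExp) : e.eval t = e.eval s := by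
  induction e with
  | const n => rfl
  | get a i ih => simp [ih, h]
  | add e f he hf => simp [WExp.eval, he, hf]
  | sub e f he hf => simp [WExp.eval, he, hf]
  | mul e f he hf => simp [WExp.eval, he, hf]
  | div e f he hf => simp [WExp.eval, he, hf]
  | mod e f he hf => simp [WExp.eval, he, hf]

/-- The power `e ^ n` with a fixed exponent. -/
def power (e : WExp) : ℕ → WExp
  | 0 => 1
  | n + 1 => e.power n * e

@[simp] theorem eval_power (n : ℕ) : (e.power n).eval s = e.eval s ^ n := by
  induction n with
  | zero => simp [power]
  | succ n ih => simp [power, ih, pow_succ]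

end WExp

namespace RExp

instance : Add RExp := ⟨.add⟩
instance : Sub RExp := ⟨.sub⟩
instance : Mul RExp := ⟨.mul⟩
instance : Div RExp := ⟨.div⟩
instance (n : ℕ) : OfNat RExp n := ⟨.ofWord (.const n)⟩

/-- The real variable kept in entry `0` of real array `a`. -/
abbrev var (a : ℕ) : RExp := .get a (.const 0)

/-- The expression reads real array `a`. -/
def Reads (a : ℕ) : RExp → Prop
  | .ofWord _ => False
  | .get b _ => a = b
  | .add e f => e.Reads a ∨ f.Reads a
  | .sub e f => e.Reads a ∨ f.Reads a
  | .mul e f => e.Reads a ∨ f.Reads a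
  | .div e f => e.Reads a ∨ f.Reads a
  | .sqrt e => e.Reads a

variable (s : Mem) (a : ℕ) (e f : RExp)

@[simp] theorem eval_ofNat (n : ℕ) : (ofNat(n) : RExp).eval s = n := rfl
@[simp] theorem eval_ofWord (e : WExp) : (RExp.ofWord e).eval s = e.eval s := rfl
@[simp] theorem eval_get (e : WExp) : (RExp.get a e).eval s = s.real a (e.eval s) := rfl
@[simp] theorem eval_add : (e + f).eval s = e.eval s + f.eval s := rfl
@[simp] theorem eval_sub : (e - f).eval s = e.eval s - f.eval s := rfl
@[simp] theorem eval_mul : (e * f).eval s = e.eval s * f.eval s := rfl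
@[simp] theorem eval_div : (e / f).eval s = e.eval s / f.eval s := rfl
@[simp] theorem eval_sqrt : (RExp.sqrt e).eval s = Real.sqrt (e.eval s) := rfl

@[simp] theorem reads_ofNat (n : ℕ) : (ofNat(n) : RExp).Reads a ↔ False := Iff.rfl
@[simp] theorem reads_ofWord (e : WExp) : (RExp.ofWord e).Reads a ↔ False := Iff.rfl
@[simp] theorem reads_get (b : ℕ) (e : WExp) : (RExp.get b e).Reads a ↔ a = b := Iff.rfl
@[simp] theorem reads_add : (e + f).Reads a ↔ e.Reads a ∨ f.Reads a := Iff.rfl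
@[simp] theorem reads_sub : (e - f).Reads a ↔ e.Reads a ∨ f.Reads a := Iff.rfl
@[simp] theorem reads_mul : (e * f).Reads a ↔ e.Reads a ∨ f.Reads a := Iff.rfl
@[simp] theorem reads_div : (e / f).Reads a ↔ e.Reads a ∨ f.Reads a := Iff.rfl

theorem eval_congr {s t : Mem} (e : RExp) (hw : t.word = s.word)
    (hr : ∀ a, e.Reads a → t.real a = s.real a) : e.eval t = e.eval s := by
  induction e with
  | ofWord e => simp [WExp.eval_congr hw]
  | get a i => simp [WExp.eval_congr hw, hr a rfl]
  | add e f he hf | sub e f he hf | mul e f he hf | div e f he hf =>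
    simp only [RExp.eval]
    rw [he fun a h => hr a (Or.inl h), hf fun a h => hr a (Or.inr h)]
  | sqrt e he =>
    simp only [RExp.eval]
    rw [he hr]

/-- The sum of the expressions `f b` over a list. -/
def sumList {ι : Type*} (f : ι → RExp) : List ι → RExp
  | [] => 0
  | b :: l => f b + sumList f l

@[simp] theorem eval_sumList {ι : Type*} (f : ι → RExp) (l : List ι) :
    (sumList f l).eval s = (l.map fun b => (f b).eval s).sum := by
  induction l with
  | nil => simp [sumList]
  | cons b l ih => simp [sumList, ih]

end RExp

namespace Test

/-- The conjunction of the tests `f b` over a list. -/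
def all {ι : Type*} (f : ι → Test) : List ι → Test
  | [] => .wordLt 0 1
  | b :: l => .conj (f b) (all f l)

/-- `e ≤ f` for reals. -/
abbrev realLe (e f : RExp) : Test := .neg (.realLt f e)

variable (s : Mem)

@[simp] theorem eval_wordLt (e f : WExp) : (Test.wordLt e f).eval s ↔ e.eval s < f.eval s := Iff.rfl
@[simp] theorem eval_realLt (e f : RExp) : (Test.realLt e f).eval s ↔ e.eval s < f.eval s := Iff.rfl
@[simp] theorem eval_neg (b : Test) : (Test.neg b).eval s ↔ ¬ b.eval s := Iff.rfl
@[simp] theorem eval_conj (b c : Test) : (Test.conj b c).eval s ↔ b.eval s ∧ c.eval s := Iff.rfl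

@[simp] theorem eval_all {ι : Type*} (f : ι → Test) (l : List ι) :
    (all f l).eval s ↔ ∀ b ∈ l, (f b).eval s := by
  induction l with
  | nil => simp [all]
  | cons b l ih => simp [all, ih]

end Test

/-! ### Deterministic runs -/

namespace Cmd

/-- Word array `a` is a target of the command. -/
def WritesWord (a : ℕ) : Cmd → Prop
  | .skip => False
  | .setWord b _ _ => a = b
  | .setReal _ _ _ => False
  | .rand b _ _ => a = b
  | .solve _ _ _ _ => False
  | .seq c d => c.WritesWord a ∨ d.WritesWord a
  | .ite _ c d => c.WritesWord a ∨ d.WritesWord a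
  | .loop _ c => c.WritesWord a

/-- Real array `a` is a target of the command. -/
def WritesReal (a : ℕ) : Cmd → Prop
  | .skip => False
  | .setWord _ _ _ => False
  | .setReal b _ _ => a = b
  | .rand _ _ _ => False
  | .solve _ _ _ out => a = out
  | .seq c d => c.WritesReal a ∨ d.WritesReal a
  | .ite _ c d => c.WritesReal a ∨ d.WritesReal a
  | .loop _ c => c.WritesReal a

/-- The two memories agree on all arrays that the command does not write. -/
def Same (c : Cmd) (s t : Mem) : Prop :=
  (∀ a, ¬ c.WritesWord a → t.word a = s.word a) ∧ ∀ a, ¬ c.WritesReal a → t.real a = s.real a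

theorem Same.refl (c : Cmd) (s : Mem) : c.Same s s := ⟨fun _ _ => rfl, fun _ _ => rfl⟩

theorem Same.trans {c : Cmd} {s t u : Mem} (h : c.Same s t) (h' : c.Same t u) : c.Same s u :=
  ⟨fun a ha => (h'.1 a ha).trans (h.1 a ha), fun a ha => (h'.2 a ha).trans (h.2 a ha)⟩

theorem Same.mono {c d : Cmd} {s t : Mem} (h : c.Same s t)
    (hw : ∀ a, c.WritesWord a → d.WritesWord a) (hr : ∀ a, c.WritesReal a → d.WritesReal a) :
    d.Same s t :=
  ⟨fun a ha => h.1 a fun h => ha (hw a h), fun a ha => h.2 a fun h => ha (hr a h)⟩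

/-- The command runs deterministically from `s` to `s'` in `n` steps. -/
def Runs (W : ℕ) (o : Solver) (c : Cmd) (s : Mem) (n : ℕ) (s' : Mem) : Prop :=
  ∀ t, n ≤ t → c.run W o t s = PMF.pure (some (s', t - n))

/-- The command runs deterministically from `s` in at most `n` steps to a memory with property `Q`,
and writes no array that is not a target of it. -/
def Ends (W : ℕ) (o : Solver) (c : Cmd) (s : Mem) (n : ℕ) (Q : Mem → Prop) : Prop :=
  ∃ s' n', n' ≤ n ∧ c.Runs W o s n' s' ∧ c.Same s s' ∧ Q s'

variable {W : ℕ} {o : Solver} {c d : Cmd} {s : Mem} {n n' : ℕ} {Q Q' : Mem → Prop}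

theorem Ends.mono (h : c.Ends W o s n Q) (hn : n ≤ n') (hQ : ∀ t, c.Same s t → Q t → Q' t) :
    c.Ends W o s n' Q' := by
  obtain ⟨s', k, hk, hr, hs, hq⟩ := h
  exact ⟨s', k, hk.trans hn, hr, hs, hQ s' hs hq⟩

theorem runs_pay {k : ℕ} {s' : Mem} (h : ∀ t, c.run W o t s = Run.pay k t s') :
    c.Runs W o s k s' := by
  intro t ht
  rw [h, Run.pay, if_pos ht]

theorem ends_skip (hn : 1 ≤ n) (hQ : Q s) : Cmd.skip.Ends W o s n Q :=
  ⟨s, 1, hn, runs_pay fun _ => rfl, Same.refl _ _, hQ⟩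

theorem ends_setWord {a : ℕ} {i e : WExp} (hn : 1 ≤ n) (hW : e.eval s ≤ W)
    (hQ : Q (s.setWord a (i.eval s) (e.eval s))) : (Cmd.setWord a i e).Ends W o s n Q := by
  refine ⟨s.setWord a (i.eval s) (e.eval s), 1, hn, runs_pay fun t => ?_,
    ⟨fun b hb => ?_, fun b _ => rfl⟩, hQ⟩
  · rw [Cmd.run, if_pos hW]
  · exact Mem.setWord_word_of_ne _ _ _ _ _ hb

theorem ends_setReal {a : ℕ} {i : WExp} {e : RExp} (hn : 1 ≤ n)
    (hQ : Q (s.setReal a (i.eval s) (e.eval s))) : (Cmd.setReal a i e).Ends W o s n Q :=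
  ⟨_, 1, hn, runs_pay fun _ => rfl,
    ⟨fun _ _ => rfl, fun _ hb => Mem.setReal_real_of_ne _ _ _ _ _ hb⟩, hQ⟩

theorem ends_solve {e : WExp} {pts wts out : ℕ} (hn : 1 + o.time (e.eval s) ≤ n)
    (hQ : Q (s.copyReal out o.outLen (o.answer (e.eval s) (s.real pts) (s.real wts)))) :
    (Cmd.solve e pts wts out).Ends W o s n Q := by
  refine ⟨_, _, hn, runs_pay fun _ => rfl, ⟨fun _ _ => rfl, fun b hb => ?_⟩, hQ⟩
  exact Function.update_of_ne hb _ _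

theorem Runs.seq {k k' : ℕ} {s₁ s₂ : Mem} (h : c.Runs W o s k s₁) (h' : d.Runs W o s₁ k' s₂) :
    (Cmd.seq c d).Runs W o s (k + k') s₂ := by
  intro t ht
  rw [Cmd.run, h t (by omega), Run.andThen, PMF.pure_bind]
  simp only
  rw [h' _ (by omega), Nat.sub_sub]

theorem ends_seq {R : Mem → Prop} (h : c.Ends W o s n R)
    (h' : ∀ t, c.Same s t → R t → d.Ends W o t n' Q) :
    (Cmd.seq c d).Ends W o s (n + n') Q := by
  obtain ⟨s₁, k, hk, hr, hs, hR⟩ := h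
  obtain ⟨s₂, k', hk', hr', hs', hQ⟩ := h' s₁ hs hR
  refine ⟨s₂, k + k', by omega, hr.seq hr', ?_, hQ⟩
  exact (hs.mono (fun _ => Or.inl) fun _ => Or.inl).trans
    (hs'.mono (fun _ => Or.inr) fun _ => Or.inr)

/-- Run `c` and then `d`, with a bound for the total number of steps. -/
theorem ends_seq_le {R : Mem → Prop} {k : ℕ} (h : c.Ends W o s n R) (hk : n + n' ≤ k)
    (h' : ∀ t, c.Same s t → R t → d.Ends W o t n' Q) :
    (Cmd.seq c d).Ends W o s k Q :=
  (ends_seq h h').mono hk fun _ _ h => h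

theorem ends_seq_setWord {a : ℕ} {i e : WExp} (hW : e.eval s ≤ W)
    (h : d.Ends W o (s.setWord a (i.eval s) (e.eval s)) n Q) :
    (Cmd.seq (.setWord a i e) d).Ends W o s (n + 1) Q :=
  ends_seq_le (R := fun t => t = s.setWord a (i.eval s) (e.eval s)) (ends_setWord le_rfl hW rfl)
    (Nat.add_comm _ _).le fun _ _ ht => ht ▸ h

theorem ends_seq_setReal {a : ℕ} {i : WExp} {e : RExp}
    (h : d.Ends W o (s.setReal a (i.eval s) (e.eval s)) n Q) :
    (Cmd.seq (.setReal a i e) d).Ends W o s (n + 1) Q :=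
  ends_seq_le (R := fun t => t = s.setReal a (i.eval s) (e.eval s)) (ends_setReal le_rfl rfl)
    (Nat.add_comm _ _).le fun _ _ ht => ht ▸ h

theorem ends_ite {b : Test} (h : b.eval s → c.Ends W o s n Q) (h' : ¬ b.eval s → d.Ends W o s n Q) :
    (Cmd.ite b c d).Ends W o s (n + 1) Q := by
  by_cases hb : b.eval s
  · obtain ⟨s', k, hk, hr, hs, hq⟩ := h hb
    refine ⟨s', k + 1, by omega, ?_, hs.mono (fun _ => Or.inl) fun _ => Or.inl, hq⟩
    intro t ht
    obtain ⟨t, rfl⟩ : ∃ u, t = u + 1 := ⟨t - 1, by omega⟩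
    rw [Cmd.run, if_pos hb, hr _ (by omega)]
    simp
  · obtain ⟨s', k, hk, hr, hs, hq⟩ := h' hb
    refine ⟨s', k + 1, by omega, ?_, hs.mono (fun _ => Or.inr) fun _ => Or.inr, hq⟩
    intro t ht
    obtain ⟨t, rfl⟩ : ∃ u, t = u + 1 := ⟨t - 1, by omega⟩
    rw [Cmd.run, if_neg hb, hr _ (by omega)]
    simp

/-- A loop whose body, in every state with the invariant `I k`, decreases the rank `k` by more than
its number of steps. -/
theorem ends_loop_rank {b : Test} (I : ℕ → Mem → Prop) {k : ℕ} (h0 : I k s)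
    (hstep : ∀ k t, c.Same s t → I k t → b.eval t →
      ∃ n, c.Ends W o t n fun t' => ∃ k', I k' t' ∧ n + 1 + k' ≤ k) :
    (Cmd.loop b c).Ends W o s (k + 1) fun t => ∃ k', I k' t ∧ ¬ b.eval t := by
  -- The recursion argument `f` of `Run.iterate` is kept apart from the budget `u`: a round lowers
  -- `f` by one, but `u` by one plus the cost of the body. The induction runs over a bound `K` for
  -- the rank.
  suffices H : ∀ K k (t : Mem), c.Same s t → I k t → k ≤ K → ∃ s' n', n' ≤ k + 1 ∧
      (∀ u f, n' ≤ u → u ≤ f → Run.iterate (fun s' => b.eval s') (fun t' s' => c.run W o t' s') f u t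
        = PMF.pure (some (s', u - n'))) ∧ c.Same t s' ∧ ∃ k', I k' s' ∧ ¬ b.eval s' by
    obtain ⟨s', n', hn, hr, hs, hI⟩ := H k k s (Same.refl _ _) h0 le_rfl
    refine ⟨s', n', hn, fun t ht => ?_, hs, hI⟩
    rw [Cmd.run]
    exact hr t t ht le_rfl
  intro K
  induction K with
  | zero =>
    intro k t hst ht hk
    -- At rank `0` no round can be paid for, so the test has to fail.
    have hb : ¬ b.eval t := fun hb => by
      obtain ⟨n, _, _, _, _, _, _, _, h⟩ := hstep k t hst ht hb
      omega
    refine ⟨t, 1, by omega, fun u f hu hf => ?_, Same.refl _ _, k, ht, hb⟩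
    obtain ⟨u, rfl⟩ : ∃ v, u = v + 1 := ⟨u - 1, by omega⟩
    obtain ⟨f, rfl⟩ : ∃ v, f = v + 1 := ⟨f - 1, by omega⟩
    rw [Run.iterate, if_neg hb]
    simp
  | succ K ih =>
    intro k t hst ht hk
    by_cases hb : b.eval t
    · obtain ⟨n, t', n', hn', hr, hs, k', hI, hΦ⟩ := hstep k t hst ht hb
      obtain ⟨s', m, hm, hr', hs', hI'⟩ := ih k' t' (hst.trans hs) hI (by omega)
      refine ⟨s', n' + 1 + m, by omega, fun u f hu hf => ?_, hs.trans hs', hI'⟩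
      obtain ⟨u, rfl⟩ : ∃ v, u = v + 1 := ⟨u - 1, by omega⟩
      obtain ⟨f, rfl⟩ : ∃ v, f = v + 1 := ⟨f - 1, by omega⟩
      rw [Run.iterate, if_pos hb, hr _ (by omega), Run.andThen, PMF.pure_bind]
      simp only
      rw [hr' _ _ (by omega) (by omega)]
      congr 3
      omega
    · refine ⟨t, 1, by omega, fun u f hu hf => ?_, Same.refl _ _, k, ht, hb⟩
      obtain ⟨u, rfl⟩ : ∃ v, u = v + 1 := ⟨u - 1, by omega⟩
      obtain ⟨f, rfl⟩ : ∃ v, f = v + 1 := ⟨f - 1, by omega⟩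
      rw [Run.iterate, if_neg hb]
      simp

/-- A loop whose body, in every state with the invariant `I`, decreases the potential `Φ` by
more than its number of steps. -/
theorem ends_loop {b : Test} (I : Mem → Prop) (Φ : Mem → ℕ) (h0 : I s)
    (hstep : ∀ t, c.Same s t → I t → b.eval t →
      ∃ n, c.Ends W o t n fun t' => I t' ∧ n + 1 + Φ t' ≤ Φ t) :
    (Cmd.loop b c).Ends W o s (Φ s + 1) fun t => I t ∧ ¬ b.eval t := by
  refine (ends_loop_rank (fun k t => I t ∧ k = Φ t) ⟨h0, rfl⟩ ?_).mono le_rfl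
    fun t _ ⟨k, h1, h2⟩ => ⟨h1.1, h2⟩
  rintro k t hs ⟨h1, rfl⟩ hb
  obtain ⟨n, hn⟩ := hstep t hs h1 hb
  exact ⟨n, hn.mono le_rfl fun t' _ h => ⟨Φ t', ⟨h.1, rfl⟩, h.2⟩⟩

/-- `for i < e do c`, with the counter in entry `0` of word array `i`. -/
def forTo (i : ℕ) (e : WExp) (c : Cmd) : Cmd :=
  .seq (.setWord i 0 0) (.loop (.wordLt (.var i) e) (.seq c (.setWord i 0 (.var i + 1))))

/-- A round costs `C` for the body, one for the increment and one for the test; the extra `2` pays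
for the initial assignment and the last test. The body has to establish the next invariant for the
memory in which the counter is already advanced, because the increment belongs to the loop. -/
theorem ends_forTo {i m C : ℕ} {e : WExp} (I : ℕ → Mem → Prop) (hc : ¬ c.WritesWord i)
    (he : ∀ t, (forTo i e c).Same s t → e.eval t = m) (hW : m ≤ W)
    (h0 : I 0 (s.setWord i 0 0))
    (hstep : ∀ j < m, ∀ t, (forTo i e c).Same s t → t.word i 0 = j → I j t →
      c.Ends W o t C fun t' => I (j + 1) (t'.setWord i 0 (j + 1))) :
    (forTo i e c).Ends W o s ((C + 2) * m + 2) (I m) := by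
  have hmono : ∀ t t', (Cmd.setWord i 0 0).Same s t →
      (Cmd.seq c (.setWord i 0 (.var i + 1))).Same t t' → (forTo i e c).Same s t' := fun t t' h h' =>
    (h.mono (fun _ => Or.inl) fun _ => Or.inl).trans (h'.mono (fun _ => Or.inr) fun _ => Or.inr)
  refine ends_seq_le (n := 1) (n' := (C + 2) * m + 1)
    (R := fun t => t.word i 0 = 0 ∧ I 0 t) (ends_setWord le_rfl (by simp) (by simpa using h0))
    (by omega) ?_
  rintro t hst ⟨ht, hIt⟩
  have := ends_loop (W := W) (o := o) (s := t) (b := .wordLt (.var i) e)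
    (c := .seq c (.setWord i 0 (.var i + 1)))
    (fun t => t.word i 0 ≤ m ∧ I (t.word i 0) t) (fun t => (C + 2) * (m - t.word i 0))
    ⟨by omega, by rwa [ht]⟩ ?_
  · refine (this.mono (by simp [ht]) ?_)
    rintro t' hs ⟨⟨h1, h2⟩, h3⟩
    have := he t' (hmono t t' hst hs)
    simp only [Test.eval_wordLt, WExp.eval_get, WExp.eval_const] at h3
    have h4 : t'.word i 0 = m := by omega
    rwa [h4] at h2
  · rintro t₁ hs ⟨h1, h2⟩ h3
    have hm := hmono t t₁ hst hs
    simp only [Test.eval_wordLt, WExp.eval_get, WExp.eval_const, he t₁ hm] at h3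
    refine ⟨C + 1, ends_seq_le (hstep _ h3 t₁ hm rfl h2) le_rfl ?_⟩
    intro t₂ hs₂ hI
    have hw : t₂.word i = t₁.word i := hs₂.1 i hc
    refine ends_setWord le_rfl ?_ ?_
    · simp [hw]; omega
    · simp only [WExp.eval_ofNat, WExp.eval_add, WExp.eval_get, WExp.eval_const,
        Mem.setWord_word_self, hw, Function.update_self]
      refine ⟨⟨by omega, hI⟩, ?_⟩
      obtain ⟨k, hk⟩ : ∃ k, m = t₁.word i 0 + 1 + k := ⟨m - t₁.word i 0 - 1, by omega⟩
      rw [hk, show t₁.word i 0 + 1 + k - (t₁.word i 0 + 1) = k by omega,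
        show t₁.word i 0 + 1 + k - t₁.word i 0 = k + 1 by omega]
      ring_nf; omega

/-- Run the commands `f b` for the elements `b` of a list. -/
def forEach {ι : Type*} (f : ι → Cmd) : List ι → Cmd
  | [] => .skip
  | b :: l => .seq (f b) (forEach f l)

theorem writesWord_forEach {ι : Type*} {f : ι → Cmd} {l : List ι} {a : ℕ} :
    (forEach f l).WritesWord a ↔ ∃ b ∈ l, (f b).WritesWord a := by
  induction l with
  | nil => simp [forEach, WritesWord]
  | cons b l ih => simp [forEach, WritesWord, ih]

theorem writesReal_forEach {ι : Type*} {f : ι → Cmd} {l : List ι} {a : ℕ} :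
    (forEach f l).WritesReal a ↔ ∃ b ∈ l, (f b).WritesReal a := by
  induction l with
  | nil => simp [forEach, WritesReal]
  | cons b l ih => simp [forEach, WritesReal, ih]

/-- The invariant speaks about the part of the list that is already processed. The last step is the
final `skip`. -/
theorem ends_forEach {ι : Type*} {f : ι → Cmd} {C : ℕ} (I : List ι → Mem → Prop) (l : List ι)
    (h0 : I [] s)
    (hstep : ∀ l₁ b l₂, l = l₁ ++ b :: l₂ → ∀ t, (forEach f l).Same s t → I l₁ t →
      (f b).Ends W o t C fun t' => I (l₁ ++ [b]) t') :
    (forEach f l).Ends W o s (C * l.length + 1) (I l) := by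
  suffices H : ∀ l₂ l₁, l = l₁ ++ l₂ → ∀ t, (forEach f l).Same s t → I l₁ t →
      (forEach f l₂).Ends W o t (C * l₂.length + 1) (I l) from H l [] rfl s (Same.refl _ _) h0
  intro l₂
  induction l₂ with
  | nil =>
    rintro l₁ h t - hI
    rw [List.append_nil] at h
    exact ends_skip (by simp) (h ▸ hI)
  | cons b l₂ ih =>
    intro l₁ h t hst hI
    refine ends_seq_le (hstep l₁ b l₂ h t hst hI) ?_ fun t' hs' hI' =>
      ih (l₁ ++ [b]) (by simp [h]) t' ?_ hI'
    · simp only [List.length_cons, Nat.mul_succ]; omega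
    · refine hst.trans (hs'.mono (fun a ha => ?_) fun a ha => ?_)
      · exact writesWord_forEach.2 ⟨b, by simp [h], ha⟩
      · exact writesReal_forEach.2 ⟨b, by simp [h], ha⟩

section writes
variable (a b i : ℕ) (e f : WExp) (g : RExp) (t : Test)
@[simp] theorem writesWord_skip : Cmd.skip.WritesWord a ↔ False := Iff.rfl
@[simp] theorem writesReal_skip : Cmd.skip.WritesReal a ↔ False := Iff.rfl
@[simp] theorem writesWord_setWord : (Cmd.setWord b e f).WritesWord a ↔ a = b := Iff.rfl
@[simp] theorem writesReal_setWord : (Cmd.setWord b e f).WritesReal a ↔ False := Iff.rfl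
@[simp] theorem writesWord_setReal : (Cmd.setReal b e g).WritesWord a ↔ False := Iff.rfl
@[simp] theorem writesReal_setReal : (Cmd.setReal b e g).WritesReal a ↔ a = b := Iff.rfl
@[simp] theorem writesWord_solve (p w : ℕ) : (Cmd.solve e p w b).WritesWord a ↔ False := Iff.rfl
@[simp] theorem writesReal_solve (p w : ℕ) : (Cmd.solve e p w b).WritesReal a ↔ a = b := Iff.rfl
@[simp] theorem writesWord_seq : (Cmd.seq c d).WritesWord a ↔ c.WritesWord a ∨ d.WritesWord a :=
  Iff.rfl
@[simp] theorem writesReal_seq : (Cmd.seq c d).WritesReal a ↔ c.WritesReal a ∨ d.WritesReal a :=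
  Iff.rfl
@[simp] theorem writesWord_ite : (Cmd.ite t c d).WritesWord a ↔ c.WritesWord a ∨ d.WritesWord a :=
  Iff.rfl
@[simp] theorem writesReal_ite : (Cmd.ite t c d).WritesReal a ↔ c.WritesReal a ∨ d.WritesReal a :=
  Iff.rfl
@[simp] theorem writesWord_loop : (Cmd.loop t c).WritesWord a ↔ c.WritesWord a := Iff.rfl
@[simp] theorem writesReal_loop : (Cmd.loop t c).WritesReal a ↔ c.WritesReal a := Iff.rfl
@[simp] theorem writesWord_forTo : (forTo i e c).WritesWord a ↔ a = i ∨ c.WritesWord a := by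
  simp [forTo]; tauto
@[simp] theorem writesReal_forTo : (forTo i e c).WritesReal a ↔ c.WritesReal a := by
  simp [forTo]
end writes

/-- A deterministic run that ends in time succeeds with any probability. -/
theorem Ends.succeeds {t : ℕ} {δ : ℝ} {good : Mem → Prop} (h : c.Ends W o s t good) (hδ : 0 ≤ δ) :
    c.Succeeds W o t s δ good := by
  obtain ⟨s', n', hn, hr, -, hg⟩ := h
  have := hr t hn
  refine ⟨by simp [this], ?_⟩
  rw [this, PMF.toOuterMeasure_pure_apply, if_pos ⟨s', _, rfl, hg⟩]
  simpa using hδ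

end Cmd

/-! ### Lists of vectors in memory -/

/-- The array holds the vectors of the list one after the other. -/
def HoldsVecs {d : ℕ} (f : ℕ → ℝ) (l : List (Fin d → ℝ)) : Prop :=
  ∀ (i : ℕ) (h : i < l.length) (b : Fin d), f (i * d + b) = l[i] b

theorem HoldsVecs.append {d : ℕ} {f g : ℕ → ℝ} {l : List (Fin d → ℝ)} {v : Fin d → ℝ} (h : HoldsVecs f l)
    (hg : ∀ b : Fin d, g (l.length * d + b) = v b)
    (hfg : ∀ i, (∀ b : Fin d, i ≠ l.length * d + b) → g i = f i) : HoldsVecs g (l ++ [v]) := by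
  intro i hi b
  rw [List.length_append, List.length_singleton] at hi
  rcases Nat.lt_succ_iff_lt_or_eq.1 hi with h' | h'
  · rw [List.getElem_append_left h', hfg, h i h' b]
    intro b'
    -- Block `i` ends before the new block begins, so it is untouched.
    have h1 : (i + 1) * d ≤ l.length * d := Nat.mul_le_mul_right _ h'
    have h2 := b.2
    rw [add_mul] at h1
    omega
  · subst h'
    simp [hg]

/-! ### Programs that store and append vectors. -/

namespace Cmd

variable {W : ℕ} {o : Solver} {s : Mem} {Q : Mem → Prop} {d : ℕ}

/-- Store a vector as the `idx`-th vector of real array `a`. -/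
def setVec (a : ℕ) (idx : WExp) (f : Fin d → RExp) : Cmd :=
  forEach (fun b : Fin d => .setReal a (idx * .const d + .const b) (f b)) (List.finRange d)

theorem writesWord_setVec {a b : ℕ} {idx : WExp} {f : Fin d → RExp} :
    ¬ (setVec a idx f).WritesWord b := by
  simp [setVec, writesWord_forEach]

theorem writesReal_setVec {a b : ℕ} {idx : WExp} {f : Fin d → RExp}
    (h : (setVec a idx f).WritesReal b) : b = a := by
  simp only [setVec, writesReal_forEach] at h
  obtain ⟨_, _, h⟩ := h
  exact h

/-- The coordinates are written one by one; since no `f b` reads the target array, every expression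
still has its value in the initial memory when its turn comes. -/
theorem ends_setVec {a : ℕ} {idx : WExp} {f : Fin d → RExp} (hf : ∀ b, ¬ (f b).Reads a)
    (hQ : ∀ t, t.word = s.word → (∀ b, b ≠ a → t.real b = s.real b) →
      (∀ b : Fin d, t.real a (idx.eval s * d + b) = (f b).eval s) →
      (∀ i, (∀ b : Fin d, i ≠ idx.eval s * d + b) → t.real a i = s.real a i) → Q t) :
    (setVec a idx f).Ends W o s (d + 1) Q := by
  have hw : ∀ t, (setVec a idx f).Same s t → t.word = s.word := fun t h =>
    funext fun b => h.1 b writesWord_setVec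
  have hr : ∀ t, (setVec a idx f).Same s t → ∀ b, b ≠ a → t.real b = s.real b := fun t h b hb =>
    h.2 b fun h => hb (writesReal_setVec h)
  have key := ends_forEach (W := W) (o := o) (s := s) (C := 1)
    (f := fun b : Fin d => .setReal a (idx * .const d + .const b) (f b))
    (fun l t => (∀ b ∈ l, t.real a (idx.eval s * d + (b : Fin d)) = (f b).eval s) ∧
      ∀ i, (∀ b ∈ l, i ≠ idx.eval s * d + (b : Fin d)) → t.real a i = s.real a i)
    (List.finRange d) (by simp) ?_
  · refine key.mono (by simp) fun t hs ht => hQ t (hw t hs) (hr t hs) (fun b => ht.1 b (by simp))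
      fun i hi => ht.2 i fun b _ => hi b
  · rintro l₁ b l₂ - t hs ⟨h1, h2⟩
    have he : idx.eval t = idx.eval s := WExp.eval_congr (hw t hs) _
    have hb : (f b).eval t = (f b).eval s := RExp.eval_congr _ (hw t hs) fun c hc =>
      hr t hs c fun h => hf b (h ▸ hc)
    refine ends_setReal le_rfl ⟨fun b' hb' => ?_, fun i hi => ?_⟩
    · simp only [WExp.eval_add, WExp.eval_mul, WExp.eval_const, he, hb, Mem.setReal_real_self,
        Function.update_apply]
      split_ifs with h
      · have : b' = b := Fin.ext (by omega)
        rw [this]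
      · rcases List.mem_append.1 hb' with hb' | hb'
        · exact h1 b' hb'
        · simp only [List.mem_singleton] at hb'
          exact absurd (by rw [hb']) h
    · simp only [WExp.eval_add, WExp.eval_mul, WExp.eval_const, he, Mem.setReal_real_self]
      rw [Function.update_of_ne (hi b (by simp))]
      exact h2 i fun b' hb' => hi b' (by simp [hb'])

/-- Append a vector to the list of vectors in real array `a` whose length is word variable `n`. -/
def pushVec (a n : ℕ) (f : Fin d → RExp) : Cmd :=
  .seq (setVec a (.var n) f) (.setWord n 0 (.var n + 1))

theorem writesWord_pushVec {a n b : ℕ} {f : Fin d → RExp} :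
    (pushVec a n f).WritesWord b ↔ b = n := by
  simp [pushVec, writesWord_setVec]

theorem writesReal_pushVec {a n b : ℕ} {f : Fin d → RExp} (h : (pushVec a n f).WritesReal b) :
    b = a := by
  simp only [pushVec, writesReal_seq, writesReal_setWord, or_false] at h
  exact writesReal_setVec h

theorem ends_pushVec {a n : ℕ} {f : Fin d → RExp} {l : List (Fin d → ℝ)}
    (hf : ∀ b, ¬ (f b).Reads a) (hn : s.word n 0 = l.length) (hW : l.length + 1 ≤ W)
    (hl : HoldsVecs (s.real a) l)
    (hQ : ∀ t, (∀ b, b ≠ n → t.word b = s.word b) → (∀ b, b ≠ a → t.real b = s.real b) →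
      t.word n 0 = (l ++ [fun b => (f b).eval s]).length →
      HoldsVecs (t.real a) (l ++ [fun b => (f b).eval s]) → Q t) :
    (pushVec a n f).Ends W o s (d + 2) Q := by
  refine ends_seq_le (n := d + 1) (n' := 1) (ends_setVec hf fun t h1 h2 h3 h4 =>
    (⟨h1, h2, h3, h4⟩ : _ ∧ _ ∧ _ ∧ _)) le_rfl ?_
  rintro t - ⟨h1, h2, h3, h4⟩
  refine ends_setWord le_rfl (by simp [h1, hn, hW]) (hQ _ ?_ ?_ ?_ ?_)
  · intro b hb
    simp [hb, h1]
  · intro b hb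
    simp [h2 b hb]
  · simp [h1, hn]
  · simp only [WExp.eval_get, WExp.eval_const, hn] at h3 h4
    exact hl.append h3 h4

end Cmd

/-! ### Sorting -/

/-- The state of the merge of the sorted blocks `[lo, mid)` and `[mid, hi)` of `A` into `B`, when the
positions before `o` are filled and `i`, `j` are the next positions of the two blocks. The entries
are compared by their values under `V`; all blocks are cut off at `M`. -/
structure MergeState (V : ℕ → ℝ) (A B : ℕ → ℕ) (M lo mid hi o i j : ℕ) : Prop where
  lo_le : lo ≤ i
  le_mid : i ≤ mid
  mid_le : mid ≤ j
  le_hi : j ≤ hi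
  le_or : j ≤ M ∨ j = mid
  add_eq : i + j = o + mid
  sorted : ∀ p q, lo ≤ p → p < q → q < o → V (B p) ≤ V (B q)
  left_mem : ∀ p, lo ≤ p → p < i → ∃ q < o, B q = A p
  right_mem : ∀ p, mid ≤ p → p < j → ∃ q < o, B q = A p
  le_left : ∀ q, lo ≤ q → q < o → ∀ p, i ≤ p → p < mid → p < M → V (B q) ≤ V (A p)
  le_right : ∀ q, lo ≤ q → q < o → ∀ p, j ≤ p → p < hi → p < M → V (B q) ≤ V (A p)

namespace MergeState

variable {V : ℕ → ℝ} {A B : ℕ → ℕ} {M lo mid hi o i j : ℕ}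

theorem init (h₁ : lo ≤ mid) (h₂ : mid ≤ hi) : MergeState V A B M lo mid hi lo lo mid := by
  constructor <;> intros <;> omega

/-- Both blocks are sorted, so the smaller of the two heads is a minimum of everything not yet
placed. The clauses `le_left` and `le_right`, placed entries are at most unplaced ones, are what
keeps the output sorted when it is appended. -/
theorem step_left (h : MergeState V A B M lo mid hi o i j) (ho : o < M) (hi' : i < mid)
    (hA : ∀ p q, lo ≤ p → p < q → q < mid → q < M → V (A p) ≤ V (A q))
    (hA' : ∀ p q, mid ≤ p → p < q → q < hi → q < M → V (A p) ≤ V (A q))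
    (hij : j < hi → j < M → V (A i) ≤ V (A j)) :
    i < M ∧ MergeState V A (Function.update B o (A i)) M lo mid hi (o + 1) (i + 1) j := by
  have hiM : i < M := by have := h.add_eq; have := h.mid_le; omega
  have hlo : lo ≤ o := by have := h.add_eq; have := h.mid_le; have := h.lo_le; omega
  refine ⟨hiM, ?_⟩
  have hu : ∀ q, q < o → Function.update B o (A i) q = B q := fun q hq =>
    Function.update_of_ne (by omega) _ _
  have key : ∀ q, lo ≤ q → q < o + 1 → Function.update B o (A i) q = A i ∧ q = o ∨
      q < o ∧ Function.update B o (A i) q = B q := by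
    intro q _ hq
    rcases Nat.lt_succ_iff_lt_or_eq.1 hq with h | h
    · exact Or.inr ⟨h, hu q h⟩
    · exact Or.inl ⟨by simp [h], h⟩
  have hiA : ∀ p, i ≤ p → p < mid → p < M → V (A i) ≤ V (A p) := by
    intro p h1 h2 h3
    rcases h1.eq_or_lt with rfl | h1
    · rfl
    · exact hA i p h.lo_le h1 h2 h3
  have hjA : ∀ p, j ≤ p → p < hi → p < M → V (A i) ≤ V (A p) := by
    intro p h1 h2 h3
    refine (hij (by omega) (by omega)).trans ?_
    rcases h1.eq_or_lt with rfl | h1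
    · rfl
    · exact hA' j p h.mid_le h1 h2 h3
  constructor
  · have := h.lo_le; omega
  · omega
  · exact h.mid_le
  · exact h.le_hi
  · exact h.le_or
  · have := h.add_eq; omega
  · intro p q h1 h2 h3
    rw [hu p (by omega)]
    rcases key q (by omega) h3 with ⟨h4, -⟩ | ⟨h4, h5⟩
    · rw [h4]; exact h.le_left p h1 (by omega) i le_rfl hi' hiM
    · rw [h5]; exact h.sorted p q h1 h2 h4
  · intro p h1 h2
    rcases Nat.lt_succ_iff_lt_or_eq.1 h2 with h3 | rfl
    · obtain ⟨q, hq, hq'⟩ := h.left_mem p h1 h3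
      exact ⟨q, by omega, by rw [hu q hq, hq']⟩
    · exact ⟨o, by omega, by simp⟩
  · intro p h1 h2
    obtain ⟨q, hq, hq'⟩ := h.right_mem p h1 h2
    exact ⟨q, by omega, by rw [hu q hq, hq']⟩
  · intro q h1 h2 p h3 h4 h5
    rcases key q h1 h2 with ⟨h6, -⟩ | ⟨h6, h7⟩
    · rw [h6]; exact hiA p (by omega) h4 h5
    · rw [h7]; exact h.le_left q h1 h6 p (by omega) h4 h5
  · intro q h1 h2 p h3 h4 h5
    rcases key q h1 h2 with ⟨h6, -⟩ | ⟨h6, h7⟩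
    · rw [h6]; exact hjA p h3 h4 h5
    · rw [h7]; exact h.le_right q h1 h6 p h3 h4 h5

/-- The mirror image of `step_left`. If the left block is exhausted, nothing has to be compared:
then `i = mid`, and `i + j = o + mid` gives `j = o`, which is in range. -/
theorem step_right (h : MergeState V A B M lo mid hi o i j) (ho : o < M) (ho' : o < hi)
    (hA : ∀ p q, lo ≤ p → p < q → q < mid → q < M → V (A p) ≤ V (A q))
    (hA' : ∀ p q, mid ≤ p → p < q → q < hi → q < M → V (A p) ≤ V (A q))
    (hij : i < mid → j < hi ∧ j < M ∧ V (A j) ≤ V (A i)) :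
    j < M ∧ MergeState V A (Function.update B o (A j)) M lo mid hi (o + 1) i (j + 1) := by
  have hjM : j < hi ∧ j < M := by
    by_cases hi' : i < mid
    · exact ⟨(hij hi').1, (hij hi').2.1⟩
    · have := h.add_eq; have := h.le_mid; omega
  have hlo : lo ≤ o := by have := h.add_eq; have := h.mid_le; have := h.lo_le; omega
  refine ⟨hjM.2, ?_⟩
  have hu : ∀ q, q < o → Function.update B o (A j) q = B q := fun q hq =>
    Function.update_of_ne (by omega) _ _
  have key : ∀ q, lo ≤ q → q < o + 1 → Function.update B o (A j) q = A j ∧ q = o ∨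
      q < o ∧ Function.update B o (A j) q = B q := by
    intro q _ hq
    rcases Nat.lt_succ_iff_lt_or_eq.1 hq with h | h
    · exact Or.inr ⟨h, hu q h⟩
    · exact Or.inl ⟨by simp [h], h⟩
  have hjA : ∀ p, j ≤ p → p < hi → p < M → V (A j) ≤ V (A p) := by
    intro p h1 h2 h3
    rcases h1.eq_or_lt with rfl | h1
    · rfl
    · exact hA' j p h.mid_le h1 h2 h3
  have hiA : ∀ p, i ≤ p → p < mid → p < M → V (A j) ≤ V (A p) := by
    intro p h1 h2 h3
    refine (hij (by omega)).2.2.trans ?_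
    rcases h1.eq_or_lt with rfl | h1
    · rfl
    · exact hA i p h.lo_le h1 h2 h3
  constructor
  · exact h.lo_le
  · exact h.le_mid
  · have := h.mid_le; omega
  · omega
  · omega
  · have := h.add_eq; omega
  · intro p q h1 h2 h3
    rw [hu p (by omega)]
    rcases key q (by omega) h3 with ⟨h4, -⟩ | ⟨h4, h5⟩
    · rw [h4]; exact h.le_right p h1 (by omega) j le_rfl hjM.1 hjM.2
    · rw [h5]; exact h.sorted p q h1 h2 h4
  · intro p h1 h2
    obtain ⟨q, hq, hq'⟩ := h.left_mem p h1 h2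
    exact ⟨q, by omega, by rw [hu q hq, hq']⟩
  · intro p h1 h2
    rcases Nat.lt_succ_iff_lt_or_eq.1 h2 with h3 | rfl
    · obtain ⟨q, hq, hq'⟩ := h.right_mem p h1 h3
      exact ⟨q, by omega, by rw [hu q hq, hq']⟩
    · exact ⟨o, by omega, by simp⟩
  · intro q h1 h2 p h3 h4 h5
    rcases key q h1 h2 with ⟨h6, -⟩ | ⟨h6, h7⟩
    · rw [h6]; exact hiA p h3 h4 h5
    · rw [h7]; exact h.le_left q h1 h6 p h3 h4 h5
  · intro q h1 h2 p h3 h4 h5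
    rcases key q h1 h2 with ⟨h6, -⟩ | ⟨h6, h7⟩
    · rw [h6]; exact hjA p (by omega) h4 h5
    · rw [h7]; exact h.le_right q h1 h6 p (by omega) h4 h5

end MergeState

/-- The entries of `A` at the positions below `M` are all numbers below `M`, and they are sorted
by their values under `V` within blocks of length `w`. -/
structure BlockSorted (V : ℕ → ℝ) (A : ℕ → ℕ) (M w : ℕ) : Prop where
  lt : ∀ p < M, A p < M
  surj : ∀ v < M, ∃ p < M, A p = v
  sorted : ∀ p q, p < q → q < M → p / w = q / w → V (A p) ≤ V (A q)

/-- The state of a merging pass of block length `w` before position `o` is filled. -/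
structure PassState (V : ℕ → ℝ) (A B : ℕ → ℕ) (M w b o : ℕ) : Prop where
  le : b * (2 * w) ≤ o
  lt : ∀ q < o, B q < M
  sorted : ∀ p q, p < q → q < b * (2 * w) → p / (2 * w) = q / (2 * w) → V (B p) ≤ V (B q)
  mem : ∀ p < b * (2 * w), ∃ q < o, B q = A p

namespace PassState

variable {V : ℕ → ℝ} {A B : ℕ → ℕ} {M w b o i j : ℕ}

theorem update (h : PassState V A B M w b o) {x : ℕ} (hx : x < M) :
    PassState V A (Function.update B o x) M w b (o + 1) := by
  have hu : ∀ q, q < o → Function.update B o x q = B q := fun q hq =>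
    Function.update_of_ne (by omega) _ _
  have := h.le
  refine ⟨by omega, fun q hq => ?_, fun p q h1 h2 h3 => ?_, fun p hp => ?_⟩
  · rcases Nat.lt_succ_iff_lt_or_eq.1 hq with h1 | h1
    · rw [hu q h1]; exact h.lt q h1
    · simpa [h1]
  · rw [hu p (by omega), hu q (by omega)]; exact h.sorted p q h1 h2 h3
  · obtain ⟨q, hq, hq'⟩ := h.mem p hp
    exact ⟨q, by omega, by rw [hu q hq, hq']⟩

/-- Two positions in the same double block lie either both in the finished part or both in the
current merge. -/
theorem sorted_of_merge (h : PassState V A B M w b o) (hw : 0 < w) {mid hi : ℕ}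
    (hm : MergeState V A B M (b * (2 * w)) mid hi o i j) :
    ∀ p q, p < q → q < o → p / (2 * w) = q / (2 * w) → V (B p) ≤ V (B q) := by
  intro p q h1 h2 h3
  by_cases h4 : q < b * (2 * w)
  · exact h.sorted p q h1 h4 h3
  · refine hm.sorted p q ?_ h1 h2
    have : b ≤ q / (2 * w) := (Nat.le_div_iff_mul_le (by omega)).2 (by omega)
    rw [← h3] at this
    exact (Nat.le_div_iff_mul_le (by omega)).1 this

theorem next (h : PassState V A B M w b o) (hw : 0 < w)
    (hm : MergeState V A B M (b * (2 * w)) (b * (2 * w) + w) (b * (2 * w) + 2 * w) o i j)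
    (ho : o = (b + 1) * (2 * w)) : PassState V A B M w (b + 1) o := by
  refine ⟨ho.ge, h.lt, fun p q h1 h2 h3 => h.sorted_of_merge hw hm p q h1 (ho ▸ h2) h3, ?_⟩
  intro p hp
  have h1 := hm.add_eq; have h2 := hm.le_mid; have h3 := hm.le_hi
  rw [add_mul, one_mul] at ho hp
  by_cases h4 : p < b * (2 * w)
  · exact h.mem p h4
  · by_cases h5 : p < i
    · exact hm.left_mem p (by omega) h5
    · exact hm.right_mem p (by omega) (by omega)

/-- The last double block may be cut off by `M`, and then its merge is still open; if `M` is a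
multiple of `2 * w` there is no open merge, so `hm` is conditional. Each entry of `A` reappears in
`B`, since all positions below `M` of the cut-off blocks have been consumed. -/
theorem blockSorted (h : PassState V A B M w b M) (hw : 0 < w) (hA : BlockSorted V A M w)
    (hm : M ≠ b * (2 * w) →
      MergeState V A B M (b * (2 * w)) (b * (2 * w) + w) (b * (2 * w) + 2 * w) M i j) :
    BlockSorted V B M (2 * w) := by
  by_cases hM : M = b * (2 * w)
  · refine ⟨h.lt, fun v hv => ?_, fun p q h1 h2 h3 => h.sorted p q h1 (hM ▸ h2) h3⟩
    obtain ⟨p, hp, rfl⟩ := hA.surj v hv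
    exact h.mem p (by omega)
  · have hm := hm hM
    refine ⟨h.lt, fun v hv => ?_, h.sorted_of_merge hw hm⟩
    obtain ⟨p, hp, rfl⟩ := hA.surj v hv
    have h1 := hm.add_eq; have h2 := hm.le_mid; have h3 := hm.le_hi; have h6 := hm.le_or
    by_cases h4 : p < b * (2 * w)
    · exact h.mem p h4
    · by_cases h5 : p < i
      · exact hm.left_mem p (by omega) h5
      · exact hm.right_mem p (by omega) (by omega)

end PassState

/-! ### Merge sort and ranking as programs. -/

namespace Cmd

/-- The value of item `e`. -/
abbrev itemVal (e : WExp) : RExp := .get 0 (3 + e)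

/-- Fill position `o` in a merging pass over `M` items. -/
def mergeStep (M : WExp) : Cmd :=
  .seq
    (.ite (.wordLt 0 (.var 5 % (2 * .var 4))) .skip
      (.seq (.setWord 6 0 (.var 5)) (.seq (.setWord 8 0 (.var 5 + .var 4))
        (.seq (.setWord 7 0 (.var 5 + .var 4)) (.setWord 9 0 (.var 5 + 2 * .var 4))))))
    (.ite (.conj (.wordLt (.var 6) (.var 8)) (.neg (.conj (.wordLt (.var 7) (.var 9))
        (.conj (.wordLt (.var 7) M)
          (.realLt (itemVal (.get 2 (.var 7))) (itemVal (.get 2 (.var 6))))))))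
      (.seq (.setWord 3 (.var 5) (.get 2 (.var 6))) (.setWord 6 0 (.var 6 + 1)))
      (.seq (.setWord 3 (.var 5) (.get 2 (.var 7))) (.setWord 7 0 (.var 7 + 1))))

variable {W : ℕ} {o : Solver} {s : Mem}

/-- The merge state is assumed only strictly inside a double block: at its start the program sets
both heads and both block ends afresh. The bound on `W` leaves room for block ends beyond `m`. -/
theorem ends_mergeStep {M : WExp} {m w b k : ℕ} {V : ℕ → ℝ}
    (hM : ∀ t, t.word 0 = s.word 0 → M.eval t = m)
    (hV : ∀ i, V i = s.real 0 (3 + i)) (hw : 0 < w) (hW : 3 * m + 2 * w ≤ W)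
    (h4 : s.word 4 0 = w) (h5 : s.word 5 0 = k) (hk : k < m)
    (hA : BlockSorted V (s.word 2) m w) (hkb : k < (b + 1) * (2 * w))
    (hP : PassState V (s.word 2) (s.word 3) m w b k)
    (hG : k ≠ b * (2 * w) → s.word 8 0 = b * (2 * w) + w ∧ s.word 9 0 = b * (2 * w) + 2 * w ∧
      MergeState V (s.word 2) (s.word 3) m (b * (2 * w)) (b * (2 * w) + w) (b * (2 * w) + 2 * w)
        k (s.word 6 0) (s.word 7 0)) :
    (mergeStep M).Ends W o s 8 fun t =>
      PassState V (s.word 2) (t.word 3) m w b (k + 1) ∧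
      t.word 8 0 = b * (2 * w) + w ∧ t.word 9 0 = b * (2 * w) + 2 * w ∧
      MergeState V (s.word 2) (t.word 3) m (b * (2 * w)) (b * (2 * w) + w) (b * (2 * w) + 2 * w)
        (k + 1) (t.word 6 0) (t.word 7 0) := by
  have hle := hP.le
  have hblock : ∀ c p q, c * w ≤ p → p < q → q < c * w + w → q < m →
      V (s.word 2 p) ≤ V (s.word 2 q) := by
    intro c p q h1 h2 h3 h4
    refine hA.sorted p q h2 h4 ?_
    rw [Nat.div_eq_of_lt_le (k := c) (by omega) (by rw [add_mul, one_mul]; omega),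
      Nat.div_eq_of_lt_le (k := c) (by omega) (by rw [add_mul, one_mul]; omega)]
  have hL := hblock (2 * b)
  have hR := hblock (2 * b + 1)
  rw [add_mul, one_mul] at hkb hR
  rw [show 2 * b * w = b * (2 * w) by ring] at hL hR
  refine ends_seq_le (n := 5) (n' := 3) (R := fun t => t.word 2 = s.word 2 ∧ t.word 3 = s.word 3 ∧
      t.word 8 0 = b * (2 * w) + w ∧ t.word 9 0 = b * (2 * w) + 2 * w ∧
      MergeState V (s.word 2) (s.word 3) m (b * (2 * w)) (b * (2 * w) + w) (b * (2 * w) + 2 * w)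
        k (t.word 6 0) (t.word 7 0)) ?_ le_rfl ?_
  · refine ends_ite (fun h => ends_skip (by omega) ?_) fun h => ?_
    · simp only [Test.eval_wordLt, WExp.eval_ofNat, WExp.eval_mod, WExp.eval_get, WExp.eval_const,
        WExp.eval_mul, h4, h5] at h
      obtain ⟨h1, h2, h3⟩ := hG (by rintro rfl; simp at h)
      exact ⟨rfl, rfl, h1, h2, h3⟩
    · simp only [Test.eval_wordLt, WExp.eval_ofNat, WExp.eval_mod, WExp.eval_get, WExp.eval_const,
        WExp.eval_mul, h4, h5, not_lt, Nat.le_zero] at h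
      -- Position `k` lies in double block `b` and is a multiple of `2 * w`.
      have hkb' : k = b * (2 * w) := by
        obtain ⟨c, rfl⟩ := Nat.dvd_of_mod_eq_zero h
        have h1 : b ≤ c := Nat.le_of_mul_le_mul_left (by rw [mul_comm (2 * w) b]; exact hle)
          (show 0 < 2 * w by omega)
        have h2 : c < b + 1 := Nat.lt_of_mul_lt_mul_left (a := 2 * w)
          (by rw [mul_comm (2 * w) (b + 1), add_mul, one_mul]; omega)
        rw [show c = b by omega, mul_comm]
      refine ends_seq_setWord (by simp [h5]; omega) (ends_seq_setWord (by simp [h5, h4]; omega)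
        (ends_seq_setWord (by simp [h5, h4]; omega) (ends_setWord le_rfl (by simp [h5, h4]; omega)
        ?_)))
      simp only [WExp.eval_add, WExp.eval_get, WExp.eval_ofNat, WExp.eval_mul, ne_eq,
        Nat.reduceEqDiff, not_false_eq_true, Mem.setWord_word_of_ne, h4, h5,
        Mem.setWord_word_self, Function.update_self, hkb', true_and, WExp.eval_const]
      exact MergeState.init (by omega) (by omega)
  · rintro t hs ⟨h2, h3, h8, h9, hm⟩
    have h5' : t.word 5 = s.word 5 := hs.1 5 (by simp)
    have hr : t.real = s.real := funext fun a => hs.2 a (by simp)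
    have hV' : ∀ i, t.real 0 (3 + i) = V i := by simp [hr, hV]
    have hMt : M.eval t = m := hM t (hs.1 0 (by simp))
    refine ends_ite (fun h => ?_) fun h => ?_
    · simp only [Test.eval_conj, Test.eval_wordLt, WExp.eval_get, WExp.eval_const, h8, Test.eval_neg,
        h9, hMt, h2, Test.eval_realLt, RExp.eval_get, WExp.eval_add, WExp.eval_ofNat, hV',
        not_and, not_lt] at h
      obtain ⟨h10, h11⟩ := hm.step_left hk h.1 (fun p q => hL p q)
        (fun p q a a' a'' => hR p q a a' (by omega)) h.2
      have h12 := hA.lt _ h10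
      have h13 := hm.le_mid
      refine ends_seq_setWord (by simp [h2]; omega) (ends_setWord le_rfl (by simp; omega) ?_)
      simp only [WExp.eval_ofNat, WExp.eval_add, WExp.eval_get, WExp.eval_const, ne_eq, h2, h5', h5,
        Nat.reduceEqDiff, not_false_eq_true, Mem.setWord_word_of_ne,
        Mem.setWord_word_self, Function.update_self, h8, h9, h3, true_and]
      exact ⟨hP.update h12, h11⟩
    · simp only [Test.eval_conj, Test.eval_wordLt, WExp.eval_get, WExp.eval_const, h8, Test.eval_neg,
        h9, hMt, h2, Test.eval_realLt, RExp.eval_get, WExp.eval_add, WExp.eval_ofNat, hV',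
        not_and, not_lt, not_forall, not_le] at h
      obtain ⟨h10, h11⟩ := hm.step_right hk (by omega) (fun p q => hL p q)
        (fun p q a a' a'' => hR p q a a' (by omega)) (fun hi => by
          obtain ⟨a, a', a''⟩ := h hi
          exact ⟨a, a', a''.le⟩)
      have h12 := hA.lt _ h10
      refine ends_seq_setWord (by simp [h2]; omega) (ends_setWord le_rfl (by simp; omega) ?_)
      simp only [WExp.eval_ofNat, WExp.eval_add, WExp.eval_get, WExp.eval_const, ne_eq, h2, h5', h5,
        Nat.reduceEqDiff, not_false_eq_true, Mem.setWord_word_of_ne,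
        Mem.setWord_word_self, Function.update_self, h8, h9, h3, true_and]
      exact ⟨hP.update h12, h11⟩

@[simp] theorem writesWord_mergeStep {M : WExp} {a : ℕ} :
    (mergeStep M).WritesWord a ↔ a = 3 ∨ a = 6 ∨ a = 7 ∨ a = 8 ∨ a = 9 := by
  simp [mergeStep]; tauto

@[simp] theorem writesReal_mergeStep {M : WExp} {a : ℕ} : ¬ (mergeStep M).WritesReal a := by
  simp [mergeStep]

/-- Merge the sorted blocks of length `w` of the item list in pairs. -/
def mergePass (M : WExp) : Cmd :=
  .seq (forTo 5 M (mergeStep M))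
    (.seq (forTo 5 M (.setWord 2 (.var 5) (.get 3 (.var 5)))) (.setWord 4 0 (2 * .var 4)))

theorem ends_mergePass {M : WExp} {m w : ℕ} {V : ℕ → ℝ}
    (hM : ∀ t, t.word 0 = s.word 0 → M.eval t = m)
    (hV : ∀ i, V i = s.real 0 (3 + i)) (hw : 0 < w) (hW : 3 * m + 2 * w ≤ W)
    (h4 : s.word 4 0 = w) (hA : BlockSorted V (s.word 2) m w) :
    (mergePass M).Ends W o s (13 * m + 5) fun t =>
      t.word 4 0 = 2 * w ∧ BlockSorted V (t.word 2) m (2 * w) := by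
  refine ends_seq_le (n := 10 * m + 2) (n' := 3 * m + 3)
    (R := fun t => BlockSorted V (t.word 3) m (2 * w)) ?_ (by omega) ?_
  · refine (ends_forTo (m := m) (C := 8) (fun k t => ∃ b, k < (b + 1) * (2 * w) ∧
      PassState V (s.word 2) (t.word 3) m w b k ∧ (k ≠ b * (2 * w) →
        t.word 8 0 = b * (2 * w) + w ∧ t.word 9 0 = b * (2 * w) + 2 * w ∧
      MergeState V (s.word 2) (t.word 3) m (b * (2 * w)) (b * (2 * w) + w) (b * (2 * w) + 2 * w)
        k (t.word 6 0) (t.word 7 0))) (by simp) (fun t ht => hM t (ht.1 0 (by simp)))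
        (by omega) ?_ ?_).mono (by omega) ?_
    · refine ⟨0, by omega, ⟨by simp, by simp, by simp, by simp⟩, by simp⟩
    · rintro k hk t hs ht ⟨b, hkb, hP, hG⟩
      have h2 : t.word 2 = s.word 2 := hs.1 2 (by simp)
      have h0 : t.word 0 = s.word 0 := hs.1 0 (by simp)
      have hr : t.real = s.real := funext fun a => hs.2 a (by simp)
      refine (ends_mergeStep (V := V) (w := w) (b := b) (k := k) (m := m)
        (fun t' ht' => hM t' (ht'.trans h0)) (fun i => by rw [hr, hV]) hw hW
        (by rw [hs.1 4 (by simp), h4]) ht hk (h2 ▸ hA) hkb (h2 ▸ hP) (h2 ▸ hG)).mono le_rfl ?_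
      rw [h2]
      rintro t' hs' ⟨hP', h8, h9, hG'⟩
      -- If the double block is complete, the block count goes up and the merge state is dropped;
      -- the next step starts a new merge.
      by_cases hb : k + 1 = (b + 1) * (2 * w)
      · exact ⟨b + 1, by rw [hb, add_mul (b + 1)]; omega, by simpa using hP'.next hw hG' hb,
          fun h => absurd hb h⟩
      · exact ⟨b, by omega, by simpa using hP', fun _ => by simpa using ⟨h8, h9, hG'⟩⟩
    · rintro t hs ⟨b, hb, hP, hG⟩
      exact hP.blockSorted hw hA fun h => (hG h).2.2
  · intro t hs hB
    have h0 : t.word 0 = s.word 0 := hs.1 0 (by simp)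
    refine ends_seq_le (n := 3 * m + 2) (n' := 1)
      (R := fun t' => ∀ p < m, t'.word 2 p = t.word 3 p) ?_ le_rfl ?_
    · refine (ends_forTo (m := m) (C := 1) (fun k t' => ∀ p < k, t'.word 2 p = t.word 3 p)
        (by simp) (fun t' ht' => hM t' ((ht'.1 0 (by simp)).trans h0)) (by omega) (by simp) ?_)
      intro k hk t' hs' ht' hI
      have h3 : t'.word 3 = t.word 3 := hs'.1 3 (by simp)
      refine ends_setWord le_rfl (by simp [ht', h3]; have := hB.lt k hk; omega) ?_
      intro p hp
      simp only [WExp.eval_get, WExp.eval_const, ht', h3, ne_eq, Nat.reduceEqDiff,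
        not_false_eq_true, Mem.setWord_word_of_ne, Mem.setWord_word_self, Function.update_apply]
      split_ifs with h
      · rw [h]
      · exact hI p (by omega)
    · intro t' hs' hR
      have h4' : t'.word 4 = s.word 4 := (hs'.1 4 (by simp)).trans (hs.1 4 (by simp))
      refine ends_setWord le_rfl (by simp [h4', h4]; omega) ?_
      simp only [WExp.eval_mul, WExp.eval_ofNat, WExp.eval_get, WExp.eval_const, h4', h4,
        Mem.setWord_word_self, Function.update_self, ne_eq, Nat.reduceEqDiff, not_false_eq_true,
        Mem.setWord_word_of_ne, true_and]
      refine ⟨fun p hp => by rw [hR p hp]; exact hB.lt p hp, fun v hv => ?_, fun p q h1 h2 h3 => ?_⟩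
      · obtain ⟨p, hp, h⟩ := hB.surj v hv
        exact ⟨p, hp, by rw [hR p hp, h]⟩
      · rw [hR p (by omega), hR q h2]
        exact hB.sorted p q h1 h2 h3

@[simp] theorem writesWord_mergePass {M : WExp} {a : ℕ} : (mergePass M).WritesWord a ↔
    a = 2 ∨ a = 3 ∨ a = 4 ∨ a = 5 ∨ a = 6 ∨ a = 7 ∨ a = 8 ∨ a = 9 := by
  simp [mergePass]; tauto

@[simp] theorem writesReal_mergePass {M : WExp} {a : ℕ} : ¬ (mergePass M).WritesReal a := by
  simp [mergePass]

/-- Sort the `M` items by value. -/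
def mergeSort (M : WExp) : Cmd :=
  .seq (forTo 5 M (.setWord 2 (.var 5) (.var 5)))
    (.seq (.setWord 4 0 1) (.loop (.wordLt (.var 4) M) (mergePass M)))

@[simp] theorem writesWord_mergeSort {M : WExp} {a : ℕ} : (mergeSort M).WritesWord a ↔
    a = 2 ∨ a = 3 ∨ a = 4 ∨ a = 5 ∨ a = 6 ∨ a = 7 ∨ a = 8 ∨ a = 9 := by
  simp [mergeSort]; tauto

@[simp] theorem writesReal_mergeSort {M : WExp} {a : ℕ} : ¬ (mergeSort M).WritesReal a := by
  simp [mergeSort]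

/-- The block length is a power of two that doubles in every linear pass, so `clog` of it rises by
one. The difference of `clog 2 m` and this number, times the cost of a pass, is the potential. -/
theorem ends_mergeSort {M : WExp} {m : ℕ} {V : ℕ → ℝ}
    (hM : ∀ t, t.word 0 = s.word 0 → M.eval t = m)
    (hV : ∀ i, V i = s.real 0 (3 + i)) (hW : 5 * m + 1 ≤ W) :
    (mergeSort M).Ends W o s (3 * m + 4 + (13 * m + 6) * Nat.clog 2 m) fun t =>
      (∀ p < m, t.word 2 p < m) ∧ (∀ v < m, ∃ p < m, t.word 2 p = v) ∧
      ∀ p q, p ≤ q → q < m → V (t.word 2 p) ≤ V (t.word 2 q) := by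
  refine ends_seq_le (n := 3 * m + 2) (n' := 2 + (13 * m + 6) * Nat.clog 2 m)
    (R := fun t => ∀ p < m, t.word 2 p = p) ?_ (by omega) ?_
  · refine (ends_forTo (m := m) (C := 1) (fun k t' => ∀ p < k, t'.word 2 p = p)
      (by simp) (fun t' ht' => hM t' (ht'.1 0 (by simp))) (by omega) (by simp) ?_)
    intro k hk t' hs' ht' hI
    refine ends_setWord le_rfl (by simp [ht']; omega) ?_
    intro p hp
    simp only [WExp.eval_get, WExp.eval_const, ht', ne_eq, Nat.reduceEqDiff,
      not_false_eq_true, Mem.setWord_word_of_ne, Mem.setWord_word_self, Function.update_apply]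
    split_ifs with h
    · rw [h]
    · exact hI p (by omega)
  · intro t hs hR
    refine (ends_seq_setWord (n := 1 + (13 * m + 6) * Nat.clog 2 m) (by simp; omega) ?_).mono
      (by omega) fun _ _ h => h
    have hinit : BlockSorted V (t.word 2) m 1 := by
      refine ⟨fun p hp => by rwa [hR p hp], fun v hv => ⟨v, hv, hR v hv⟩, fun p q h1 _ h3 => ?_⟩
      simp only [Nat.div_one] at h3
      omega
    set t₁ := t.setWord 4 (WExp.eval t 0) (WExp.eval t 1) with ht₁
    have key := ends_loop (W := W) (o := o) (s := t₁) (b := .wordLt (.var 4) M) (c := mergePass M)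
      (fun u => ∃ j, u.word 4 0 = 2 ^ j ∧ (u.word 4 0 = 1 ∨ u.word 4 0 < 2 * m) ∧
        BlockSorted V (u.word 2) m (u.word 4 0))
      (fun u => (13 * m + 6) * (Nat.clog 2 m - Nat.clog 2 (u.word 4 0)))
      ⟨0, by simp [ht₁], by simp [ht₁], by simpa [ht₁] using hinit⟩ ?_
    · refine key.mono (by simp [ht₁]) ?_
      rintro u hu ⟨⟨j, h1, h2, h3⟩, h4⟩
      have h0 : u.word 0 = s.word 0 := (hu.1 0 (by simp)).trans (by simpa [ht₁] using hs.1 0 (by simp))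
      simp only [Test.eval_wordLt, WExp.eval_get, WExp.eval_const, hM u h0, not_lt] at h4
      refine ⟨h3.lt, h3.surj, fun p q hpq hq => ?_⟩
      rcases hpq.eq_or_lt with rfl | hpq
      · rfl
      · exact h3.sorted p q hpq hq (by
          rw [Nat.div_eq_of_lt (by omega), Nat.div_eq_of_lt (by omega)])
    · rintro u hu ⟨j, h1, h2, h3⟩ hb
      have h0 : u.word 0 = s.word 0 := (hu.1 0 (by simp)).trans (by simpa [ht₁] using hs.1 0 (by simp))
      have hr : u.real = s.real := funext fun a => (hu.2 a (by simp)).trans (hs.2 a (by simp))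
      simp only [Test.eval_wordLt, WExp.eval_get, WExp.eval_const, hM u h0] at hb
      have hpos : 0 < u.word 4 0 := by rw [h1]; positivity
      refine ⟨13 * m + 5, (ends_mergePass (m := m) (w := u.word 4 0) (V := V)
        (fun t' ht' => hM t' (ht'.trans h0)) (fun i => by rw [hr, hV]) hpos (by omega) rfl
        h3).mono le_rfl ?_⟩
      rintro u' hu' ⟨h5, h6⟩
      refine ⟨⟨j + 1, by rw [h5, h1, pow_succ, mul_comm], by omega, h5 ▸ h6⟩, ?_⟩
      have h7 : Nat.clog 2 (2 * 2 ^ j) = j + 1 := by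
        rw [mul_comm, ← pow_succ, Nat.clog_pow _ _ (by norm_num)]
      have h8 : j < Nat.clog 2 m := (Nat.lt_clog_iff_pow_lt (by norm_num)).2 (h1 ▸ hb)
      rw [h5, h1, h7, Nat.clog_pow _ _ (by norm_num)]
      obtain ⟨k, hk⟩ : ∃ k, Nat.clog 2 m = j + 1 + k := ⟨_, (Nat.add_sub_of_le h8).symm⟩
      rw [hk, show j + 1 + k - (j + 1) = k by omega, show j + 1 + k - j = k + 1 by omega]
      ring_nf; omega

/-- Give equal items equal numbers and different items different numbers. -/
def rankItems (M : WExp) : Cmd :=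
  .seq (mergeSort M) (.seq (.setWord 10 0 0) (forTo 5 M
    (.seq (.ite (.realLt (itemVal (.get 2 (.var 5 - 1))) (itemVal (.get 2 (.var 5))))
        (.setWord 10 0 (.var 5)) .skip)
      (.setWord 1 (.get 2 (.var 5)) (.var 10)))))

theorem writesWord_rankItems {M : WExp} {a : ℕ} (h : (rankItems M).WritesWord a) :
    1 ≤ a ∧ a ≤ 10 := by
  simp [rankItems] at h; omega

@[simp] theorem writesReal_rankItems {M : WExp} {a : ℕ} : ¬ (rankItems M).WritesReal a := by
  simp [rankItems]

open Classical in
/-- The first position of the run of equal values that contains position `p`. -/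
noncomputable def runStart (V : ℕ → ℝ) (A : ℕ → ℕ) : ℕ → ℕ
  | 0 => 0
  | p + 1 => if V (A p) < V (A (p + 1)) then p + 1 else runStart V A p

theorem runStart_le (V : ℕ → ℝ) (A : ℕ → ℕ) (p : ℕ) : runStart V A p ≤ p := by
  induction p with
  | zero => simp [runStart]
  | succ p ih => simp only [runStart]; split_ifs <;> omega

/-- In a sorted list a strict increase separates all earlier values from all later ones, and it
resets the start of the run to a position beyond every earlier start. -/
theorem runStart_eq_iff {V : ℕ → ℝ} {A : ℕ → ℕ} {m p q : ℕ}
    (h : ∀ p q, p ≤ q → q < m → V (A p) ≤ V (A q)) (hpq : p ≤ q) (hq : q < m) :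
    runStart V A p = runStart V A q ↔ V (A p) = V (A q) := by
  induction q, hpq using Nat.le_induction with
  | base => simp
  | succ q hpq ih =>
    simp only [runStart]
    split_ifs with h1
    · have h2 := runStart_le V A p
      have h3 := h p q hpq (by omega)
      constructor
      · omega
      · intro h4; linarith
    · rw [ih (by omega), le_antisymm (h q (q + 1) (by omega) hq) (not_lt.1 h1)]

/-- Ranks turn equality of real values into equality of small words. Only this equivalence matters
later, not the order of the ranks; the start of the run of equal values is a convenient rank. -/
theorem ends_rankItems {M : WExp} {m : ℕ} {V : ℕ → ℝ}
    (hM : ∀ t, t.word 0 = s.word 0 → M.eval t = m)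
    (hV : ∀ i, V i = s.real 0 (3 + i)) (hW : 5 * m + 1 ≤ W) :
    (rankItems M).Ends W o s (8 * m + 7 + (13 * m + 6) * Nat.clog 2 m) fun t =>
      (∀ i < m, t.word 1 i < m) ∧ ∀ i < m, ∀ j < m, t.word 1 i = t.word 1 j ↔ V i = V j := by
  refine ends_seq_le (ends_mergeSort hM hV hW) (n' := 5 * m + 3) (by omega) ?_
  rintro t hs ⟨hlt, hsurj, hsort⟩
  have h0 : t.word 0 = s.word 0 := hs.1 0 (by simp)
  have hr : t.real = s.real := funext fun a => hs.2 a (by simp)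
  refine ends_seq_setWord (n := 5 * m + 2) (by simp) ?_
  refine (ends_forTo (m := m) (C := 3) (fun k u => (∀ p < k, u.word 1 (t.word 2 p) =
    runStart V (t.word 2) p) ∧ u.word 10 0 = runStart V (t.word 2) (k - 1))
    (by simp) (fun u hu => hM u ((hu.1 0 (by simp)).trans (by simpa using h0))) (by omega)
    (by simp [runStart]) ?_).mono le_rfl ?_
  · rintro k hk u hu hu5 ⟨h1, h2⟩
    have hu2 : u.word 2 = t.word 2 := (hu.1 2 (by simp)).trans (by simp)
    have hV' : ∀ i, u.real 0 (3 + i) = V i := fun i => by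
      rw [hu.2 0 (by simp), Mem.setWord_real, hr, hV]
    refine ends_seq_le (n := 2) (n' := 1) (R := fun v => v.word 2 = t.word 2 ∧ v.word 1 = u.word 1
      ∧ v.word 5 0 = k ∧ v.word 10 0 = runStart V (t.word 2) k) ?_ le_rfl ?_
    · refine ends_ite (fun h => ?_) fun h => ?_
      · simp only [Test.eval_realLt, RExp.eval_get, WExp.eval_add, WExp.eval_ofNat, WExp.eval_get,
          WExp.eval_sub, WExp.eval_const, hu5, hu2, hV'] at h
        refine ends_setWord le_rfl (by simp [hu5]; omega) ⟨by simp [hu2], by simp, by simp [hu5], ?_⟩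
        -- At `k = 0` truncated subtraction makes the program compare the first item with itself, so
        -- the strict test fails.
        obtain ⟨k, rfl⟩ : ∃ l, k = l + 1 :=
          ⟨k - 1, by rcases k with _ | k <;> simp at h ⊢⟩
        simp only [Nat.add_sub_cancel] at h
        simp [runStart, if_pos h, hu5]
      · simp only [Test.eval_realLt, RExp.eval_get, WExp.eval_add, WExp.eval_ofNat, WExp.eval_get,
          WExp.eval_sub, WExp.eval_const, hu5, hu2, hV'] at h
        refine ends_skip le_rfl ⟨hu2, rfl, hu5, ?_⟩
        rcases k with _ | k
        · exact h2
        · simp only [Nat.add_sub_cancel] at h h2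
          simp [runStart, if_neg h, h2]
    · rintro v - ⟨h3, h4, h5, h6⟩
      refine ends_setWord le_rfl (by simp [h6]; have := runStart_le V (t.word 2) k; omega) ?_
      simp only [WExp.eval_get, WExp.eval_const, h3, h5, h6, ne_eq, Nat.reduceEqDiff,
        not_false_eq_true, Mem.setWord_word_of_ne, Mem.setWord_word_self, Nat.add_sub_cancel,
        and_true, h4, OfNat.one_ne_ofNat, OfNat.ofNat_ne_one, Function.update_apply]
      intro p hp
      split_ifs with h
      · exact ((runStart_eq_iff hsort (show p ≤ k by omega) hk).2 (by rw [h])).symm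
      · refine h1 p ?_
        rcases Nat.lt_succ_iff_lt_or_eq.1 hp with h | rfl
        · exact h
        · exact absurd rfl h
  · rintro u hu ⟨h1, -⟩
    refine ⟨fun i hi => ?_, fun i hi j hj => ?_⟩
    · obtain ⟨p, hp, rfl⟩ := hsurj i hi
      rw [h1 p hp]
      exact (runStart_le _ _ _).trans_lt hp
    · obtain ⟨p, hp, rfl⟩ := hsurj i hi
      obtain ⟨q, hq, rfl⟩ := hsurj j hj
      rw [h1 p hp, h1 q hq]
      rcases le_total p q with h | h
      · exact runStart_eq_iff hsort h hq
      · rw [eq_comm, runStart_eq_iff hsort h hp, eq_comm]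

end Cmd

/-! ### Boxes -/

section Boxes

variable {d : ℕ}

/-- The cube with lower corner `lo` and side `ℓ` in the directions in `B`: half-open if `0 < ℓ`, and
a point if `ℓ = 0`. -/
def box (B : Finset (Fin d)) (ℓ : ℝ) (lo : Fin d → ℝ) : Set (Fin d → ℝ) :=
  {p | ∀ b ∈ B, lo b ≤ p b ∧ (p b < lo b + ℓ ∨ p b = lo b)}

/-- The point `x` has distance at most `ρ` to the closed cube, in all directions in `B`. -/
def NearBox (B : Finset (Fin d)) (ℓ ρ : ℝ) (lo x : Fin d → ℝ) : Prop :=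
  ∀ b ∈ B, lo b - ρ ≤ x b ∧ x b ≤ lo b + ℓ + ρ

theorem box_congr {B : Finset (Fin d)} {ℓ : ℝ} {u v : Fin d → ℝ} (h : ∀ b ∈ B, u b = v b) :
    box B ℓ u = box B ℓ v := by
  ext p
  exact forall₂_congr fun b hb => by rw [h b hb]

/-- Disjoint cubes near a few points are few. -/
theorem length_le_of_disjoint_of_near {B : Finset (Fin d)} {ℓ ρ : ℝ} (hℓ : 0 ≤ ℓ) {t n : ℕ}
    (hρ : ρ ≤ t * ℓ) {x : ℕ → Fin d → ℝ} {L : List (Fin d → ℝ)}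
    (hd : L.Pairwise fun u v => Disjoint (box B ℓ u) (box B ℓ v))
    (hn : ∀ u ∈ L, ∃ i < n, NearBox B ℓ ρ u (x i)) : L.length ≤ n * (2 * t + 2) ^ B.card := by
  have hd' : ∀ i j (hi : i < L.length) (hj : j < L.length), i ≠ j →
      Disjoint (box B ℓ L[i]) (box B ℓ L[j]) := by
    rw [List.pairwise_iff_getElem] at hd
    intro i j hi hj hij
    rcases lt_or_gt_of_ne hij with h | h
    · exact hd i j hi hj h
    · exact (hd j i hj hi h).symm
  obtain ⟨u, hu⟩ : ∃ u : Fin L.length → Fin d → ℝ, ∀ i, u i = L[(i : ℕ)] := ⟨_, fun _ => rfl⟩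
  choose g hg hgn using fun i : Fin L.length => hn (u i) (hu i ▸ List.getElem_mem i.2)
  -- The corner relative to its nearby point, rounded in units of `ℓ`. Nearness confines each
  -- coordinate to `-(t + 1), …, t`, which are `2 t + 2` values; for `ℓ = 0` division by zero gives
  -- `0`.
  set fl : Fin L.length → Fin d → ℤ := fun i b => ⌊(u i b - x (g i) b) / ℓ⌋ with hfl
  have hrange : ∀ i, ∀ b ∈ B, fl i b ∈ Finset.Icc (-(t + 1 : ℤ)) t := by
    intro i b hb
    obtain ⟨h1, h2⟩ := hgn i b hb
    rw [Finset.mem_Icc]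
    rcases hℓ.eq_or_lt with h0 | h0
    · simp only [hfl, ← h0, div_zero, Int.floor_zero]
      omega
    · constructor
      · rw [hfl, Int.le_floor, le_div_iff₀ h0]
        push_cast
        linarith
      · rw [hfl, ← Int.lt_add_one_iff, Int.floor_lt, div_lt_iff₀ h0]
        push_cast
        linarith
  have hinj : ∀ i j, g i = g j → (∀ b ∈ B, fl i b = fl j b) → i = j := by
    intro i j hgij hflij
    by_contra hij
    have hdis := Set.disjoint_left.1 (hd' i j i.2 j.2 fun h => hij (Fin.ext h))
    rw [← hu i, ← hu j] at hdis
    -- Equal roundings mean that the corners differ by less than `ℓ` in every direction, so the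
    -- coordinatewise maximum of the corners lies in both cubes. For `ℓ = 0` the corners agree in
    -- the directions of `B`.
    refine @hdis (fun b => max (u i b) (u j b)) ?_ ?_ <;>
    · intro b hb
      have h1 := hflij b hb
      have h2 := hgn i b hb
      have h3 := hgn j b hb
      simp only [hfl, hgij] at h1
      rcases hℓ.eq_or_lt with h0 | h0
      · rw [← h0] at hρ
        have : u i b = u j b := by rw [hgij] at h2; linarith [h2.1, h2.2, h3.1, h3.2]
        simp [this, ← h0]
      · have h4 := Int.abs_sub_lt_one_of_floor_eq_floor h1
        rw [← sub_div, abs_div, abs_of_pos h0, div_lt_one h0, abs_lt] at h4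
        refine ⟨by simp, Or.inl ?_⟩
        simp only [max_lt_iff]
        constructor <;> linarith [h4.1, h4.2]
  have hcard := Fintype.card_le_of_injective
    (fun i : Fin L.length => ((⟨g i, hg i⟩ : Fin n),
      fun b : B => (⟨fl i b, hrange i b b.2⟩ : Finset.Icc (-(t + 1 : ℤ)) t))) (by
    intro i j hij
    simp only [Prod.mk.injEq, Fin.mk.injEq, funext_iff, Subtype.mk.injEq] at hij
    exact hinj i j hij.1 fun b hb => hij.2 ⟨b, hb⟩)
  simp only [Fintype.card_fin, Fintype.card_prod, Fintype.card_pi, Finset.prod_const,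
    Fintype.card_coe, Int.card_Icc, Finset.card_univ] at hcard
  rwa [show ((t : ℤ) + 1 - -(t + 1)).toNat = 2 * t + 2 by omega] at hcard

/-- The cubes of side `3 r` in the directions in `B` are disjoint, near the points `x i`, and cover
the cubes of radius `r` around these points. -/
structure RootState (x : ℕ → Fin d → ℝ) (n : ℕ) (r : ℝ) (B : Finset (Fin d))
    (L : List (Fin d → ℝ)) : Prop where
  disj : L.Pairwise fun u v => Disjoint (box B (3 * r) u) (box B (3 * r) v)
  near : ∀ u ∈ L, ∃ i < n, NearBox B (3 * r) (2 * r) u (x i)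
  cover : ∀ p : Fin d → ℝ, (∃ i < n, ∀ b ∈ B, |p b - x i b| ≤ r) → ∃ u ∈ L, p ∈ box B (3 * r) u

/-- The refinement of the cubes in `L` in direction `a`, while it treats cube number `c`: the new
cubes found up to now are those in `N`, and `last` is the last one for cube `c` if `flag` holds. -/
structure AxisState (x : ℕ → Fin d → ℝ) (n : ℕ) (r : ℝ) (B : Finset (Fin d)) (a : Fin d)
    (L : List (Fin d → ℝ)) (c : ℕ) (N : List (Fin d → ℝ)) (flag : Prop) (last : ℝ) : Prop where
  disj : N.Pairwise fun u v =>
    Disjoint (box (insert a B) (3 * r) u) (box (insert a B) (3 * r) v)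
  near : ∀ u ∈ N, ∃ i < n, NearBox (insert a B) (3 * r) (2 * r) u (x i)
  parent : ∀ v ∈ N, ∃ (c' : ℕ) (h : c' < L.length), (c' < c ∨ c' = c ∧ flag ∧ v a ≤ last) ∧
    ∀ b ∈ B, v b = L[c'] b
  last_mem : flag → ∀ h : c < L.length, ∃ v ∈ N, v a = last ∧ ∀ b ∈ B, v b = L[c] b
  cover_old : ∀ (c' : ℕ) (h : c' < L.length), c' < c → ∀ i < n,
    NearBox B (3 * r) (2 * r) L[c'] (x i) → ∀ p ∈ box B (3 * r) L[c'], |p a - x i a| ≤ r →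
    ∃ v ∈ N, p ∈ box (insert a B) (3 * r) v
  cover_cur : flag → ∀ (h : c < L.length), ∀ i < n,
    NearBox B (3 * r) (2 * r) L[c] (x i) → x i a ≤ last + r →
    ∀ p ∈ box B (3 * r) L[c], |p a - x i a| ≤ r →
    ∃ v ∈ N, p ∈ box (insert a B) (3 * r) v

variable {x : ℕ → Fin d → ℝ} {n : ℕ} {r : ℝ} {B : Finset (Fin d)} {a : Fin d}
  {L N : List (Fin d → ℝ)} {c : ℕ} {flag : Prop} {last : ℝ}

/-- With no directions to constrain, any corner describes the whole space. -/
theorem RootState.init (hn : 0 < n) (u : Fin d → ℝ) : RootState x n r ∅ [u] :=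
  ⟨by simp, fun v _ => ⟨0, hn, by simp [NearBox]⟩, fun p _ => ⟨u, by simp, by simp [box]⟩⟩

/-- Packing with `t = 1`, since `2 r ≤ 3 r`. The bound depends only on disjointness and nearness, so
refining axis by axis does not multiply constants beyond it. -/
theorem RootState.length_le (h : RootState x n r B L) (hr : 0 ≤ r) : L.length ≤ n * 4 ^ B.card :=
  length_le_of_disjoint_of_near (t := 1) (by positivity) (by push_cast; linarith) h.disj h.near

theorem AxisState.length_le (h : AxisState x n r B a L c N flag last) (hr : 0 ≤ r) :
    N.length ≤ n * 4 ^ (insert a B).card :=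
  length_le_of_disjoint_of_near (t := 1) (by positivity) (by push_cast; linarith) h.disj h.near

theorem AxisState.init (x : ℕ → Fin d → ℝ) (n : ℕ) (r : ℝ) (B : Finset (Fin d)) (a : Fin d)
    (L : List (Fin d → ℝ)) (last : ℝ) : AxisState x n r B a L 0 [] False last := by
  constructor <;> simp

/-- If no nearby point is left beyond `last + r`, the clause `cover_cur` already covers everything
that cube `c` has to cover. -/
theorem AxisState.next (h : AxisState x n r B a L c N flag last) (hc : c < L.length)
    (hno : ∀ i < n, ¬ (NearBox B (3 * r) (2 * r) L[c] (x i) ∧ ¬ (flag ∧ x i a ≤ last + r)))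
    (last' : ℝ) : AxisState x n r B a L (c + 1) N False last' := by
  refine ⟨h.disj, h.near, fun v hv => ?_, False.elim, ?_, False.elim⟩
  · obtain ⟨c', h1, h2, h3⟩ := h.parent v hv
    exact ⟨c', h1, Or.inl (by omega), h3⟩
  · intro c' h1 h2 i hi h3 p hp hpa
    rcases Nat.lt_succ_iff_lt_or_eq.1 h2 with h4 | rfl
    · exact h.cover_old c' h1 h4 i hi h3 p hp hpa
    · have h4 := hno i hi
      rw [not_and_not_right] at h4
      exact h.cover_cur (h4 h3).1 hc i hi h3 (h4 h3).2 p hp hpa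

/-- A point `p` of a cube with `|p - x i| ≤ r` puts `x i` within `r` of that cube, well below the
tolerance `2 r`, so `x i` was considered when that cube was refined. -/
theorem AxisState.finish (h : AxisState x n r B a L L.length N flag last) (hr : 0 ≤ r)
    (hL : RootState x n r B L) : RootState x n r (insert a B) N := by
  refine ⟨h.disj, h.near, ?_⟩
  rintro p ⟨i, hi, hp⟩
  obtain ⟨u, hu, hpu⟩ := hL.cover p ⟨i, hi, fun b hb => hp b (Finset.mem_insert_of_mem hb)⟩
  obtain ⟨c', hc', rfl⟩ := List.getElem_of_mem hu
  refine h.cover_old c' hc' hc' i hi (fun b hb => ?_) p hpu (hp a (Finset.mem_insert_self _ _))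
  have h1 := hpu b hb
  have h2 := abs_le.1 (hp b (Finset.mem_insert_of_mem hb))
  rcases h1.2 with h3 | h3 <;> constructor <;> linarith [h1.1, h2.1, h2.2]

theorem mem_box_insert {ℓ : ℝ} {u p : Fin d → ℝ} : p ∈ box (insert a B) ℓ u ↔
    (u a ≤ p a ∧ (p a < u a + ℓ ∨ p a = u a)) ∧ p ∈ box B ℓ u := by
  simp [box]

/-- A sweep in direction `a`: take the first nearby point not handled yet and open an interval of
length `3 r` at distance `r` below it, or at the end of the previous interval if the two would
overlap. The shift is at most `3 r`, because the point lies beyond `last + r`; this keeps the new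
cube near the point. A point up to `last + r` needs no new interval, as its neighbourhood ends by
`last + 2 r`. -/
theorem AxisState.push (h : AxisState x n r B a L c N flag last) (hr : 0 ≤ r) (hc : c < L.length)
    (hL : L.Pairwise fun u v => Disjoint (box B (3 * r) u) (box B (3 * r) v))
    {i : ℕ} (hi : i < n) (hnear : NearBox B (3 * r) (2 * r) L[c] (x i))
    (hflag : ¬ (flag ∧ x i a ≤ last + r))
    (hmin : ∀ j < n, NearBox B (3 * r) (2 * r) L[c] (x j) → ¬ (flag ∧ x j a ≤ last + r) →
      x i a ≤ x j a)
    {v : Fin d → ℝ} (hvB : ∀ b ∈ B, v b = L[c] b)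
    (hva : flag ∧ x i a - r < last + 3 * r ∧ v a = last + 3 * r ∨
      ¬ (flag ∧ x i a - r < last + 3 * r) ∧ v a = x i a - r) :
    AxisState x n r B a L c (N ++ [v]) True (v a) := by
  have hi1 : flag → last + r < x i a := fun hf => not_le.1 fun h => hflag ⟨hf, h⟩
  have hge : x i a - r ≤ v a := by rcases hva with ⟨-, h1, h2⟩ | ⟨-, h2⟩ <;> linarith
  have hle : v a ≤ x i a + 2 * r := by
    rcases hva with ⟨hf, h1, h2⟩ | ⟨-, h2⟩
    · linarith [hi1 hf]
    · linarith
  have hlast : flag → last + 3 * r ≤ v a ∧ last < v a := by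
    intro hf
    have h0 := hi1 hf
    rcases hva with ⟨-, h1, h2⟩ | ⟨h1, h2⟩
    · exact ⟨h2.ge, by linarith⟩
    · have h3 : last + 3 * r ≤ x i a - r := not_lt.1 fun h => h1 ⟨hf, h⟩
      exact ⟨by linarith, by linarith⟩
  have hvbox : ∀ p ∈ box B (3 * r) L[c], v a ≤ p a → (p a < v a + 3 * r ∨ p a = v a) →
      p ∈ box (insert a B) (3 * r) v := fun p hp h1 h2 =>
    mem_box_insert.2 ⟨⟨h1, h2⟩, by rwa [box_congr hvB]⟩
  refine ⟨?_, ?_, ?_, ?_, ?_, ?_⟩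
  · rw [List.pairwise_append]
    refine ⟨h.disj, by simp, fun u hu w hw => ?_⟩
    rw [List.mem_singleton] at hw
    subst hw
    obtain ⟨c', hc', h1, h2⟩ := h.parent u hu
    rw [Set.disjoint_left]
    intro p hpu hpw
    obtain ⟨h3, h4⟩ := mem_box_insert.1 hpu
    obtain ⟨h5, h6⟩ := mem_box_insert.1 hpw
    rw [box_congr h2] at h4
    rw [box_congr hvB] at h6
    -- Earlier intervals over the same cube begin at `last` or below and therefore end before the
    -- new one begins.
    have hfl : flag → u a ≤ last → False := by
      intro hf hul
      have := hlast hf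
      rcases h3.2 with h7 | h7 <;> linarith [h5.1]
    rcases h1 with h1 | ⟨rfl, hf, h1⟩
    · exact Set.disjoint_left.1 (List.pairwise_iff_getElem.1 hL c' c hc' hc h1) h4 h6
    · exact hfl hf h1
  · intro u hu
    rcases List.mem_append.1 hu with hu | hu
    · exact h.near u hu
    · rw [List.mem_singleton] at hu
      subst hu
      refine ⟨i, hi, fun b hb => ?_⟩
      rcases Finset.mem_insert.1 hb with rfl | hb
      · constructor <;> linarith
      · rw [hvB b hb]
        exact hnear b hb
  · intro u hu
    rcases List.mem_append.1 hu with hu | hu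
    · obtain ⟨c', hc', h1, h2⟩ := h.parent u hu
      refine ⟨c', hc', ?_, h2⟩
      rcases h1 with h1 | ⟨h1, hf, h3⟩
      · exact Or.inl h1
      · exact Or.inr ⟨h1, trivial, by linarith [hlast hf]⟩
    · rw [List.mem_singleton] at hu
      subst hu
      exact ⟨c, hc, Or.inr ⟨rfl, trivial, le_rfl⟩, hvB⟩
  · exact fun _ _ => ⟨v, by simp, rfl, hvB⟩
  · intro c' hc' h1 j hj h2 p hp hpa
    obtain ⟨u, hu, hpu⟩ := h.cover_old c' hc' h1 j hj h2 p hp hpa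
    exact ⟨u, by simp [hu], hpu⟩
  · intro _ _ j hj h2 h3 p hp hpa
    by_cases hf : flag ∧ x j a ≤ last + r
    · obtain ⟨u, hu, hpu⟩ := h.cover_cur hf.1 hc j hj h2 hf.2 p hp hpa
      exact ⟨u, by simp [hu], hpu⟩
    · have h4 := hmin j hj h2 hf
      have h5 := abs_le.1 hpa
      -- Above `v a` the new cube contains `p`. Below `v a` the interval must have been shifted, and
      -- `p` lies in the previous one, because `p a ≥ x j a - r > last`.
      by_cases h6 : v a ≤ p a
      · refine ⟨v, by simp, hvbox p hp h6 ?_⟩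
        -- For `r = 0` all cubes are points and `p a = v a`.
        rcases hr.eq_or_lt with h0 | h0
        · exact Or.inr (by linarith)
        · exact Or.inl (by linarith)
      · rcases hva with ⟨hf', h7, h8⟩ | ⟨-, h8⟩
        · obtain ⟨u, hu, hua, huB⟩ := h.last_mem hf' hc
          have h9 : last + r < x j a := not_le.1 fun h => hf ⟨hf', h⟩
          refine ⟨u, by simp [hu], mem_box_insert.2 ⟨⟨by linarith, Or.inl (by linarith)⟩, ?_⟩⟩
          rwa [box_congr huB]
        · linarith

end Boxes

/-! ### The initial cubes -/

namespace Cmd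

variable {W : ℕ} {o : Solver} {s : Mem} {d : ℕ}

/-- Find the least value of `e` among the indices below `n` that satisfy `b`. -/
def findMin (n : WExp) (b : Test) (e : RExp) : Cmd :=
  .seq (.setWord 16 0 0) (forTo 14 n
    (.ite (.conj b (.neg (.conj (.wordLt 0 (.var 16)) (.realLe (.var 11) e))))
      (.seq (.setReal 11 0 e) (.setWord 16 0 1)) .skip))

@[simp] theorem writesWord_findMin {n : WExp} {b : Test} {e : RExp} {a : ℕ} :
    (findMin n b e).WritesWord a ↔ a = 14 ∨ a = 16 := by
  simp [findMin]; tauto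

@[simp] theorem writesReal_findMin {n : WExp} {b : Test} {e : RExp} {a : ℕ} :
    (findMin n b e).WritesReal a ↔ a = 11 := by
  simp [findMin]

/-- Word `16` tells whether an index was found; only then is real array `11` meaningful. The test
and the expression need to be understood only in memories that differ from `s` in the scratch
arrays. With a constant value this serves as an existence test. -/
theorem ends_findMin {n : WExp} {b : Test} {e : RExp} {m : ℕ} {P : ℕ → Prop} {v : ℕ → ℝ}
    (h : ∀ t, (∀ a, a ≠ 14 → a ≠ 16 → t.word a = s.word a) → (∀ a, a ≠ 11 → t.real a = s.real a) →
      n.eval t = m ∧ ∀ j < m, t.word 14 0 = j → (b.eval t ↔ P j) ∧ e.eval t = v j)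
    (hW : m + 1 ≤ W) :
    (findMin n b e).Ends W o s (5 * m + 3) fun t => (t.word 16 0 = 0 ∧ ∀ j < m, ¬ P j) ∨
      t.word 16 0 = 1 ∧ ∃ j < m, P j ∧ t.real 11 0 = v j ∧ ∀ j' < m, P j' → v j ≤ v j' := by
  have hsame : ∀ t, (forTo 14 n
    (.ite (.conj b (.neg (.conj (.wordLt 0 (.var 16)) (.realLe (.var 11) e))))
      (.seq (.setReal 11 0 e) (.setWord 16 0 1)) .skip)).Same
      (s.setWord 16 (WExp.eval s 0) (WExp.eval s 0)) t →
      n.eval t = m ∧ ∀ j < m, t.word 14 0 = j → (b.eval t ↔ P j) ∧ e.eval t = v j := fun t ht =>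
    h t (fun a h1 h2 => (ht.1 a (by simp [h1, h2])).trans (by simp [h2]))
      fun a h1 => ht.2 a (by simp [h1])
  refine ends_seq_setWord (n := 5 * m + 2) (by simp) ?_
  refine ends_forTo (m := m) (C := 3) (fun k t => (t.word 16 0 = 0 ∧ ∀ j < k, ¬ P j) ∨
      t.word 16 0 = 1 ∧ ∃ j < k, P j ∧ t.real 11 0 = v j ∧ ∀ j' < k, P j' → v j ≤ v j')
    (by simp) (fun t ht => (hsame t ht).1) (by omega) (by simp) ?_
  intro k hk t ht htk hI
  obtain ⟨hb, he⟩ := (hsame t ht).2 k hk htk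
  refine ends_ite (fun hc => ?_) fun hc => ?_
  · simp only [Test.eval_conj, hb, Test.eval_neg, Test.eval_wordLt, WExp.eval_ofNat, WExp.eval_get,
      WExp.eval_const, Test.eval_realLt, he, RExp.eval_get, not_and_not_right] at hc
    refine (ends_seq_setReal (n := 1) (ends_setWord le_rfl (by simp; omega) ?_)).mono le_rfl
      fun _ _ h => h
    simp only [WExp.eval_ofNat, Mem.setWord_word_self, ne_eq, Nat.reduceEqDiff, not_false_eq_true,
      Mem.setWord_word_of_ne, Function.update_self, Mem.setWord_real, Mem.setReal_real_self, he,
      one_ne_zero, false_and, true_and, false_or]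
    refine ⟨k, by omega, hc.1, rfl, fun j' hj' hP => ?_⟩
    rcases Nat.lt_succ_iff_lt_or_eq.1 hj' with h1 | rfl
    · rcases hI with ⟨h2, h3⟩ | ⟨h2, j, h3, h4, h5, h6⟩
      · exact absurd hP (h3 j' h1)
      · have := hc.2 (by omega)
        rw [h5] at this
        exact this.le.trans (h6 j' h1 hP)
    · exact le_rfl
  · simp only [Test.eval_conj, hb, Test.eval_neg, Test.eval_wordLt, WExp.eval_ofNat, WExp.eval_get,
      WExp.eval_const, Test.eval_realLt, he, RExp.eval_get, not_and] at hc
    replace hc : P k → 0 < t.word 16 0 ∧ t.real 11 0 ≤ v k := fun hP => by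
      by_contra h
      exact hc hP fun h1 h2 => h ⟨h1, not_lt.1 h2⟩
    refine ends_skip (by norm_num) ?_
    simp only [ne_eq, Nat.reduceEqDiff, not_false_eq_true, Mem.setWord_word_of_ne,
      Mem.setWord_real]
    rcases hI with ⟨h2, h3⟩ | ⟨h2, j, h3, h4, h5, h6⟩
    · refine Or.inl ⟨h2, fun j hj hP => ?_⟩
      rcases Nat.lt_succ_iff_lt_or_eq.1 hj with h1 | rfl
      · exact h3 j h1 hP
      · have := (hc hP).1
        omega
    · refine Or.inr ⟨h2, j, by omega, h4, h5, fun j' hj' hP => ?_⟩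
      rcases Nat.lt_succ_iff_lt_or_eq.1 hj' with h1 | rfl
      · exact h6 j' h1 hP
      · rw [← h5]
        exact (hc hP).2

/-- Coordinate `b` of the point with number in word variable `14`. -/
abbrev pointCoord (b : Fin d) : RExp := .get 1 (.var 14 * .const d + .const b)

/-- Coordinate `b` of the lower corner of the cube with number in word variable `13`. -/
abbrev cellCoord (b : Fin d) : RExp := .get 2 (.var 13 * .const d + .const b)

/-- The point is at most `ρ` away from the cube of side `ℓ`. -/
def nearTest (l : List (Fin d)) (ℓ ρ : RExp) : Test :=
  .all (fun b => .conj (.realLe (cellCoord b - ρ) (pointCoord b))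
    (.realLe (pointCoord b) (cellCoord b + ℓ + ρ))) l

theorem eval_nearTest {l : List (Fin d)} {ℓ ρ : RExp} {x lo : Fin d → ℝ}
    (hx : ∀ b : Fin d, s.real 1 (s.word 14 0 * d + b) = x b)
    (hlo : ∀ b : Fin d, s.real 2 (s.word 13 0 * d + b) = lo b) :
    (nearTest l ℓ ρ).eval s ↔ NearBox l.toFinset (ℓ.eval s) (ρ.eval s) lo x := by
  simp [nearTest, NearBox, hx, hlo]

/-- Make the new cubes the current ones. -/
def copyCells (d : ℕ) : Cmd :=
  .seq (forTo 14 (.var 12 * .const d) (.setReal 2 (.var 14) (.get 12 (.var 14))))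
    (.setWord 11 0 (.var 12))

@[simp] theorem writesWord_copyCells {a : ℕ} : (copyCells d).WritesWord a ↔ a = 14 ∨ a = 11 := by
  simp [copyCells]

@[simp] theorem writesReal_copyCells {a : ℕ} : (copyCells d).WritesReal a ↔ a = 2 := by
  simp [copyCells]

theorem ends_copyCells {N : List (Fin d → ℝ)} (hN : HoldsVecs (s.real 12) N)
    (hn : s.word 12 0 = N.length) (hW : N.length * (d + 1) ≤ W) :
    (copyCells d).Ends W o s (3 * (N.length * d) + 3) fun t =>
      HoldsVecs (t.real 2) N ∧ t.word 11 0 = N.length := by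
  rw [mul_add, mul_one] at hW
  refine ends_seq_le (n := 3 * (N.length * d) + 2) (n' := 1)
    (R := fun t => ∀ i < N.length * d, t.real 2 i = s.real 12 i) ?_ le_rfl ?_
  · refine ends_forTo (m := N.length * d) (C := 1) (fun k t => ∀ i < k, t.real 2 i = s.real 12 i)
      (by simp) (fun t ht => ?_) (by omega) (by simp) ?_
    · have h12 : t.word 12 = s.word 12 := ht.1 12 (by simp)
      simp [h12, hn]
    · intro k hk t ht htk hI
      have h12 : t.real 12 = s.real 12 := ht.2 12 (by simp)
      refine ends_setReal le_rfl fun i hi => ?_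
      simp only [WExp.eval_get, WExp.eval_const, htk, RExp.eval_get, h12, Mem.setWord_real,
        Mem.setReal_real_self, Function.update_apply]
      split_ifs with h
      · rw [h]
      · exact hI i (by omega)
  · intro t ht hR
    have h12 : t.word 12 = s.word 12 := ht.1 12 (by simp)
    refine ends_setWord le_rfl (by simp [h12, hn]; omega) ⟨fun i hi b => ?_, by simp [h12, hn]⟩
    rw [Mem.setWord_real, hR, hN i hi b]
    have h1 : (i + 1) * d ≤ N.length * d := Nat.mul_le_mul_right _ hi
    have h2 := b.2
    rw [add_mul] at h1
    omega

/-- The bound for the cost of the data points. -/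
abbrev radius : RExp := .get 0 2

/-- Find the next cube in direction `a` within the current cube. -/
def axisStep (l : List (Fin d)) (a : Fin d) : Cmd :=
  .seq (findMin (.get 0 1)
      (.conj (nearTest l (3 * radius) (2 * radius))
        (.neg (.conj (.wordLt 0 (.var 15)) (.realLe (pointCoord a) (.var 10 + radius)))))
      (pointCoord a))
    (.ite (.wordLt 0 (.var 16))
      (.seq (.setReal 14 0 (.var 11 - radius))
        (.seq (.ite (.conj (.wordLt 0 (.var 15)) (.realLt (.var 14) (.var 10 + 3 * radius)))
            (.setReal 14 0 (.var 10 + 3 * radius)) .skip)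
          (.seq (pushVec 12 12 fun b => if b = a then .var 14 else cellCoord b)
            (.seq (.setReal 10 0 (.var 14)) (.setWord 15 0 1)))))
      (.seq (.setWord 13 0 (.var 13 + 1)) (.setWord 15 0 0)))

/-- Refine the current cubes in direction `a`. -/
def axisStage (l : List (Fin d)) (a : Fin d) : Cmd :=
  .seq (.setWord 12 0 0) (.seq (.setWord 13 0 0) (.seq (.setWord 15 0 0)
    (.seq (.loop (.wordLt (.var 13) (.var 11)) (axisStep l a)) (copyCells d))))

theorem writesReal_axisStep {l : List (Fin d)} {a : Fin d} {b : ℕ}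
    (h : (axisStep l a).WritesReal b) : b = 10 ∨ b = 11 ∨ b = 12 ∨ b = 14 := by
  simp only [axisStep, writesReal_seq, writesReal_findMin, writesReal_ite, writesReal_setReal,
    writesReal_skip, writesReal_setWord, or_false] at h
  rcases h with h | h | h | h | h
  · omega
  · omega
  · omega
  · exact Or.inr (Or.inr (Or.inl (writesReal_pushVec h)))
  · omega

@[simp] theorem writesWord_axisStep {l : List (Fin d)} {a : Fin d} {b : ℕ} :
    (axisStep l a).WritesWord b ↔ b = 12 ∨ b = 13 ∨ b = 14 ∨ b = 15 ∨ b = 16 := by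
  simp [axisStep, writesWord_pushVec]; tauto

variable {x : ℕ → Fin d → ℝ} {n : ℕ} {r : ℝ}

/-- The memory holds the points `x i` for `i < n` and the radius `r`. -/
structure HoldsPoints (x : ℕ → Fin d → ℝ) (n : ℕ) (r : ℝ) (s : Mem) : Prop where
  num : s.word 0 1 = n
  rad : s.real 0 2 = r
  point : ∀ i < n, ∀ b : Fin d, s.real 1 (i * d + b) = x i b

theorem HoldsPoints.congr {t : Mem} (h : HoldsPoints x n r s) (hw : t.word 0 = s.word 0)
    (h0 : t.real 0 = s.real 0) (h1 : t.real 1 = s.real 1) : HoldsPoints x n r t :=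
  ⟨by rw [hw, h.num], by rw [h0, h.rad], fun i hi b => by rw [h1, h.point i hi]⟩

/-- One round either opens a new interval or moves on to the next cube. The strict inequality on `c
+ N.length` is the progress that bounds the number of rounds. -/
theorem ends_axisStep {l : List (Fin d)} {a : Fin d} {L N : List (Fin d → ℝ)} {c : ℕ}
    (ha : a ∉ l) (hx : HoldsPoints x n r s) (hr : 0 ≤ r) (hW : n + L.length + N.length + 2 ≤ W)
    (hL : HoldsVecs (s.real 2) L) (hN : HoldsVecs (s.real 12) N)
    (hN' : s.word 12 0 = N.length) (hc : c < L.length) (hc' : s.word 13 0 = c)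
    (hd : L.Pairwise fun u v => Disjoint (box l.toFinset (3 * r) u) (box l.toFinset (3 * r) v))
    (hI : AxisState x n r l.toFinset a L c N (0 < s.word 15 0) (s.real 10 0)) :
    (axisStep l a).Ends W o s (5 * n + d + 11) fun t => ∃ c' N', c' ≤ L.length ∧
      HoldsVecs (t.real 12) N' ∧ t.word 12 0 = N'.length ∧ t.word 13 0 = c' ∧
      AxisState x n r l.toFinset a L c' N' (0 < t.word 15 0) (t.real 10 0) ∧
      c + N.length < c' + N'.length ∧ N.length ≤ N'.length ∧ c ≤ c' := by
  refine ends_seq_le (n := 5 * n + 3) (n' := d + 8) (ends_findMin (m := n)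
    (P := fun i => NearBox l.toFinset (3 * r) (2 * r) L[c] (x i) ∧
      ¬ (0 < s.word 15 0 ∧ x i a ≤ s.real 10 0 + r)) (v := fun i => x i a) ?_ (by omega))
    (by omega) ?_
  · intro t hw hrl
    have hx' := hx.congr (hw 0 (by simp) (by simp)) (hrl 0 (by simp)) (hrl 1 (by simp))
    refine ⟨by simp [hx'.num], fun j hj htj => ⟨?_, by simp [htj, hx'.point j hj]⟩⟩
    rw [Test.eval_conj, eval_nearTest (x := x j) (lo := L[c])]
    · simp [hx'.rad, htj, hx'.point j hj, hw 15, hrl 10]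
    · intro b; rw [htj, hx'.point j hj]
    · intro b; rw [hw 13 (by simp) (by simp), hrl 2 (by simp), hc', hL c hc]
  · intro t hs ht
    have hx' := hx.congr (hs.1 0 (by simp)) (hs.2 0 (by simp)) (hs.2 1 (by simp))
    have h13 : t.word 13 = s.word 13 := hs.1 13 (by simp)
    have h15 : t.word 15 = s.word 15 := hs.1 15 (by simp)
    have h12 : t.word 12 = s.word 12 := hs.1 12 (by simp)
    have hr2 : t.real 2 = s.real 2 := hs.2 2 (by simp)
    have hr10 : t.real 10 = s.real 10 := hs.2 10 (by simp)
    have hr12 : t.real 12 = s.real 12 := hs.2 12 (by simp)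
    refine ends_ite (fun h => ?_) fun h => ?_
    · rcases ht with ht | ⟨ht, i, hi, ⟨hP1, hP2⟩, hbest, hmin⟩
      · simp [ht.1] at h
      refine ends_seq_setReal ?_
      refine ends_seq_le (n := 2) (n' := d + 4) (R := fun u =>
        (0 < s.word 15 0 ∧ x i a - r < s.real 10 0 + 3 * r ∧ u.real 14 0 = s.real 10 0 + 3 * r ∨
        ¬ (0 < s.word 15 0 ∧ x i a - r < s.real 10 0 + 3 * r) ∧ u.real 14 0 = x i a - r)) ?_
        (by omega) ?_
      · refine ends_ite (fun h => ends_setReal le_rfl ?_) fun h => ends_skip le_rfl ?_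
        · simp [h15, hr10, hx'.rad, hbest] at h ⊢
          exact Or.inl h
        · simp [h15, hr10, hx'.rad, hbest] at h ⊢
          exact fun h' => Or.inr (h h')
      · intro u hu hva
        have hu12 : u.word 12 = s.word 12 := (hu.1 12 (by simp)).trans (by simpa using h12)
        have hu13 : u.word 13 = s.word 13 := (hu.1 13 (by simp)).trans (by simpa using h13)
        have hur12 : u.real 12 = s.real 12 := (hu.2 12 (by simp)).trans (by simpa using hr12)
        have hur2 : u.real 2 = s.real 2 := (hu.2 2 (by simp)).trans (by simpa using hr2)
        refine ends_seq_le (n := d + 2) (n' := 2) (ends_pushVec (l := N) (fun b => ?_)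
          (by rw [hu12, hN']) (by omega) (hur12 ▸ hN)
          fun v h1 h2 h3 h4 => (⟨h1, h2, h3, h4⟩ : _ ∧ _ ∧ _ ∧ _)) (by omega) ?_
        · split_ifs <;> simp
        · rintro v - ⟨h1, h2, h3, h4⟩
          refine ends_seq_setReal (n := 1) (ends_setWord le_rfl (by simp; omega) ?_)
          refine ⟨c, _, hc.le, by simpa using h4, by simpa using h3, by simp [h1, hu13, hc'], ?_,
            by simp, by simp, le_rfl⟩
          have key := hI.push hr hc hd hi hP1 hP2 (fun j hj h1 h2 => hmin j hj ⟨h1, h2⟩)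
            (v := fun b => RExp.eval u (if b = a then .var 14 else cellCoord b)) ?_ (by simpa using hva)
          · simpa [h2] using key
          · intro b hb
            rw [List.mem_toFinset] at hb
            have hba : b ≠ a := fun h => ha (h ▸ hb)
            simp [hba, hur2, hu13, hc', hL c hc]
    · rcases ht with ⟨ht, hno⟩ | ht
      swap
      · simp [ht.1] at h
      refine (ends_seq_setWord (n := 1) (by simp [h13, hc']; omega)
        (ends_setWord le_rfl (by simp) ?_)).mono (by omega) fun _ _ h => h
      refine ⟨c + 1, N, hc, by simpa [hr12] using hN, by simp [h12, hN'], by simp [h13, hc'], ?_,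
        by omega, le_rfl, by omega⟩
      simpa using hI.next hc hno _

/-- Old and new cubes alike are bounded by packing, so at most `2 * (n * 4 ^ (l.length + 1))` rounds
occur, each with one scan of the points. The copy at the end makes the third summand. -/
theorem ends_axisStage {l : List (Fin d)} {a : Fin d} {L : List (Fin d → ℝ)}
    (ha : a ∉ l) (hx : HoldsPoints x n r s) (hr : 0 ≤ r)
    (hW : 2 * (n * 4 ^ (l.length + 1) * (d + 1)) + n + 2 ≤ W)
    (hL : HoldsVecs (s.real 2) L) (hL' : s.word 11 0 = L.length)
    (hI : RootState x n r l.toFinset L) :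
    (axisStage l a).Ends W o s
      ((5 * n + d + 12) * (2 * (n * 4 ^ (l.length + 1))) + 3 * (n * 4 ^ (l.length + 1) * d) + 7)
      fun t => ∃ N, HoldsVecs (t.real 2) N ∧ t.word 11 0 = N.length ∧
        RootState x n r (a :: l).toFinset N := by
  set Mx := n * 4 ^ (l.length + 1) with hMx
  have hLlen : L.length ≤ Mx := (hI.length_le hr).trans
    (Nat.mul_le_mul_left _ (Nat.pow_le_pow_right (by norm_num)
      ((List.toFinset_card_le l).trans (by omega))))
  have hNlen : ∀ {c N flag last}, AxisState x n r l.toFinset a L c N flag last → N.length ≤ Mx :=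
    fun h => (h.length_le hr).trans (Nat.mul_le_mul_left _ (Nat.pow_le_pow_right (by norm_num)
      ((Finset.card_insert_le _ _).trans (Nat.succ_le_succ (List.toFinset_card_le l)))))
  have hMW : Mx ≤ Mx * (d + 1) := Nat.le_mul_of_pos_right _ (by omega)
  have : (5 * n + d + 12) * (2 * Mx) + 3 * (Mx * d) + 7 =
    ((5 * n + d + 12) * (2 * Mx) + 1 + (3 * (Mx * d) + 3)) + 1 + 1 + 1 := by ring
  rw [this]
  refine ends_seq_setWord (by simp) (ends_seq_setWord (by simp) (ends_seq_setWord (by simp) ?_))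
  set s₁ := (((s.setWord 12 (WExp.eval s 0) (WExp.eval s 0)).setWord 13
    (WExp.eval _ 0) (WExp.eval _ 0)).setWord 15 (WExp.eval _ 0) (WExp.eval _ 0)) with hs₁
  have hx₁ : HoldsPoints x n r s₁ := hx.congr (by simp [hs₁]) rfl rfl
  refine ends_seq_le (n := (5 * n + d + 12) * (2 * Mx) + 1) (n' := 3 * (Mx * d) + 3)
    (R := fun t => ∃ N, HoldsVecs (t.real 12) N ∧ t.word 12 0 = N.length ∧
        RootState x n r (a :: l).toFinset N) ?_ (by omega) ?_
  · refine (ends_loop (fun t => ∃ c N, c ≤ L.length ∧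
      HoldsVecs (t.real 12) N ∧ t.word 12 0 = N.length ∧ t.word 13 0 = c ∧
      AxisState x n r l.toFinset a L c N (0 < t.word 15 0) (t.real 10 0))
      (fun t => (5 * n + d + 12) * ((L.length - t.word 13 0) + (Mx - t.word 12 0)))
      ⟨0, [], by simp, by simp [HoldsVecs], by simp [hs₁], by simp [hs₁], ?_⟩ ?_).mono ?_ ?_
    · simpa [hs₁] using AxisState.init x n r l.toFinset a L _
    · rintro t ht ⟨c, N, hc, h1, h2, h3, h4⟩ hb
      have hr2 : t.real 2 = s.real 2 := ht.2 2 fun h => by have := writesReal_axisStep h; omega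
      have h11 : t.word 11 = s.word 11 := (ht.1 11 (by simp)).trans (by simp [hs₁])
      have hx' := hx₁.congr (t := t) (ht.1 0 (by simp))
        (ht.2 0 fun h => by have := writesReal_axisStep h; omega)
        (ht.2 1 fun h => by have := writesReal_axisStep h; omega)
      simp only [Test.eval_wordLt, WExp.eval_get, WExp.eval_const, h3, h11, hL'] at hb
      have hN1 := hNlen h4
      refine ⟨5 * n + d + 11, (ends_axisStep ha hx' hr (by omega) (hr2 ▸ hL) h1 h2 hb h3 hI.disj
        h4).mono le_rfl ?_⟩
      rintro t' - ⟨c', N', h5, h6, h7, h8, h9, h10, h11, h12⟩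
      have hN2 := hNlen h9
      refine ⟨⟨c', N', h5, h6, h7, h8, h9⟩, ?_⟩
      rw [h7, h8, h2, h3]
      have : (L.length - c') + (Mx - N'.length) + 1 ≤ (L.length - c) + (Mx - N.length) := by omega
      calc _ = (5 * n + d + 12) * ((L.length - c') + (Mx - N'.length) + 1) := by ring
        _ ≤ _ := Nat.mul_le_mul_left _ this
    · refine Nat.add_le_add_right (Nat.mul_le_mul_left _ ?_) _
      omega
    · rintro t ht ⟨⟨c, N, hc, h1, h2, h3, h4⟩, hb⟩
      have h11 : t.word 11 = s.word 11 := (ht.1 11 (by simp)).trans (by simp [hs₁])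
      simp only [Test.eval_wordLt, WExp.eval_get, WExp.eval_const, h3, h11, hL', not_lt] at hb
      obtain rfl : c = L.length := le_antisymm hc hb
      exact ⟨N, h1, h2, by simpa using h4.finish hr hI⟩
  · rintro t ht ⟨N, h1, h2, h3⟩
    have hlen : N.length ≤ Mx := (h3.length_le hr).trans
      (Nat.mul_le_mul_left _ (Nat.pow_le_pow_right (by norm_num) (List.toFinset_card_le _)))
    have h4 : N.length * d ≤ Mx * d := Nat.mul_le_mul_right _ hlen
    have h5 : N.length * (d + 1) ≤ Mx * (d + 1) := Nat.mul_le_mul_right _ hlen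
    exact (ends_copyCells h1 h2 (by omega)).mono (by omega) fun u _ hu => ⟨N, hu.1, hu.2, h3⟩

/-- Compute disjoint cubes that cover the neighbourhoods of the points. -/
def rootStage : List (Fin d) → Cmd
  | [] => .setWord 11 0 1
  | a :: l => .seq (rootStage l) (axisStage l a)

theorem writesWord_rootStage {l : List (Fin d)} {a : ℕ} (h : (rootStage l).WritesWord a) :
    11 ≤ a ∧ a ≤ 16 := by
  induction l with
  | nil => simp [rootStage] at h; omega
  | cons b l ih =>
    simp only [rootStage, writesWord_seq, axisStage, writesWord_setWord, writesWord_loop,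
      writesWord_axisStep, writesWord_copyCells] at h
    rcases h with h | h
    · exact ih h
    · omega

theorem writesReal_rootStage {l : List (Fin d)} {a : ℕ} (h : (rootStage l).WritesReal a) :
    a = 2 ∨ 10 ≤ a ∧ a ≤ 14 := by
  induction l with
  | nil => simp [rootStage] at h
  | cons b l ih =>
    simp only [rootStage, writesReal_seq, axisStage, writesReal_setWord, writesReal_loop,
      writesReal_copyCells, false_or] at h
    rcases h with h | h | h
    · exact ih h
    · have := writesReal_axisStep h
      omega
    · omega

/-- Induction over the axes. The cost of every axis is bounded by that of the last one, which has
the largest packing bound. -/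
theorem ends_rootStage {l : List (Fin d)} (hl : l.Nodup) (hx : HoldsPoints x n r s) (hn : 0 < n) (hr : 0 ≤ r)
    (hW : 2 * (n * 4 ^ l.length * (d + 1)) + n + 2 ≤ W) :
    (rootStage l).Ends W o s
      (((5 * n + d + 12) * (2 * (n * 4 ^ l.length)) + 3 * (n * 4 ^ l.length * d) + 7) *
        l.length + 1)
      fun t => ∃ N, HoldsVecs (t.real 2) N ∧ t.word 11 0 = N.length ∧
        RootState x n r l.toFinset N := by
  induction l with
  | nil =>
    -- Whatever array `2` contains serves as the corner, since no direction is constrained yet.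
    refine ends_setWord (by simp) (by simp; omega) ⟨[fun b => s.real 2 b], ?_, by simp, ?_⟩
    · intro i hi b
      obtain rfl : i = 0 := by simpa using hi
      simp
    · simpa using RootState.init hn _
  | cons a l ih =>
    have h4 : n * 4 ^ l.length ≤ n * 4 ^ (a :: l).length :=
      Nat.mul_le_mul_left _ (Nat.pow_le_pow_right (by norm_num) (by simp))
    have h5 : n * 4 ^ l.length * (d + 1) ≤ n * 4 ^ (a :: l).length * (d + 1) :=
      Nat.mul_le_mul_right _ h4
    rw [List.nodup_cons] at hl
    refine ends_seq_le (ih hl.2 (by omega)) (n' := (5 * n + d + 12) * (2 * (n * 4 ^ (a :: l).length)) +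
      3 * (n * 4 ^ (a :: l).length * d) + 7) ?_ ?_
    · have : ((5 * n + d + 12) * (2 * (n * 4 ^ l.length)) + 3 * (n * 4 ^ l.length * d) + 7) *
        l.length ≤ ((5 * n + d + 12) * (2 * (n * 4 ^ (a :: l).length)) +
          3 * (n * 4 ^ (a :: l).length * d) + 7) * l.length := by gcongr
      rw [List.length_cons, Nat.mul_succ]
      rw [List.length_cons] at this
      omega
    · rintro t ht ⟨N, h1, h2, h3⟩
      have hx' := hx.congr (t := t) (ht.1 0 fun h => by have := writesWord_rootStage h; omega)
        (ht.2 0 fun h => by have := writesReal_rootStage h; omega)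
        (ht.2 1 fun h => by have := writesReal_rootStage h; omega)
      exact ends_axisStage hl.1 hx' hr hW h1 h2 h3

end Cmd

/-! ### Subdivision of cubes -/

section Subdivision

variable {d : ℕ}

/-- A point is within `κ ℓ` of the cube of side `ℓ`. -/
def NearSome (x : ℕ → Fin d → ℝ) (n : ℕ) (B : Finset (Fin d)) (κ ℓ : ℝ) (u : Fin d → ℝ) : Prop :=
  ∃ i < n, NearBox B ℓ (κ * ℓ) u (x i)

/-- The lower corner of the half-size cube that is upper in the directions in `σ`. -/
noncomputable def child (ℓ : ℝ) (u : Fin d → ℝ) (σ : Finset (Fin d)) : Fin d → ℝ :=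
  fun b => if b ∈ σ then u b + ℓ / 2 else u b

open Classical in
/-- The parts of the cubes that are near a point. -/
noncomputable def children (x : ℕ → Fin d → ℝ) (n : ℕ) (B : Finset (Fin d)) (κ ℓ : ℝ)
    (L : List (Fin d → ℝ)) : List (Fin d → ℝ) :=
  L.flatMap fun u => if NearSome x n B κ ℓ u then B.powerset.toList.map (child ℓ u) else []

open Classical in
/-- The cubes that are not near a point, with their side. -/
noncomputable def farCubes (x : ℕ → Fin d → ℝ) (n : ℕ) (B : Finset (Fin d)) (κ ℓ : ℝ)
    (L : List (Fin d → ℝ)) : List ((Fin d → ℝ) × ℝ) :=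
  (L.filter fun u => ¬ NearSome x n B κ ℓ u).map fun u => (u, ℓ)

variable {x : ℕ → Fin d → ℝ} {n : ℕ} {r : ℝ} {B : Finset (Fin d)} {κ ℓ : ℝ}
  {L : List (Fin d → ℝ)} {E : List ((Fin d → ℝ) × ℝ)}

theorem child_subset (hℓ : 0 < ℓ) (u : Fin d → ℝ) (σ : Finset (Fin d)) :
    box B (ℓ / 2) (child ℓ u σ) ⊆ box B ℓ u := by
  intro p hp b hb
  have h := hp b hb
  simp only [child] at h
  split_ifs at h <;> rcases h with ⟨h1, h2 | h2⟩ <;>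
    exact ⟨by linarith, Or.inl (by linarith)⟩

/-- A direction in exactly one of `σ` and `τ` separates the two parts; being half-open, they do not
share the dividing face. -/
theorem child_disjoint (hℓ : 0 < ℓ) (u : Fin d → ℝ) {σ τ : Finset (Fin d)} (hσ : σ ⊆ B)
    (hτ : τ ⊆ B) (h : σ ≠ τ) :
    Disjoint (box B (ℓ / 2) (child ℓ u σ)) (box B (ℓ / 2) (child ℓ u τ)) := by
  obtain ⟨b, hb⟩ : ∃ b, ¬ (b ∈ σ ↔ b ∈ τ) := by
    by_contra! h'
    exact h (Finset.ext h')
  have hbB : b ∈ B := by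
    by_contra hbB
    exact hb ⟨fun h => absurd (hσ h) hbB, fun h => absurd (hτ h) hbB⟩
  rw [Set.disjoint_left]
  intro p hp hq
  have h1 := hp b hbB
  have h2 := hq b hbB
  simp only [child] at h1 h2
  by_cases h3 : b ∈ σ <;> by_cases h4 : b ∈ τ
  · exact hb (iff_of_true h3 h4)
  · rw [if_pos h3] at h1
    rw [if_neg h4] at h2
    rcases h2.2 with h5 | h5 <;> linarith [h1.1]
  · rw [if_neg h3] at h1
    rw [if_pos h4] at h2
    rcases h1.2 with h5 | h5 <;> linarith [h2.1]
  · exact hb (iff_of_false h3 h4)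

theorem exists_mem_child {u p : Fin d → ℝ} (hp : p ∈ box B ℓ u) (hℓ : 0 < ℓ) :
    ∃ σ ⊆ B, p ∈ box B (ℓ / 2) (child ℓ u σ) := by
  classical
  -- The directions in which `p` lies in the upper half.
  refine ⟨B.filter fun b => u b + ℓ / 2 ≤ p b, Finset.filter_subset _ _, fun b hb => ?_⟩
  obtain ⟨h1, h2⟩ := hp b hb
  by_cases h3 : u b + ℓ / 2 ≤ p b
  · simp only [child, Finset.mem_filter, hb, h3, and_self, if_true, true_and]
    rcases h2 with h2 | h2
    · exact Or.inl (by linarith)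
    · linarith
  · simp only [child, Finset.mem_filter, hb, h3, and_false, if_false]
    exact ⟨h1, Or.inl (by linarith)⟩

theorem mem_children {v : Fin d → ℝ} : v ∈ children x n B κ ℓ L ↔
    ∃ u ∈ L, NearSome x n B κ ℓ u ∧ ∃ σ ⊆ B, child ℓ u σ = v := by
  simp only [children, List.mem_flatMap]
  refine exists_congr fun u => and_congr_right fun _ => ?_
  split_ifs with h <;> simp [h]

theorem mem_farCubes {v : (Fin d → ℝ) × ℝ} : v ∈ farCubes x n B κ ℓ L ↔
    ∃ u ∈ L, ¬ NearSome x n B κ ℓ u ∧ (u, ℓ) = v := by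
  simp only [farCubes, List.mem_map, List.mem_filter, decide_eq_true_eq, and_assoc]

/-- The cubes in `L` of side `ℓ` and the cubes in `E` are disjoint and cover the cubes of radius `r`
around the points; those in `E` are far from the points. -/
structure LevelState (x : ℕ → Fin d → ℝ) (n : ℕ) (r : ℝ) (B : Finset (Fin d)) (κ ℓ : ℝ)
    (L : List (Fin d → ℝ)) (E : List ((Fin d → ℝ) × ℝ)) : Prop where
  disj : L.Pairwise fun u v => Disjoint (box B ℓ u) (box B ℓ v)
  disj_far : E.Pairwise fun u v => Disjoint (box B u.2 u.1) (box B v.2 v.1)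
  disj_cross : ∀ u ∈ L, ∀ v ∈ E, Disjoint (box B ℓ u) (box B v.2 v.1)
  cover : ∀ p : Fin d → ℝ, (∃ i < n, ∀ b ∈ B, |p b - x i b| ≤ r) →
    (∃ u ∈ L, p ∈ box B ℓ u) ∨ ∃ v ∈ E, p ∈ box B v.2 v.1
  far : ∀ v ∈ E, ¬ NearSome x n B κ v.2 v.1

theorem RootState.levelState (h : RootState x n r B L) : LevelState x n r B κ (3 * r) L [] :=
  ⟨h.disj, by simp, by simp, fun p hp => Or.inl (h.cover p hp), by simp⟩

/-- Parts stay inside their parents, so disjointness is inherited. A near cube is the union of its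
parts and a far cube becomes a leaf, so nothing covered is lost. -/
theorem LevelState.step (h : LevelState x n r B κ ℓ L E) (hℓ : 0 < ℓ) :
    LevelState x n r B κ (ℓ / 2) (children x n B κ ℓ L) (E ++ farCubes x n B κ ℓ L) := by
  have hfar : ∀ u ∈ L, ∀ v ∈ farCubes x n B κ ℓ L, NearSome x n B κ ℓ u →
      Disjoint (box B ℓ u) (box B v.2 v.1) := by
    intro u hu v hv hnu
    obtain ⟨w, hw, hnw, rfl⟩ := mem_farCubes.1 hv
    have : Std.Symm fun u v : Fin d → ℝ => Disjoint (box B ℓ u) (box B ℓ v) := ⟨fun _ _ h => h.symm⟩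
    have hne : u ≠ w := by rintro rfl; exact hnw hnu
    exact h.disj.forall hu hw hne
  refine ⟨?_, ?_, ?_, ?_, ?_⟩
  · rw [children, List.pairwise_flatMap]
    refine ⟨fun u _ => ?_, h.disj.imp fun {u v} huv w hw w' hw' => ?_⟩
    · split_ifs
      · rw [List.pairwise_map]
        refine (List.nodup_iff_pairwise_ne.1 (Finset.nodup_toList _)).imp_of_mem ?_
        intro σ τ hσ hτ hne
        rw [Finset.mem_toList, Finset.mem_powerset] at hσ hτ
        exact child_disjoint hℓ u hσ hτ hne
      · simp
    · split_ifs at hw hw' <;> simp only [List.mem_map, List.not_mem_nil] at hw hw'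
      obtain ⟨σ, -, rfl⟩ := hw
      obtain ⟨τ, -, rfl⟩ := hw'
      exact huv.mono (child_subset hℓ u σ) (child_subset hℓ v τ)
  · rw [List.pairwise_append]
    refine ⟨h.disj_far, ?_, ?_⟩
    · rw [farCubes, List.pairwise_map]
      exact h.disj.filter _
    · intro v hv w hw
      obtain ⟨u, hu, -, rfl⟩ := mem_farCubes.1 hw
      exact (h.disj_cross u hu v hv).symm
  · intro v hv w hw
    obtain ⟨u, hu, hnu, σ, -, rfl⟩ := mem_children.1 hv
    rcases List.mem_append.1 hw with hw | hw
    · exact (h.disj_cross u hu w hw).mono_left (child_subset hℓ u σ)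
    · exact (hfar u hu w hw hnu).mono_left (child_subset hℓ u σ)
  · intro p hp
    rcases h.cover p hp with ⟨u, hu, hpu⟩ | ⟨v, hv, hpv⟩
    · by_cases hnu : NearSome x n B κ ℓ u
      · obtain ⟨σ, hσ, hpσ⟩ := exists_mem_child hpu hℓ
        exact Or.inl ⟨_, mem_children.2 ⟨u, hu, hnu, σ, hσ, rfl⟩, hpσ⟩
      · exact Or.inr ⟨_, List.mem_append_right _ (mem_farCubes.2 ⟨u, hu, hnu, rfl⟩), hpu⟩
    · exact Or.inr ⟨v, List.mem_append_left _ hv, hpv⟩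
  · intro v hv
    rcases List.mem_append.1 hv with hv | hv
    · exact h.far v hv
    · obtain ⟨u, hu, hnu, rfl⟩ := mem_farCubes.1 hv
      exact hnu

theorem length_farCubes_le : (farCubes x n B κ ℓ L).length ≤ L.length := by
  rw [farCubes, List.length_map]
  exact List.length_filter_le _ _

theorem length_children_eq : (children x n B κ ℓ L).length = 2 ^ B.card *
    (L.filter fun u => open Classical in decide (NearSome x n B κ ℓ u)).length := by
  classical
  induction L with
  | nil => simp [children]
  | cons u L ih =>
    rw [children, List.flatMap_cons, ← children, List.length_append, ih, List.filter_cons]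
    split_ifs with h1 h2 h2
    · simp; ring
    · exact absurd h1 (by simpa using h2)
    · exact absurd (by simpa using h2) h1
    · simp

/-- Only near cubes have parts, and packing bounds their number by the number of points alone. Hence
the lists do not grow from level to level. -/
theorem LevelState.length_children_le (h : LevelState x n r B κ ℓ L E) (hℓ : 0 ≤ ℓ) {t : ℕ}
    (ht : κ ≤ t) : (children x n B κ ℓ L).length ≤ 2 ^ B.card * (n * (2 * t + 2) ^ B.card) := by
  rw [length_children_eq]
  refine Nat.mul_le_mul_left _ (length_le_of_disjoint_of_near (ℓ := ℓ) (ρ := κ * ℓ) (x := x) hℓ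
    (mul_le_mul_of_nonneg_right ht hℓ) (List.Pairwise.filter _ h.disj) fun u hu => ?_)
  show NearSome x n B κ ℓ u
  simpa only [decide_eq_true_eq] using (List.mem_filter.1 hu).2

theorem children_append (L L' : List (Fin d → ℝ)) :
    children x n B κ ℓ (L ++ L') = children x n B κ ℓ L ++ children x n B κ ℓ L' := by
  simp [children]

theorem farCubes_append (L L' : List (Fin d → ℝ)) :
    farCubes x n B κ ℓ (L ++ L') = farCubes x n B κ ℓ L ++ farCubes x n B κ ℓ L' := by
  simp [farCubes]

end Subdivision

/-! ### The leaves of the subdivision -/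

/-- The memory holds the list `E` of cubes, with their sides. -/
structure HoldsLeaves {d : ℕ} (s : Mem) (E : List ((Fin d → ℝ) × ℝ)) : Prop where
  num : s.word 17 0 = E.length
  corner : HoldsVecs (s.real 3) (E.map Prod.fst)
  side : ∀ (i : ℕ) (h : i < E.length), s.real 4 i = E[i].2

theorem HoldsLeaves.congr {d : ℕ} {s t : Mem} {E : List ((Fin d → ℝ) × ℝ)} (h : HoldsLeaves s E)
    (hw : t.word 17 = s.word 17) (h3 : t.real 3 = s.real 3) (h4 : t.real 4 = s.real 4) :
    HoldsLeaves t E :=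
  ⟨by rw [hw, h.num], by rw [h3]; exact h.corner, by rw [h4]; exact h.side⟩

namespace Cmd

variable {W : ℕ} {o : Solver} {s : Mem} {d : ℕ} {x : ℕ → Fin d → ℝ} {n : ℕ} {r : ℝ}

/-- Append the current cube to the list of leaves. -/
def pushLeaf (d : ℕ) : Cmd :=
  .seq (.setReal 4 (.var 17) (.var 9)) (pushVec 3 17 fun b : Fin d => cellCoord b)

@[simp] theorem writesWord_pushLeaf {a : ℕ} : (pushLeaf d).WritesWord a ↔ a = 17 := by
  simp [pushLeaf, writesWord_pushVec]

theorem writesReal_pushLeaf {a : ℕ} (h : (pushLeaf d).WritesReal a) : a = 3 ∨ a = 4 := by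
  simp only [pushLeaf, writesReal_seq, writesReal_setReal] at h
  rcases h with h | h
  · exact Or.inr h
  · exact Or.inl (writesReal_pushVec h)

theorem ends_pushLeaf {E : List ((Fin d → ℝ) × ℝ)} {u : Fin d → ℝ} (hE : HoldsLeaves s E)
    (hW : E.length + 1 ≤ W) (hu : ∀ b : Fin d, s.real 2 (s.word 13 0 * d + b) = u b) :
    (pushLeaf d).Ends W o s (d + 3) fun t => HoldsLeaves t (E ++ [(u, s.real 9 0)]) := by
  refine ends_seq_setReal (n := d + 2) (ends_pushVec (l := E.map Prod.fst) (by simp)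
    (by simp [hE.num]) (by simpa using hW) (by simpa using hE.corner) fun t h1 h2 h3 h4 => ?_)
  refine ⟨by simpa using h3, by simpa [hu] using h4, fun i hi => ?_⟩
  rw [h2 4 (by norm_num)]
  simp only [WExp.eval_get, WExp.eval_const, hE.num, RExp.eval_get, Mem.setReal_real_self]
  rw [List.length_append, List.length_singleton] at hi
  rcases Nat.lt_succ_iff_lt_or_eq.1 hi with h | rfl
  · rw [Function.update_of_ne h.ne, List.getElem_append_left h, hE.side i h]
  · simp

/-- Treat one cube: if it is near a point, keep its parts, otherwise make it a leaf. -/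
noncomputable def levelCell (l : List (Fin d)) (κ : RExp) : Cmd :=
  .seq (findMin (.get 0 1) (nearTest l (.var 9) (κ * .var 9)) 0)
    (.ite (.wordLt 0 (.var 16))
      (forEach (fun σ => pushVec 12 12 fun b => if b ∈ σ then cellCoord b + .var 9 / 2
        else cellCoord b) l.toFinset.powerset.toList)
      (pushLeaf d))

@[simp] theorem writesWord_levelCell {l : List (Fin d)} {κ : RExp} {a : ℕ}
    (h : (levelCell l κ).WritesWord a) : a = 12 ∨ a = 14 ∨ a = 16 ∨ a = 17 := by
  simp only [levelCell, writesWord_seq, writesWord_findMin, writesWord_ite, writesWord_forEach,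
    writesWord_pushLeaf, writesWord_pushVec] at h
  rcases h with h | ⟨_, _, h⟩ | h <;> omega

theorem writesReal_levelCell {l : List (Fin d)} {κ : RExp} {a : ℕ}
    (h : (levelCell l κ).WritesReal a) : a = 3 ∨ a = 4 ∨ a = 11 ∨ a = 12 := by
  simp only [levelCell, writesReal_seq, writesReal_findMin, writesReal_ite, writesReal_forEach] at h
  rcases h with h | ⟨_, _, h⟩ | h
  · omega
  · have := writesReal_pushVec h; omega
  · have := writesReal_pushLeaf h; omega

/-- The search is used as an existence test for a nearby point. Treating a single cube is expressed
by `children` and `farCubes` of a one-element list, so that the loop over a level is mere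
concatenation. -/
theorem ends_levelCell {l : List (Fin d)} {κe : RExp} {κ ℓ : ℝ} {L : List (Fin d → ℝ)}
    {u : Fin d → ℝ} {E : List ((Fin d → ℝ) × ℝ)} (hx : HoldsPoints x n r s)
    (hκ : ∀ t, t.word 0 = s.word 0 → t.real 0 = s.real 0 → κe.eval t = κ)
    (hℓ : s.real 9 0 = ℓ) (hE : HoldsLeaves s E)
    (hW : n + L.length + 2 ^ l.length + E.length + 1 ≤ W)
    (hu : ∀ b : Fin d, s.real 2 (s.word 13 0 * d + b) = u b)
    (hL : HoldsVecs (s.real 12) L) (hL' : s.word 12 0 = L.length) :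
    (levelCell l κe).Ends W o s (5 * n + 5 + (d + 3) * 2 ^ l.length) fun t =>
      HoldsVecs (t.real 12) (L ++ children x n l.toFinset κ ℓ [u]) ∧
      t.word 12 0 = (L ++ children x n l.toFinset κ ℓ [u]).length ∧
      HoldsLeaves t (E ++ farCubes x n l.toFinset κ ℓ [u]) := by
  classical
  have h2 : 1 ≤ 2 ^ l.length := Nat.one_le_two_pow
  have h3 : d + 3 ≤ (d + 3) * 2 ^ l.length := Nat.le_mul_of_pos_right _ h2
  refine ends_seq_le (n := 5 * n + 3) (n' := 2 + (d + 3) * 2 ^ l.length)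
    (ends_findMin (m := n) (P := fun i => NearBox l.toFinset ℓ (κ * ℓ) u (x i))
      (v := fun _ => 0) ?_ (by omega)) (by omega) ?_
  · intro t hw hrl
    have hx' := hx.congr (hw 0 (by simp) (by simp)) (hrl 0 (by simp)) (hrl 1 (by simp))
    refine ⟨by simp [hx'.num], fun j hj htj => ⟨?_, by simp⟩⟩
    rw [eval_nearTest (x := x j) (lo := u)]
    · simp [hrl 9, hℓ, hκ t (hw 0 (by simp) (by simp)) (hrl 0 (by simp))]
    · intro b; rw [htj, hx'.point j hj]
    · intro b; rw [hw 13 (by simp) (by simp), hrl 2 (by simp), hu]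
  · intro t hs ht
    have h13 : t.word 13 = s.word 13 := hs.1 13 (by simp)
    have h12 : t.word 12 = s.word 12 := hs.1 12 (by simp)
    have hr2 : t.real 2 = s.real 2 := hs.2 2 (by simp)
    have hr9 : t.real 9 = s.real 9 := hs.2 9 (by simp)
    have hr12 : t.real 12 = s.real 12 := hs.2 12 (by simp)
    have hE' : HoldsLeaves t E := hE.congr (hs.1 17 (by simp)) (hs.2 3 (by simp)) (hs.2 4 (by simp))
    rw [show 2 + (d + 3) * 2 ^ l.length = 1 + (d + 3) * 2 ^ l.length + 1 by omega]
    refine ends_ite (fun h => ?_) fun h => ?_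
    · rcases ht with ht | ⟨-, i, hi, hP, -⟩
      · simp [ht.1] at h
      have hnear : NearSome x n l.toFinset κ ℓ u := ⟨i, hi, hP⟩
      have hcard : l.toFinset.powerset.toList.length ≤ 2 ^ l.length := by
        rw [Finset.length_toList, Finset.card_powerset]
        exact Nat.pow_le_pow_right (by norm_num) (List.toFinset_card_le l)
      have hfe := ends_forEach (W := W) (o := o) (s := t) (C := d + 2)
        (f := fun σ => pushVec 12 12 fun b : Fin d => if b ∈ σ then cellCoord b + .var 9 / 2
          else cellCoord b)
        (fun K t => HoldsVecs (t.real 12) (L ++ K.map (child ℓ u)) ∧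
          t.word 12 0 = (L ++ K.map (child ℓ u)).length) l.toFinset.powerset.toList
        (by simpa [hr12, h12] using ⟨hL, hL'⟩) ?_
      · refine hfe.mono ?_ fun t' ht' hI => ?_
        · have h4 : (d + 2) * l.toFinset.powerset.toList.length ≤ (d + 2) * 2 ^ l.length :=
            Nat.mul_le_mul_left _ hcard
          have h5 : (d + 3) * 2 ^ l.length = (d + 2) * 2 ^ l.length + 2 ^ l.length := by ring
          omega
        · have hfar : farCubes x n l.toFinset κ ℓ [u] = [] := by simp [farCubes, hnear]
          have hch : children x n l.toFinset κ ℓ [u] =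
              l.toFinset.powerset.toList.map (child ℓ u) := by simp [children, hnear]
          rw [hfar, hch, List.append_nil]
          refine ⟨hI.1, hI.2, hE'.congr (ht'.1 17 ?_) (ht'.2 3 ?_) (ht'.2 4 ?_)⟩
          · simp [writesWord_forEach, writesWord_pushVec]
          all_goals
            rw [writesReal_forEach]
            rintro ⟨_, _, h⟩
            have := writesReal_pushVec h
            omega
      · rintro l₁ σ l₂ hl t' ht' ⟨hI1, hI2⟩
        have h13' : t'.word 13 = s.word 13 :=
          (ht'.1 13 (by simp [writesWord_forEach, writesWord_pushVec])).trans h13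
        have hre : ∀ a, a ≠ 12 → t'.real a = t.real a := fun a ha => ht'.2 a (by
          rw [writesReal_forEach]
          rintro ⟨_, _, h⟩
          exact ha (writesReal_pushVec h))
        have hlen := congrArg List.length hl
        simp only [List.length_append, List.length_cons] at hlen
        refine ends_pushVec (fun b => ?_) hI2 ?_ hI1 fun v h1 h2 h3 h4 => ?_
        · split_ifs <;> simp
        · simp only [List.length_append, List.length_map]
          omega
        · have hv : (fun b : Fin d => RExp.eval t' (if b ∈ σ then cellCoord b + .var 9 / 2
              else cellCoord b)) = child ℓ u σ := by
            funext b
            simp only [child]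
            split_ifs <;> simp [hre 2, hre 9, hr2, hr9, h13', hu, hℓ]
          rw [hv] at h3 h4
          rw [List.append_assoc] at h3 h4
          exact ⟨by simpa using h4, by simpa using h3⟩
    · rcases ht with ⟨-, hno⟩ | ht
      swap
      · simp [ht.1] at h
      have hnear : ¬ NearSome x n l.toFinset κ ℓ u := fun ⟨i, hi, hP⟩ => hno i hi hP
      have hfar : farCubes x n l.toFinset κ ℓ [u] = [(u, ℓ)] := by simp [farCubes, hnear]
      have hch : children x n l.toFinset κ ℓ [u] = [] := by simp [children, hnear]
      rw [hfar, hch, List.append_nil]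
      refine (ends_pushLeaf hE' (by omega) (u := u) (by simpa [hr2, h13] using hu)).mono (by omega) ?_
      intro t' ht' hI
      refine ⟨?_, ?_, by simpa [hr9, hℓ] using hI⟩
      · rw [ht'.2 12 fun h => by have := writesReal_pushLeaf h; omega, hr12]
        exact hL
      · rw [ht'.1 12 (by simp), h12, hL']

/-- Subdivide the current cubes. -/
noncomputable def levelStep (l : List (Fin d)) (κ : RExp) : Cmd :=
  .seq (.setWord 12 0 0) (.seq (forTo 13 (.var 11) (levelCell l κ))
    (.seq (copyCells d) (.setReal 9 0 (.var 9 / 2))))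

theorem writesWord_levelStep {l : List (Fin d)} {κ : RExp} {a : ℕ}
    (h : (levelStep l κ).WritesWord a) : 11 ≤ a ∧ a ≤ 17 := by
  simp only [levelStep, writesWord_seq, writesWord_setWord, writesWord_forTo, writesWord_copyCells,
    writesWord_setReal, or_false] at h
  rcases h with h | (h | h) | h
  · omega
  · omega
  · have := writesWord_levelCell h; omega
  · omega

theorem writesReal_levelStep {l : List (Fin d)} {κ : RExp} {a : ℕ}
    (h : (levelStep l κ).WritesReal a) : 2 ≤ a ∧ a ≤ 12 := by
  simp only [levelStep, writesReal_seq, writesReal_setWord, writesReal_forTo, writesReal_copyCells,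
    writesReal_setReal, false_or] at h
  rcases h with h | h | h
  · have := writesReal_levelCell h; omega
  · omega
  · omega

/-- The word bound is needed for the lists in progress; these come from prefixes of `L` and are no
longer than the final ones. -/
theorem ends_levelStep {l : List (Fin d)} {κe : RExp} {κ ℓ : ℝ} {L : List (Fin d → ℝ)}
    {E : List ((Fin d → ℝ) × ℝ)} (hx : HoldsPoints x n r s)
    (hκ : ∀ t, t.word 0 = s.word 0 → t.real 0 = s.real 0 → κe.eval t = κ)
    (hℓ : s.real 9 0 = ℓ) (hE : HoldsLeaves s E) {m : ℕ} (hm : L.length ≤ m)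
    (hm' : (children x n l.toFinset κ ℓ L).length ≤ m)
    (hW : n + m * (d + 1) + 2 ^ l.length + E.length + m + 1 ≤ W)
    (hL : HoldsVecs (s.real 2) L) (hL' : s.word 11 0 = L.length) :
    (levelStep l κe).Ends W o s ((5 * n + 7 + (d + 3) * 2 ^ l.length) * m + 3 * (m * d) + 7) fun t =>
      HoldsVecs (t.real 2) (children x n l.toFinset κ ℓ L) ∧
      t.word 11 0 = (children x n l.toFinset κ ℓ L).length ∧ t.real 9 0 = ℓ / 2 ∧
      HoldsLeaves t (E ++ farCubes x n l.toFinset κ ℓ L) := by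
  have hmd : m ≤ m * (d + 1) := Nat.le_mul_of_pos_right _ (by omega)
  have h2l : 1 ≤ 2 ^ l.length := Nat.one_le_two_pow
  refine ends_seq_setWord
    (n := (5 * n + 7 + (d + 3) * 2 ^ l.length) * m + 3 * (m * d) + 6) (by simp) ?_
  have h1 : (5 * n + 5 + (d + 3) * 2 ^ l.length + 2) * L.length ≤
      (5 * n + 7 + (d + 3) * 2 ^ l.length) * m :=
    Nat.mul_le_mul (by ring_nf; rfl) hm
  refine ends_seq_le (n' := 3 * (m * d) + 4) (ends_forTo (m := L.length)
    (C := 5 * n + 5 + (d + 3) * 2 ^ l.length) (fun c t =>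
      HoldsVecs (t.real 12) (children x n l.toFinset κ ℓ (L.take c)) ∧
      t.word 12 0 = (children x n l.toFinset κ ℓ (L.take c)).length ∧
      HoldsLeaves t (E ++ farCubes x n l.toFinset κ ℓ (L.take c)))
    (fun h => by have := writesWord_levelCell h; omega) ?_ (by omega) ?_ ?_) (by omega) ?_
  · intro t ht
    have h11 : t.word 11 = s.word 11 := (ht.1 11 (by
      rw [writesWord_forTo]
      rintro (h | h)
      · omega
      · have := writesWord_levelCell h; omega)).trans (by simp)
    simp [h11, hL']
  · simpa [children, farCubes, HoldsVecs] using hE.congr (by simp) (by simp) (by simp)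
  · rintro c hc t ht htc ⟨hI1, hI2, hI3⟩
    have hww : ∀ a, a ≠ 12 → a ≠ 13 → a ≠ 14 → a ≠ 16 → a ≠ 17 → t.word a = s.word a :=
      fun a h1 h2 h3 h4 h5 => (ht.1 a (by
        rw [writesWord_forTo]
        rintro (h | h)
        · omega
        · have := writesWord_levelCell h; omega)).trans (by simp [h1])
    have hrr : ∀ a, a ≠ 3 → a ≠ 4 → a ≠ 11 → a ≠ 12 → t.real a = s.real a :=
      fun a h1 h2 h3 h4 => ht.2 a (by
        rw [writesReal_forTo]
        intro h
        have := writesReal_levelCell h; omega)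
    have hw0 : t.word 0 = s.word 0 := hww 0 (by simp) (by simp) (by simp) (by simp) (by simp)
    have hr0 : t.real 0 = s.real 0 := hrr 0 (by simp) (by simp) (by simp) (by simp)
    have hx' := hx.congr hw0 hr0 (hrr 1 (by simp) (by simp) (by simp) (by simp))
    have hlen1 : (children x n l.toFinset κ ℓ (L.take c)).length ≤
        (children x n l.toFinset κ ℓ L).length := by
      conv_rhs => rw [← List.take_append_drop c L, children_append, List.length_append]
      omega
    have hlen2 : (farCubes x n l.toFinset κ ℓ (L.take c)).length ≤ m :=
      length_farCubes_le.trans ((List.length_take_le' _ _).trans hm)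
    refine (ends_levelCell (u := L[c]) (ℓ := ℓ) hx'
      (fun u h1 h2 => hκ u (h1.trans hw0) (h2.trans hr0))
      (by rw [hrr 9 (by simp) (by simp) (by simp) (by simp), hℓ]) hI3
      (by rw [List.length_append]; omega) (fun b => ?_) hI1 hI2).mono le_rfl ?_
    · rw [htc, hrr 2 (by simp) (by simp) (by simp) (by simp), hL c hc]
    · rintro t' - ⟨h2, h3, h4⟩
      rw [List.take_succ_eq_append_getElem hc, children_append, farCubes_append]
      rw [List.append_assoc] at h4
      exact ⟨by simpa using h2, by simpa using h3, h4.congr (by simp) (by simp) (by simp)⟩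
  · rintro t ht ⟨hI1, hI2, hI3⟩
    rw [List.take_length] at hI1 hI2 hI3
    have h2 : (children x n l.toFinset κ ℓ L).length * d ≤ m * d := Nat.mul_le_mul_right _ hm'
    have h3 : (children x n l.toFinset κ ℓ L).length * (d + 1) ≤ m * (d + 1) :=
      Nat.mul_le_mul_right _ hm'
    refine ends_seq_le (n := 3 * (m * d) + 3) (n' := 1)
      ((ends_copyCells hI1 hI2 (by omega)).mono (by omega) fun _ _ h => h) le_rfl ?_
    rintro t' ht' ⟨h4, h5⟩
    have hr9 : t'.real 9 = s.real 9 := (ht'.2 9 (by simp)).trans ((ht.2 9 (by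
        rw [writesReal_forTo]
        intro h
        have := writesReal_levelCell h; omega)).trans (by simp))
    refine ends_setReal le_rfl ⟨by simpa using h4, by simpa using h5, by simp [hr9, hℓ], ?_⟩
    exact hI3.congr (by simpa using ht'.1 17 (by simp)) (by simpa using ht'.2 3 (by simp))
      (by simpa using ht'.2 4 (by simp))

/-- Subdivide the cubes until `μ ℓ ≤ τ` for their side `ℓ`. -/
noncomputable def levelStage (l : List (Fin d)) (κ μ τ : RExp) : Cmd :=
  .seq (.setReal 9 0 (3 * radius)) (.seq (.setWord 17 0 0)
    (.seq (.loop (.realLt τ (μ * .var 9)) (levelStep l κ)) (forTo 13 (.var 11) (pushLeaf d))))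

theorem writesWord_levelStage {l : List (Fin d)} {κ μ τ : RExp} {a : ℕ}
    (h : (levelStage l κ μ τ).WritesWord a) : 11 ≤ a ∧ a ≤ 17 := by
  simp only [levelStage, writesWord_seq, writesWord_setWord, writesWord_forTo, writesWord_loop,
    writesWord_setReal, writesWord_pushLeaf, false_or] at h
  rcases h with h | h | h
  · omega
  · exact writesWord_levelStep h
  · omega

theorem writesReal_levelStage {l : List (Fin d)} {κ μ τ : RExp} {a : ℕ}
    (h : (levelStage l κ μ τ).WritesReal a) : 2 ≤ a ∧ a ≤ 12 := by
  simp only [levelStage, writesReal_seq, writesReal_setWord, writesReal_forTo, writesReal_loop,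
    writesReal_setReal, false_or] at h
  rcases h with h | h | h
  · omega
  · exact writesReal_levelStep h
  · have := writesReal_pushLeaf h; omega

/-- The cubes are disjoint, cover the cubes of radius `r` around the points, and each of them is
far from the points or small. -/
structure IsLeafList (x : ℕ → Fin d → ℝ) (n : ℕ) (r : ℝ) (B : Finset (Fin d)) (κ μ τ : ℝ)
    (E : List ((Fin d → ℝ) × ℝ)) : Prop where
  disj : E.Pairwise fun u v => Disjoint (box B u.2 u.1) (box B v.2 v.1)
  cover : ∀ p : Fin d → ℝ, (∃ i < n, ∀ b ∈ B, |p b - x i b| ≤ r) → ∃ v ∈ E, p ∈ box B v.2 v.1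
  far : ∀ v ∈ E, ¬ NearSome x n B κ v.2 v.1 ∨ μ * v.2 ≤ τ

/-- At level `j` the side is `3 r / 2 ^ j`, so the test fails at level `J` at the latest. Each level
contributes at most `m` far cubes and the last one at most `m` small cubes, hence `(J + 1) * m`
leaves. The program does not know `J`; the rank counts the levels that remain. -/
theorem ends_levelStage {l : List (Fin d)} {κe μe τe : RExp} {κ μ τ : ℝ} {L : List (Fin d → ℝ)}
    (hx : HoldsPoints x n r s) (hr : 0 ≤ r) (hτ : 0 ≤ τ) {J t m : ℕ}
    (hκ : ∀ t, t.word 0 = s.word 0 → t.real 0 = s.real 0 → κe.eval t = κ)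
    (hμ : ∀ t, t.word 0 = s.word 0 → t.real 0 = s.real 0 → μe.eval t = μ)
    (hτe : ∀ t, t.word 0 = s.word 0 → t.real 0 = s.real 0 → τe.eval t = τ)
    (hJ : μ * (3 * r) ≤ τ * 2 ^ J) (ht : κ ≤ t) (ht1 : 1 ≤ t)
    (hm : m = 2 ^ l.length * (n * (2 * t + 2) ^ l.length))
    (hW : n + m * (d + 1) + 2 ^ l.length + (J + 1) * m + 1 ≤ W)
    (hL : HoldsVecs (s.real 2) L) (hL' : s.word 11 0 = L.length)
    (hR : RootState x n r l.toFinset L) :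
    (levelStage l κe μe τe).Ends W o s
      (((5 * n + 7 + (d + 3) * 2 ^ l.length) * m + 3 * (m * d) + 8) * J + (d + 5) * m + 5)
      fun t => ∃ E, HoldsLeaves t E ∧ E.length ≤ (J + 1) * m ∧
        IsLeafList x n r l.toFinset κ μ τ E := by
  have hmd : m ≤ m * (d + 1) := Nat.le_mul_of_pos_right _ (by omega)
  have h2l : 1 ≤ 2 ^ l.length := Nat.one_le_two_pow
  have hLm : L.length ≤ m := by
    refine (hR.length_le hr).trans ?_
    rw [hm]
    calc n * 4 ^ l.toFinset.card ≤ n * (2 * t + 2) ^ l.length := by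
          exact Nat.mul_le_mul_left _ ((Nat.pow_le_pow_left (by omega) _).trans
            (Nat.pow_le_pow_right (by omega) (List.toFinset_card_le l)))
      _ ≤ _ := Nat.le_mul_of_pos_left _ (by positivity)
  set T := (5 * n + 7 + (d + 3) * 2 ^ l.length) * m + 3 * (m * d) + 7 with hT
  refine ends_seq_setReal (n := (T + 1) * J + (d + 5) * m + 4) ?_
  refine ends_seq_setWord (n := (T + 1) * J + (d + 5) * m + 3) (by simp) ?_
  obtain ⟨s₁, hs₁⟩ : ∃ s₁, s₁ = (s.setReal 9 0 (((3 : ℕ) : ℝ) * s.real 0 2)).setWord 17 0 0 :=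
    ⟨_, rfl⟩
  change Ends W o _ ((s.setReal 9 0 (((3 : ℕ) : ℝ) * s.real 0 2)).setWord 17 0 0) _ _
  rw [← hs₁]
  have hx₁ : HoldsPoints x n r s₁ := hx.congr (by simp [hs₁]) (by simp [hs₁]) (by simp [hs₁])
  have hB : ∀ {κ ℓ} {L : List (Fin d → ℝ)} {E}, LevelState x n r l.toFinset κ ℓ L E → 0 ≤ ℓ →
      κ ≤ t → (children x n l.toFinset κ ℓ L).length ≤ m := fun h h0 h1 => by
    refine (h.length_children_le h0 h1).trans ?_
    rw [hm]
    gcongr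
    · norm_num
    · exact List.toFinset_card_le l
    · omega
    · exact List.toFinset_card_le l
  refine ends_seq_le (n := (T + 1) * J + 1) (n' := (d + 5) * m + 2) (R := fun t => ∃ L ℓ E,
      HoldsVecs (t.real 2) L ∧ t.word 11 0 = L.length ∧ t.real 9 0 = ℓ ∧ HoldsLeaves t E ∧
      L.length ≤ m ∧ E.length ≤ J * m ∧ LevelState x n r l.toFinset κ ℓ L E ∧ μ * ℓ ≤ τ) ?_
      (by omega) ?_
  · refine (ends_loop_rank (fun k t => ∃ j L ℓ E, HoldsVecs (t.real 2) L ∧ t.word 11 0 = L.length ∧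
      t.real 9 0 = ℓ ∧ HoldsLeaves t E ∧ L.length ≤ m ∧ E.length ≤ j * m ∧
      LevelState x n r l.toFinset κ ℓ L E ∧ j ≤ J ∧ k = (T + 1) * (J - j) ∧ ℓ * 2 ^ j = 3 * r)
      (k := (T + 1) * J) ?_ ?_).mono le_rfl ?_
    · refine ⟨0, L, 3 * r, [], ?_, by simp [hs₁, hL'], by simp [hs₁, hx.rad], ?_, hLm, by simp,
        hR.levelState, by simp, by simp, by simp⟩
      · simpa [hs₁] using hL
      · exact ⟨by simp [hs₁], by simp [HoldsVecs], by simp⟩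
    · rintro k u hu ⟨j, L, ℓ, E, h1, h2, h3, h4, h5, h6, h7, h8, rfl, h9⟩ hb
      have hw0 : u.word 0 = s.word 0 := (hu.1 0 fun h => by
        have := writesWord_levelStep h; omega).trans (by simp [hs₁])
      have hr0 : u.real 0 = s.real 0 := (hu.2 0 fun h => by
        have := writesReal_levelStep h; omega).trans (by simp [hs₁])
      have hr1 : u.real 1 = s.real 1 := (hu.2 1 fun h => by
        have := writesReal_levelStep h; omega).trans (by simp [hs₁])
      have hx' := hx.congr hw0 hr0 hr1
      have hℓ0 : 0 ≤ ℓ := by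
        have : (0:ℝ) < 2 ^ j := by positivity
        by_contra hneg
        have := mul_neg_of_neg_of_pos (not_le.1 hneg) this
        linarith
      simp only [Test.eval_realLt, hτe u hw0 hr0, RExp.eval_mul, hμ u hw0 hr0, RExp.eval_get,
        WExp.eval_const, h3] at hb
      -- The test can hold only for positive sides; for `r = 0` the loop ends at once.
      have hℓ : 0 < ℓ := by
        rcases hℓ0.eq_or_lt with h | h
        · rw [← h] at hb; linarith
        · exact h
      -- At `j = J` the hypothesis `hJ` reads `μ ℓ ≤ τ` after cancelling `2 ^ J`.
      have hjJ : j < J := by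
        by_contra hj
        obtain rfl : j = J := by omega
        rw [← h9] at hJ
        have h2j : (0:ℝ) < 2 ^ j := by positivity
        have : τ * 2 ^ j < μ * ℓ * 2 ^ j := mul_lt_mul_of_pos_right hb h2j
        linarith
      have hch := hB h7 hℓ0 ht
      have h10 : j * m ≤ J * m := Nat.mul_le_mul_right _ h8
      rw [add_mul, one_mul] at hW
      refine ⟨T, (ends_levelStep hx' (fun v a b => hκ v (a.trans hw0) (b.trans hr0)) h3 h4 h5 hch
        (by omega) h1 h2).mono le_rfl ?_⟩
      rintro v - ⟨h11, h12, h13, h14⟩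
      refine ⟨_, ⟨j + 1, _, _, _, h11, h12, h13, h14, hch, ?_, h7.step hℓ, hjJ, rfl, ?_⟩, ?_⟩
      · rw [List.length_append, add_mul, one_mul]
        exact Nat.add_le_add h6 (length_farCubes_le.trans h5)
      · rw [pow_succ, ← h9]; ring
      · obtain ⟨i, rfl⟩ : ∃ i, J = j + 1 + i := ⟨J - (j + 1), by omega⟩
        rw [show j + 1 + i - (j + 1) = i by omega, show j + 1 + i - j = i + 1 by omega]
        ring_nf; omega
    · rintro u hu ⟨k, ⟨j, L, ℓ, E, h1, h2, h3, h4, h5, h6, h7, h8, -, h9⟩, hb⟩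
      have hw0 : u.word 0 = s.word 0 := (hu.1 0 fun h => by
        have := writesWord_levelStep h; omega).trans (by simp [hs₁])
      have hr0 : u.real 0 = s.real 0 := (hu.2 0 fun h => by
        have := writesReal_levelStep h; omega).trans (by simp [hs₁])
      simp only [Test.eval_realLt, hτe u hw0 hr0, RExp.eval_mul, hμ u hw0 hr0, RExp.eval_get,
        WExp.eval_const, h3, not_lt] at hb
      exact ⟨L, ℓ, E, h1, h2, h3, h4, h5, h6.trans (Nat.mul_le_mul_right _ h8), h7, hb⟩
  · rintro u hu ⟨L, ℓ, E, h1, h2, h3, h4, h5, h6, h7, h8⟩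
    rw [add_mul, one_mul] at hW
    have h9 : (d + 3 + 2) * L.length ≤ (d + 5) * m := Nat.mul_le_mul_left _ h5
    refine (ends_forTo (m := L.length) (C := d + 3) (fun c t =>
      HoldsLeaves t (E ++ (L.take c).map fun u => (u, ℓ))) (by simp) ?_ (by omega) ?_ ?_).mono
      (by omega) ?_
    · intro v hv
      simp [hv.1 11 (by simp), h2]
    · simpa using h4.congr (by simp) (by simp) (by simp)
    · intro c hc v hv hvc hI
      have hrr : ∀ a, a ≠ 3 → a ≠ 4 → v.real a = u.real a := fun a ha ha' => hv.2 a (by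
        rw [writesReal_forTo]
        intro h
        have := writesReal_pushLeaf h; omega)
      refine (ends_pushLeaf hI ?_ (u := L[c]) ?_).mono le_rfl ?_
      · simp only [List.length_append, List.length_map, List.length_take]
        omega
      · intro b
        rw [hvc, hrr 2 (by simp) (by simp), h1 c hc]
      · intro w _ hw
        rw [hrr 9 (by simp) (by simp), h3] at hw
        rw [List.take_succ_eq_append_getElem hc, List.map_append, ← List.append_assoc]
        exact hw.congr (by simp) (by simp) (by simp)
    · intro v _ hv
      rw [List.take_length] at hv
      refine ⟨_, hv, ?_, ?_, ?_, ?_⟩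
      · simp only [List.length_append, List.length_map, add_mul, one_mul]
        omega
      · rw [List.pairwise_append]
        refine ⟨h7.disj_far, by simpa [List.pairwise_map] using h7.disj, ?_⟩
        intro a ha b hb
        obtain ⟨w, hw, rfl⟩ := List.mem_map.1 hb
        exact (h7.disj_cross w hw a ha).symm
      · intro p hp
        rcases h7.cover p hp with ⟨w, hw, hpw⟩ | ⟨w, hw, hpw⟩
        · exact ⟨(w, ℓ), List.mem_append_right _ (List.mem_map.2 ⟨w, hw, rfl⟩), hpw⟩
        · exact ⟨w, List.mem_append_left _ hw, hpw⟩
      · intro a ha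
        rcases List.mem_append.1 ha with ha | ha
        · exact Or.inl (h7.far a ha)
        · obtain ⟨w, hw, rfl⟩ := List.mem_map.1 ha
          exact Or.inr h8

end Cmd

/-! ### Counting the results of an acyclic join -/

section Elimination

variable {d m : ℕ}

/-- A list of pairs (relation, neighbour) that removes all relations in `V` but `ρ`: when a relation
is removed, the attributes that it shares with the remaining ones belong to its neighbour. -/
inductive EliminationOrder (A : Fin m → Finset (Fin d)) :
    Finset (Fin m) → List (Fin m × Fin m) → Fin m → Prop
  | root (ρ : Fin m) : EliminationOrder A {ρ} [] ρ
  | step {V : Finset (Fin m)} {es : List (Fin m × Fin m)} {ρ j p : Fin m} (hj : j ∉ V) (hp : p ∈ V)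
      (h : ∀ i ∈ V, A i ∩ A j ⊆ A p) (hV : EliminationOrder A V es ρ) :
      EliminationOrder A (insert j V) ((j, p) :: es) ρ

variable (A : Fin m → Finset (Fin d)) (R : Fin m → ℕ → Fin d → ℕ) {N : ℕ}

/-- Tuple `k` of relation `j` and tuple `l` of relation `p` agree on the common attributes. -/
def Joins (j p : Fin m) (k l : ℕ) : Prop := ∀ a ∈ A j ∩ A p, R j k a = R p l a

/-- The chosen tuples of the relations in `V` agree pairwise. -/
def ConsistentOn (V : Finset (Fin m)) (l : Fin m → Fin N) : Prop :=
  ∀ i ∈ V, ∀ j ∈ V, Joins A R i j (l i) (l j)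

open Classical in
/-- The total weight of the consistent choices of tuples of the relations in `V`. -/
noncomputable def joinWeight (z : Fin N) (V : Finset (Fin m)) (c : Fin m → ℕ → ℝ) : ℝ :=
  ∑ l : Fin m → Fin N with (∀ v ∉ V, l v = z) ∧ ConsistentOn A R V l, ∏ v ∈ V, c v (l v)

open Classical in
/-- Move the weights of relation `j` to relation `p`. -/
noncomputable def moveWeights (N : ℕ) (c : Fin m → ℕ → ℝ) (j p : Fin m) : Fin m → ℕ → ℝ :=
  Function.update c p fun l =>
    c p l * ∑ k ∈ Finset.range N, if Joins A R j p k l then c j k else 0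

variable {A R}

theorem Joins.symm {j p : Fin m} {k l : ℕ} (h : Joins A R j p k l) : Joins A R p j l k :=
  fun a ha => (h a (by rwa [Finset.inter_comm])).symm

theorem ConsistentOn.congr {V : Finset (Fin m)} {l l' : Fin m → Fin N}
    (h : ConsistentOn A R V l) (hl : ∀ v ∈ V, l' v = l v) : ConsistentOn A R V l' :=
  fun i hi j hj => by rw [hl i hi, hl j hj]; exact h i hi j hj

/-- Every attribute that `j` shares with a relation `i` of `V` also occurs in `p`. Agreement of `j`
with `i` thus follows from agreement of `j` with `p` and of `p` with `i`. -/
theorem consistentOn_insert {V : Finset (Fin m)} {j p : Fin m} {l : Fin m → Fin N} (hp : p ∈ V)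
    (h : ∀ i ∈ V, A i ∩ A j ⊆ A p) :
    ConsistentOn A R (insert j V) l ↔ ConsistentOn A R V l ∧ Joins A R j p (l j) (l p) := by
  constructor
  · exact fun hl => ⟨fun i hi k hk => hl i (Finset.mem_insert_of_mem hi) k
      (Finset.mem_insert_of_mem hk), hl j (Finset.mem_insert_self _ _) p
      (Finset.mem_insert_of_mem hp)⟩
  · rintro ⟨h1, h2⟩
    have h3 : ∀ i ∈ V, Joins A R i j (l i) (l j) := by
      intro i hi a ha
      have hap := h i hi ha
      rw [Finset.mem_inter] at ha
      rw [h2 a (Finset.mem_inter.2 ⟨ha.2, hap⟩), h1 i hi p hp a (Finset.mem_inter.2 ⟨ha.1, hap⟩)]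
    intro i hi k hk
    rcases Finset.mem_insert.1 hi with hi | hi <;> rcases Finset.mem_insert.1 hk with hk | hk
    · rw [hi, hk]
      exact fun _ _ => rfl
    · rw [hi]
      exact (h3 k hk).symm
    · rw [hk]
      exact h3 i hi
    · exact h1 i hi k hk

/-- Distributivity: once the tuples of `V` are chosen, the tuple of `j` is constrained only by that
of `p`, so the sum over it is a factor that depends on the tuple of `p` alone. This is what makes
counting linear instead of exponential in the number of relations. -/
theorem joinWeight_insert {z : Fin N} {V : Finset (Fin m)} {j p : Fin m} (c : Fin m → ℕ → ℝ)
    (hj : j ∉ V) (hp : p ∈ V) (h : ∀ i ∈ V, A i ∩ A j ⊆ A p) :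
    joinWeight A R z (insert j V) c = joinWeight A R z V (moveWeights A R N c j p) := by
  classical
  have hprod : ∀ l : Fin m → Fin N, ∏ v ∈ V, moveWeights A R N c j p v (l v) =
      ∑ k : Fin N, if Joins A R j p k (l p) then c j k * ∏ v ∈ V, c v (l v) else 0 := by
    intro l
    rw [← Finset.mul_prod_erase V _ hp, ← Finset.mul_prod_erase V (fun v => c v (l v)) hp]
    have : ∏ v ∈ V.erase p, moveWeights A R N c j p v (l v) = ∏ v ∈ V.erase p, c v (l v) :=
      Finset.prod_congr rfl fun v hv => by
        rw [moveWeights, Function.update_of_ne (Finset.ne_of_mem_erase hv)]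
    rw [this, moveWeights, Function.update_self, ← Fin.sum_univ_eq_sum_range
      (fun k => if Joins A R j p k (l p) then c j k else 0) N, Finset.mul_sum, Finset.sum_mul]
    refine Finset.sum_congr rfl fun k _ => ?_
    split_ifs <;> ring
  rw [joinWeight, joinWeight, Finset.sum_congr rfl fun l _ => hprod l]
  simp_rw [← Finset.sum_filter]
  rw [Finset.sum_sigma']
  -- A choice on `insert j V` corresponds to a choice on `V` together with the tuple of `j`; the
  -- entry at `j` is reset to the filler `z`, so that each choice on `V` is represented once.
  refine Finset.sum_bij' (fun l _ => (⟨Function.update l j z, l j⟩ : Σ _ : Fin m → Fin N, Fin N))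
    (fun y _ => Function.update y.1 j y.2) ?_ ?_ ?_ ?_ ?_
  · intro l hl
    simp only [Finset.mem_filter, Finset.mem_univ, true_and, Finset.mem_sigma] at hl ⊢
    have hpj : p ≠ j := by rintro rfl; exact hj hp
    obtain ⟨h1, h2⟩ := (consistentOn_insert hp h).1 hl.2
    refine ⟨⟨fun v hv => ?_, h1.congr fun v hv => ?_⟩, ?_⟩
    · by_cases hvj : v = j
      · simp [hvj]
      · rw [Function.update_of_ne hvj]
        exact hl.1 v (by simp [hvj, hv])
    · exact Function.update_of_ne (by rintro rfl; exact hj hv) _ _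
    · rwa [Function.update_of_ne hpj]
  · rintro ⟨l, k⟩ hl
    simp only [Finset.mem_filter, Finset.mem_univ, true_and, Finset.mem_sigma] at hl ⊢
    have hpj : p ≠ j := by rintro rfl; exact hj hp
    refine ⟨fun v hv => ?_, (consistentOn_insert hp h).2 ⟨hl.1.2.congr fun v hv => ?_, ?_⟩⟩
    · rw [Finset.mem_insert, not_or] at hv
      rw [Function.update_of_ne hv.1, hl.1.1 v hv.2]
    · exact Function.update_of_ne (by rintro rfl; exact hj hv) _ _
    · rw [Function.update_self, Function.update_of_ne hpj]
      exact hl.2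
  · intro l _
    simp
  · rintro ⟨l, k⟩ hl
    simp only [Finset.mem_filter, Finset.mem_univ, true_and, Finset.mem_sigma] at hl
    have : l j = z := hl.1.1 j hj
    simp [← this]
  · intro l _
    rw [Finset.prod_insert hj]
    refine congrArg (c j (l j) * ·) ?_
    exact Finset.prod_congr rfl fun v hv => by
      simp only
      rw [Function.update_of_ne (by rintro rfl; exact hj hv)]

theorem joinWeight_singleton {z : Fin N} {ρ : Fin m} (c : Fin m → ℕ → ℝ) :
    joinWeight A R z {ρ} c = ∑ l ∈ Finset.range N, c ρ l := by
  classical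
  rw [← Fin.sum_univ_eq_sum_range (fun l => c ρ l) N, joinWeight]
  refine Finset.sum_bij' (fun l _ => l ρ) (fun k _ => Function.update (fun _ => z) ρ k)
    (by simp) ?_ ?_ ?_ ?_
  · intro k _
    simp only [Finset.mem_filter, Finset.mem_univ, true_and, Finset.mem_singleton]
    refine ⟨fun v hv => Function.update_of_ne hv _ _, ?_⟩
    intro i hi j hj a _
    rw [Finset.mem_singleton.1 hi, Finset.mem_singleton.1 hj]
  · intro l hl
    simp only [Finset.mem_filter, Finset.mem_univ, true_and, Finset.mem_singleton] at hl
    funext v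
    by_cases hv : v = ρ
    · simp [hv]
    · rw [Function.update_of_ne hv, hl.1 v hv]
  · intro k _
    simp
  · intro l _
    simp

theorem moveWeights_nonneg {c : Fin m → ℕ → ℝ} (hc : ∀ j k, 0 ≤ c j k) (j p v : Fin m) (k : ℕ) :
    0 ≤ moveWeights A R N c j p v k := by
  classical
  rw [moveWeights, Function.update_apply]
  split_ifs
  · exact mul_nonneg (hc _ _) (Finset.sum_nonneg fun k _ => by split_ifs <;> simp [hc])
  · exact hc _ _

end Elimination

/-! ### Passing weights along the elimination order, as a program. -/

namespace Cmd

variable {W : ℕ} {o : Solver} {s : Mem} {d m N : ℕ}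

/-- The position of attribute `a` of tuple `l` of relation `j` in the list of all values. -/
abbrev itemIdx (d : ℕ) (j l a : ℕ) (N : ℕ) : ℕ := (j * N + l) * d + a

/-- The number of values in the database. -/
abbrev itemCount (d m : ℕ) : WExp := .const (m * d) * .get 0 0

/-- The position of attribute `a` of tuple `l` of relation `j`. -/
abbrev itemExp (j : Fin m) (l : WExp) (a : Fin d) : WExp :=
  (.const j * .get 0 0 + l) * .const d + .const a

/-- The ranks of the attributes in a list, as digits of one number. -/
def keyExp (j : Fin m) (l : WExp) : List (Fin d) → WExp
  | [] => 0
  | a :: L => .get 1 (itemExp j l a) + itemCount d m * keyExp j l L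

/-- The value of `keyExp`. -/
def keyVal (M : ℕ) (R : Fin m → ℕ → Fin d → ℕ) (j : Fin m) (l : ℕ) : List (Fin d) → ℕ
  | [] => 0
  | a :: L => R j l a + M * keyVal M R j l L

/-- Uniqueness of digits in base `M`. -/
theorem keyVal_eq_iff {M : ℕ} {R : Fin m → ℕ → Fin d → ℕ} {j p : Fin m} {k l : ℕ}
    {L : List (Fin d)} (hj : ∀ a ∈ L, R j k a < M) (hp : ∀ a ∈ L, R p l a < M) :
    keyVal M R j k L = keyVal M R p l L ↔ ∀ a ∈ L, R j k a = R p l a := by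
  induction L with
  | nil => simp [keyVal]
  | cons a L ih =>
    rw [List.forall_mem_cons] at hj hp ⊢
    rw [← ih hj.2 hp.2, keyVal, keyVal]
    constructor
    · intro h
      have h1 := congrArg (· % M) h
      simp only [Nat.add_mul_mod_self_left, Nat.mod_eq_of_lt hj.1, Nat.mod_eq_of_lt hp.1] at h1
      rw [h1] at h
      exact ⟨h1, Nat.eq_of_mul_eq_mul_left (by omega) (Nat.add_left_cancel h)⟩
    · rintro ⟨h1, h2⟩
      rw [h1, h2]

/-- The ranks of the values of the tuples, as stored. -/
structure HoldsRanks (R : Fin m → ℕ → Fin d → ℕ) (N : ℕ) (s : Mem) : Prop where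
  num : s.word 0 0 = N
  rank : ∀ (j : Fin m) (l : ℕ) (a : Fin d), s.word 1 (itemIdx d j l a N) = R j l a

theorem HoldsRanks.congr {R : Fin m → ℕ → Fin d → ℕ} {t : Mem} (h : HoldsRanks R N s)
    (h0 : t.word 0 = s.word 0) (h1 : t.word 1 = s.word 1) : HoldsRanks R N t :=
  ⟨by rw [h0, h.num], fun j l a => by rw [h1, h.rank]⟩

theorem eval_keyExp {R : Fin m → ℕ → Fin d → ℕ} (h : HoldsRanks R N s) (j : Fin m) (l : WExp)
    (L : List (Fin d)) : (keyExp j l L).eval s = keyVal (m * d * N) R j (l.eval s) L := by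
  induction L with
  | nil => rfl
  | cons a L ih => simp [keyExp, keyVal, ih, h.num, ← h.rank, itemIdx]

/-- The weights of the tuples, as stored. -/
def HoldsWeights (c : Fin m → ℕ → ℝ) (N : ℕ) (f : ℕ → ℝ) : Prop :=
  ∀ (j : Fin m), ∀ l < N, f (j * N + l) = c j l

/-- The weight of tuple number `19` of relation `j`. -/
abbrev weight (j : Fin m) : RExp := .get 5 (.const j * .get 0 0 + .var 19)

variable (A : Fin m → Finset (Fin d))

/-- Move the weights of relation `j` to relation `p`. -/
noncomputable def moveCmd (j p : Fin m) : Cmd :=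
  .seq (forTo 19 (.get 0 0) (.setReal 6 (keyExp p (.var 19) (A j ∩ A p).toList) 0))
    (.seq (forTo 19 (.get 0 0) (.setReal 6 (keyExp j (.var 19) (A j ∩ A p).toList) 0))
      (.seq (forTo 19 (.get 0 0)
          (.seq (.ite (.realLt 0 (weight j))
              (.setWord (24 + j) (keyExp j (.var 19) (A j ∩ A p).toList) (.var 19)) .skip)
            (.setReal 6 (keyExp j (.var 19) (A j ∩ A p).toList)
              (.get 6 (keyExp j (.var 19) (A j ∩ A p).toList) + weight j))))
        (forTo 19 (.get 0 0) (.setReal 5 (.const p * .get 0 0 + .var 19)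
          (weight p * .get 6 (keyExp p (.var 19) (A j ∩ A p).toList))))))

theorem writesWord_moveCmd {j p : Fin m} {a : ℕ} :
    (moveCmd A j p).WritesWord a ↔ a = 19 ∨ a = 24 + j := by
  simp [moveCmd]
  tauto

theorem writesReal_moveCmd {j p : Fin m} {a : ℕ} :
    (moveCmd A j p).WritesReal a ↔ a = 6 ∨ a = 5 := by
  simp [moveCmd]

variable {A}

theorem mul_add_inj {N a b k l : ℕ} (hk : k < N) (hl : l < N) :
    a * N + k = b * N + l ↔ a = b ∧ k = l := by
  constructor
  · intro h
    have h1 := congrArg (· / N) h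
    have h2 := congrArg (· % N) h
    have hN : 0 < N := by omega
    simp only [mul_comm _ N, Nat.mul_add_div hN, Nat.div_eq_of_lt hk, Nat.div_eq_of_lt hl,
      Nat.mul_add_mod, Nat.mod_eq_of_lt hk, Nat.mod_eq_of_lt hl, add_zero] at h1 h2
    exact ⟨h1, h2⟩
  · rintro ⟨rfl, rfl⟩
    rfl

/-- A table addressed by the join key collects the weights of `j`; the tuples of `p` then look up
their factor. Keys are only addresses and are never stored, so words of size `N` suffice. Only
entries that occur as keys of `p` or `j` are cleared, which keeps the time linear. Word array `24 +
j` remembers, for each key, a tuple of `j` with positive weight; this is what later allows one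
result to be traced back. -/
theorem ends_moveCmd {R : Fin m → ℕ → Fin d → ℕ} {c : Fin m → ℕ → ℝ} {j p : Fin m}
    (hR : HoldsRanks R N s) (hRlt : ∀ j, ∀ l < N, ∀ a, R j l a < m * d * N)
    (hc : HoldsWeights c N (s.real 5)) (hc0 : ∀ j k, 0 ≤ c j k) (hW : N ≤ W) :
    (moveCmd A j p).Ends W o s (14 * N + 8) fun t =>
      HoldsWeights (moveWeights A R N c j p) N (t.real 5) ∧
      ∀ l < N, 0 < moveWeights A R N c j p p l →
        ∃ k < N, t.word (24 + j) (keyVal (m * d * N) R p l (A j ∩ A p).toList) = k ∧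
          0 < c j k ∧ Joins A R j p k l := by
  classical
  set K := fun v l => keyVal (m * d * N) R v l (A j ∩ A p).toList with hK
  have hKiff : ∀ k < N, ∀ l < N, K j k = K p l ↔ Joins A R j p k l := fun k hk l hl => by
    simp only [hK]
    rw [keyVal_eq_iff (fun a _ => hRlt j k hk a) fun a _ => hRlt p l hl a]
    simp [Joins]
  have hw : ∀ {C : Cmd} {t u : Mem}, C.Same t u → HoldsRanks R N t → ¬ C.WritesWord 0 →
      ¬ C.WritesWord 1 → HoldsRanks R N u := fun h h' h0 h1 => h'.congr (h.1 0 h0) (h.1 1 h1)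
  -- clear the entries that will be read
  refine ends_seq_le (n := 3 * N + 2) (n' := 11 * N + 6) (R := fun t => HoldsRanks R N t ∧
    HoldsWeights c N (t.real 5) ∧ ∀ l < N, t.real 6 (K p l) = 0) ?_ (by omega) ?_
  · refine (ends_forTo (m := N) (C := 1) (fun i t => ∀ l < i, t.real 6 (K p l) = 0)
      (by simp) (fun t ht => by simpa using (hw ht hR (by simp) (by simp)).num) hW (by simp) ?_).mono le_rfl ?_
    · intro i hi t ht hti hI
      have hR' := hw ht hR (by simp) (by simp)
      refine ends_setReal le_rfl fun l hl => ?_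
      simp only [eval_keyExp hR', Mem.setWord_real, WExp.eval_get, WExp.eval_const, hti,
        Mem.setReal_real_self, Function.update_apply, RExp.eval_ofNat, Nat.cast_zero]
      split_ifs with h
      · rfl
      · refine hI l ?_
        rcases Nat.lt_succ_iff_lt_or_eq.1 hl with h' | rfl
        · exact h'
        · exact absurd rfl h
    · exact fun t ht hI => ⟨hw ht hR (by simp) (by simp), by rwa [ht.2 5 (by simp)], hI⟩
  rintro s₁ hs₁ ⟨hR₁, hc₁, h₁⟩
  refine ends_seq_le (n := 3 * N + 2) (n' := 8 * N + 4) (R := fun t => HoldsRanks R N t ∧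
    HoldsWeights c N (t.real 5) ∧ (∀ l < N, t.real 6 (K p l) = 0) ∧ ∀ l < N, t.real 6 (K j l) = 0)
    ?_ (by omega) ?_
  · refine (ends_forTo (m := N) (C := 1) (fun i t => (∀ l < N, t.real 6 (K p l) = 0) ∧
      ∀ l < i, t.real 6 (K j l) = 0)
      (by simp) (fun t ht => by simpa using (hw ht hR₁ (by simp) (by simp)).num) hW (by simpa using h₁) ?_).mono
      le_rfl ?_
    · rintro i hi t ht hti ⟨hI, hI'⟩
      have hR' := hw ht hR₁ (by simp) (by simp)
      refine ends_setReal le_rfl ⟨fun l hl => ?_, fun l hl => ?_⟩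
      · simp only [eval_keyExp hR', Mem.setWord_real, WExp.eval_get, WExp.eval_const, hti,
          Mem.setReal_real_self, Function.update_apply, RExp.eval_ofNat, Nat.cast_zero]
        split_ifs with h
        · rfl
        · exact hI l hl
      · simp only [eval_keyExp hR', Mem.setWord_real, WExp.eval_get, WExp.eval_const, hti,
          Mem.setReal_real_self, Function.update_apply, RExp.eval_ofNat, Nat.cast_zero]
        split_ifs with h
        · rfl
        · refine hI' l ?_
          rcases Nat.lt_succ_iff_lt_or_eq.1 hl with h' | rfl
          · exact h'
          · exact absurd rfl h
    · exact fun t ht hI => ⟨hw ht hR₁ (by simp) (by simp), by rwa [ht.2 5 (by simp)], hI⟩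
  rintro s₂ hs₂ ⟨hR₂, hc₂, h₂, h₂'⟩
  -- add up the weights of relation `j`
  set S := fun (i x : ℕ) => ∑ k ∈ Finset.range i, if K j k = x then c j k else 0 with hS
  refine ends_seq_le (n := 5 * N + 2) (n' := 3 * N + 2) (R := fun t => HoldsRanks R N t ∧
    HoldsWeights c N (t.real 5) ∧ (∀ l < N, t.real 6 (K p l) = S N (K p l)) ∧
    ∀ k < N, 0 < c j k → ∃ k' < N, t.word (24 + j) (K j k) = k' ∧ 0 < c j k' ∧ K j k' = K j k)
    ?_ (by omega) ?_
  · refine (ends_forTo (m := N) (C := 3) (fun i t => (∀ l < N, t.real 6 (K p l) = S i (K p l)) ∧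
      (∀ l < N, t.real 6 (K j l) = S i (K j l)) ∧
      ∀ k < i, 0 < c j k → ∃ k' < N, t.word (24 + j) (K j k) = k' ∧ 0 < c j k' ∧ K j k' = K j k)
      (by simp; omega) (fun t ht => by simpa using (hw ht hR₂ (by simp; omega) (by simp; omega)).num) hW
      (by simpa [hS] using ⟨h₂, h₂'⟩) ?_).mono le_rfl ?_
    · rintro i hi t ht hti ⟨hI1, hI2, hI3⟩
      have hR' := hw ht hR₂ (by simp; omega) (by simp; omega)
      have hc' : HoldsWeights c N (t.real 5) := by rwa [ht.2 5 (by simp)]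
      have hwt : (weight j).eval t = c j i := by
        simp [hR'.num, hti, hc' j i hi]
      refine ends_seq_le (n := 2) (n' := 1) (R := fun u => u.real = t.real ∧ u.word 19 0 = i ∧
        HoldsRanks R N u ∧ ∀ k < i + 1, 0 < c j k →
        ∃ k' < N, u.word (24 + j) (K j k) = k' ∧ 0 < c j k' ∧ K j k' = K j k) ?_ le_rfl ?_
      · refine ends_ite (fun h => ?_) fun h => ?_
        · simp only [Test.eval_realLt, hwt, RExp.eval_ofNat, Nat.cast_zero] at h
          refine ends_setWord le_rfl (by simp [hti]; omega) ⟨rfl, ?_, ?_, ?_⟩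
          · rw [Mem.setWord_word_of_ne _ _ _ _ _ (by omega), hti]
          · exact hR'.congr (Mem.setWord_word_of_ne _ _ _ _ _ (by omega))
              (Mem.setWord_word_of_ne _ _ _ _ _ (by omega))
          · intro k hk hck
            simp only [eval_keyExp hR', WExp.eval_get, WExp.eval_const, hti, Mem.setWord_word_self,
              Function.update_apply]
            split_ifs with h'
            · exact ⟨i, hi, rfl, h, h'.symm⟩
            · refine hI3 k ?_ hck
              rcases Nat.lt_succ_iff_lt_or_eq.1 hk with h'' | rfl
              · exact h''
              · exact absurd rfl h'
        · simp only [Test.eval_realLt, hwt, RExp.eval_ofNat, Nat.cast_zero] at h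
          refine ends_skip le_rfl ⟨rfl, hti, hR', fun k hk hck => hI3 k ?_ hck⟩
          rcases Nat.lt_succ_iff_lt_or_eq.1 hk with h'' | rfl
          · exact h''
          · exact absurd hck h
      · rintro u - ⟨hu1, hu2, hu3, hu4⟩
        have hwt' : (weight j).eval u = c j i := by
          simp [hu3.num, hu1, hu2, hc' j i hi]
        have hSs : ∀ x, S (i + 1) x = S i x + if K j i = x then c j i else 0 := fun x =>
          Finset.sum_range_succ _ _
        have hval : (keyExp j (.var 19) (A j ∩ A p).toList).eval u = K j i := by
          simp [eval_keyExp hu3, hu2, hK]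
        refine ends_setReal le_rfl ⟨fun l hl => ?_, fun l hl => ?_, ?_⟩
        · rw [Mem.setWord_real, hval, Mem.setReal_real_self, Function.update_apply, RExp.eval_add,
            RExp.eval_get, hval, hwt', hu1, hSs]
          split_ifs with h h' h'
          · rw [hI2 i hi, h]
          · exact absurd h.symm h'
          · exact absurd h'.symm h
          · rw [hI1 l hl, add_zero]
        · rw [Mem.setWord_real, hval, Mem.setReal_real_self, Function.update_apply, RExp.eval_add,
            RExp.eval_get, hval, hwt', hu1, hSs]
          split_ifs with h h' h'
          · rw [hI2 i hi, h]
          · exact absurd h.symm h'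
          · exact absurd h'.symm h
          · rw [hI2 l hl, add_zero]
        · rw [Mem.setWord_word_of_ne _ _ _ _ _ (by omega)]
          exact hu4
    · exact fun t ht hI => ⟨hw ht hR₂ (by simp; omega) (by simp; omega), by rwa [ht.2 5 (by simp)], hI.1, hI.2.2⟩
  rintro s₃ hs₃ ⟨hR₃, hc₃, h₃, h₃'⟩
  have hSN : ∀ l < N, S N (K p l) = ∑ k ∈ Finset.range N, if Joins A R j p k l then c j k else 0 :=
    fun l hl => Finset.sum_congr rfl fun k hk => by
      simp only [← hKiff k (Finset.mem_range.1 hk) l hl]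
  refine (ends_forTo (m := N) (C := 1) (fun i t => ∀ v : Fin m, ∀ l < N, t.real 5 (v * N + l) =
      if v = p ∧ l < i then c p l * S N (K p l) else c v l)
      (by simp) (fun t ht => by simpa using (hw ht hR₃ (by simp) (by simp)).num) hW ?_ ?_).mono le_rfl ?_
  · intro v l hl
    simpa using hc₃ v l hl
  · rintro i hi t ht hti hI
    have hR' := hw ht hR₃ (by simp) (by simp)
    refine ends_setReal le_rfl fun v l hl => ?_
    have h6 : t.real 6 = s₃.real 6 := ht.2 6 (by simp)
    have hi5 := hI p i hi
    simp only [lt_irrefl, and_false, if_false] at hi5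
    simp only [WExp.eval_add, WExp.eval_mul, WExp.eval_const, WExp.eval_get, WExp.eval_ofNat,
      hR'.num, hti,
      RExp.eval_mul, RExp.eval_get, Mem.setWord_real, Mem.setReal_real_self, Function.update_apply,
      mul_add_inj hl hi, Fin.val_inj, eval_keyExp hR', h6, hi5]
    rw [h₃ i hi]
    by_cases hv : v = p
    · by_cases hl' : l = i
      · simp [hv, hl']
      · simp only [hv, hl', and_false, if_false, true_and]
        rw [hI p l hl]
        simp only [true_and]
        congr 1
        exact propext (by omega)
    · simp only [hv, false_and, if_false]
      rw [hI v l hl]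
      simp [hv]
  · intro t ht hI
    refine ⟨fun v l hl => ?_, fun l hl hpos => ?_⟩
    · rw [hI v l hl, moveWeights, Function.update_apply]
      by_cases hv : v = p
      · simp [hv, hl, hSN l hl]
      · simp [hv]
    · rw [moveWeights, Function.update_self] at hpos
      -- A positive new weight needs a positive summand, that is, a joining tuple of `j` with
      -- positive weight, and for its key a witness was stored.
      obtain ⟨k, hk, hk'⟩ : ∃ k ∈ Finset.range N, 0 < if Joins A R j p k l then c j k else 0 := by
        by_contra! hno
        have := mul_nonpos_of_nonneg_of_nonpos (hc0 p l) (Finset.sum_nonpos hno)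
        linarith
      rw [Finset.mem_range] at hk
      split_ifs at hk' with hjoin
      · obtain ⟨k', h1, h2, h3, h4⟩ := h₃' k hk hk'
        have h5 := (hKiff k hk l hl).2 hjoin
        refine ⟨k', h1, ?_, h3, (hKiff k' h1 l hl).1 (h4.trans h5)⟩
        rw [ht.1 (24 + j) (by simp; omega), ← h2]
        exact congrArg _ h5.symm
      · exact absurd hk' (lt_irrefl _)

/-- Add up the weights of relation `ρ`. -/
def rootCmd (ρ : Fin m) : Cmd :=
  .seq (.setReal 13 0 0) (forTo 19 (.get 0 0)
    (.seq (.setReal 13 0 (.var 13 + weight ρ))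
      (.ite (.realLt 0 (weight ρ)) (.setWord 20 (.const ρ) (.var 19)) .skip)))

theorem ends_rootCmd {c : Fin m → ℕ → ℝ} {ρ : Fin m} (hN : s.word 0 0 = N)
    (hc : HoldsWeights c N (s.real 5)) (hc0 : ∀ j k, 0 ≤ c j k) (hW : N ≤ W) :
    (rootCmd ρ).Ends W o s (5 * N + 3) fun t =>
      t.real 13 0 = ∑ l ∈ Finset.range N, c ρ l ∧
      (0 < t.real 13 0 → ∃ k < N, t.word 20 ρ = k ∧ 0 < c ρ k) := by
  refine ends_seq_setReal (n := 5 * N + 2) ?_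
  refine (ends_forTo (m := N) (C := 3) (fun i t => t.real 13 0 = ∑ l ∈ Finset.range i, c ρ l ∧
      (0 < t.real 13 0 → ∃ k < N, t.word 20 ρ = k ∧ 0 < c ρ k)) (by simp)
      (fun t ht => by simp [ht.1 0 (by simp), hN]) hW (by simp) ?_)
  rintro i hi t ht hti ⟨hI1, hI2⟩
  have h0 : t.word 0 0 = N := by simp [ht.1 0 (by simp), hN]
  have hc' : HoldsWeights c N (t.real 5) := by
    rw [ht.2 5 (by simp)]
    simpa using hc
  have hwt : (weight ρ).eval t = c ρ i := by simp [h0, hti, hc' ρ i hi]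
  refine ends_seq_setReal (n := 2) ?_
  refine ends_ite (fun h => ends_setWord le_rfl (by simp [hti]; omega) ?_) fun h => ends_skip le_rfl ?_
  · simp only [Test.eval_realLt, RExp.eval_ofNat, Nat.cast_zero, RExp.eval_get, WExp.eval_add,
      WExp.eval_mul, WExp.eval_const, WExp.eval_get, WExp.eval_ofNat, Mem.setReal_word, h0, hti, ne_eq,
      Nat.reduceEqDiff, not_false_eq_true, Mem.setReal_real_of_ne, hc' ρ i hi] at h
    rw [RExp.eval_add, hwt]
    simp only [WExp.eval_const, RExp.eval_get, hI1, WExp.eval_get, Mem.setReal_word, hti,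
      Mem.setWord_real, Mem.setReal_real_self, Function.update_self, ne_eq, Nat.reduceEqDiff,
      not_false_eq_true, Mem.setWord_word_of_ne, Mem.setWord_word_self, Finset.sum_range_succ,
      true_and, WExp.eval_ofNat]
    exact fun _ => ⟨i, hi, rfl, h⟩
  · simp only [Test.eval_realLt, RExp.eval_ofNat, Nat.cast_zero, RExp.eval_get, WExp.eval_add,
      WExp.eval_mul, WExp.eval_const, WExp.eval_get, WExp.eval_ofNat, Mem.setReal_word, h0, hti, ne_eq,
      Nat.reduceEqDiff, not_false_eq_true, Mem.setReal_real_of_ne, hc' ρ i hi, not_lt] at h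
    have h' : c ρ i = 0 := le_antisymm h (hc0 _ _)
    rw [RExp.eval_add, hwt, h', add_zero]
    simp only [WExp.eval_const, RExp.eval_get, hI1, Mem.setReal_word,
      Mem.setWord_real, Mem.setReal_real_self, Function.update_self, ne_eq, Nat.reduceEqDiff,
      not_false_eq_true, Mem.setWord_word_of_ne, Finset.sum_range_succ, h', add_zero,
      true_and, WExp.eval_ofNat]
    rwa [hI1] at hI2

variable (A)

/-- Compute the total weight of the consistent choices, and one such choice. -/
noncomputable def joinCmd (ρ : Fin m) : List (Fin m × Fin m) → Cmd
  | [] => rootCmd ρ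
  | (j, p) :: es => .seq (moveCmd A j p) (.seq (joinCmd ρ es)
      (.ite (.realLt 0 (.var 13)) (.setWord 20 (.const j)
        (.get (24 + j) (keyExp p (.get 20 (.const p)) (A j ∩ A p).toList))) .skip))

variable {A}

theorem writesWord_joinCmd {ρ : Fin m} {V : Finset (Fin m)} {es : List (Fin m × Fin m)}
    (h : EliminationOrder A V es ρ) {a : ℕ} (ha : (joinCmd A ρ es).WritesWord a) :
    a = 19 ∨ a = 20 ∨ ∃ v ∈ V, a = 24 + v := by
  induction h with
  | root ρ => simp [joinCmd, rootCmd] at ha; tauto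
  | step hj hp h hV ih =>
    simp only [joinCmd, writesWord_seq, writesWord_moveCmd, writesWord_setWord, writesWord_ite, writesWord_skip, or_false] at ha
    rcases ha with (ha | ha) | ha | ha
    · exact Or.inl ha
    · exact Or.inr (Or.inr ⟨_, Finset.mem_insert_self _ _, ha⟩)
    · rcases ih ha with h | h | ⟨v, hv, h⟩
      · exact Or.inl h
      · exact Or.inr (Or.inl h)
      · exact Or.inr (Or.inr ⟨v, Finset.mem_insert_of_mem hv, h⟩)
    · exact Or.inr (Or.inl ha)

theorem writesReal_joinCmd {ρ : Fin m} {es : List (Fin m × Fin m)} {a : ℕ}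
    (ha : (joinCmd A ρ es).WritesReal a) : a = 5 ∨ a = 6 ∨ a = 13 := by
  induction es with
  | nil => simp [joinCmd, rootCmd] at ha; tauto
  | cons e es ih =>
    simp only [joinCmd, writesReal_seq, writesReal_moveCmd, writesReal_setWord, writesReal_ite, writesReal_skip, or_false] at ha
    rcases ha with ha | ha
    · omega
    · exact ih ha

/-- Weights flow to the root on the way down the recursion; on the way back each removed relation
picks the stored witness for the tuple chosen in its neighbour. Positivity of the moved weight
guarantees that the witness exists, and it forces the original weights of the chosen tuples to be
positive. -/
theorem ends_joinCmd {R : Fin m → ℕ → Fin d → ℕ} {c : Fin m → ℕ → ℝ} {z : Fin N} {ρ : Fin m}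
    {V : Finset (Fin m)} {es : List (Fin m × Fin m)} (h : EliminationOrder A V es ρ)
    (hR : HoldsRanks R N s) (hRlt : ∀ j, ∀ l < N, ∀ a, R j l a < m * d * N)
    (hc : HoldsWeights c N (s.real 5)) (hc0 : ∀ j k, 0 ≤ c j k) (hW : N ≤ W) :
    (joinCmd A ρ es).Ends W o s ((14 * N + 10) * es.length + 5 * N + 3) fun t =>
      t.real 13 0 = joinWeight A R z V c ∧
      (0 < t.real 13 0 → ∃ l : Fin m → Fin N, (∀ v ∈ V, t.word 20 v = l v) ∧
        ConsistentOn A R V l ∧ ∀ v ∈ V, 0 < c v (l v)) := by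
  classical
  induction h generalizing s c with
  | root ρ =>
    refine (ends_rootCmd hR.num hc hc0 hW).mono (by simp) ?_
    rintro t - ⟨h1, h2⟩
    refine ⟨by rw [h1, joinWeight_singleton], fun hpos => ?_⟩
    obtain ⟨k, hk, h3, h4⟩ := h2 hpos
    refine ⟨fun _ => ⟨k, hk⟩, by simpa using h3, ?_, by simpa using h4⟩
    intro i hi j hj a _
    rw [Finset.mem_singleton.1 hi, Finset.mem_singleton.1 hj]
  | @step V es ρ j p hj hp h hV ih =>
    have hjp : j ≠ p := by rintro rfl; exact hj hp
    refine ends_seq_le (ends_moveCmd hR hRlt hc hc0 hW)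
      (n' := (14 * N + 10) * es.length + 5 * N + 3 + 2)
      (by rw [List.length_cons, Nat.mul_succ]; omega) ?_
    rintro t ht ⟨h1, h2⟩
    have hR' : HoldsRanks R N t := hR.congr (ht.1 0 (by simp [writesWord_moveCmd]; omega))
      (ht.1 1 (by simp [writesWord_moveCmd]; omega))
    refine ends_seq_le (ih hR' h1 (moveWeights_nonneg hc0 j p)) le_rfl ?_
    rintro u hu ⟨h3, h4⟩
    have hww : ∀ a : ℕ, a ≠ 19 → a ≠ 20 → (∀ v ∈ V, a ≠ 24 + v) → u.word a = t.word a :=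
      fun a ha hb hc => hu.1 a fun hw => by
        rcases writesWord_joinCmd hV hw with h | h | ⟨v, hv, h⟩
        · exact ha h
        · exact hb h
        · exact hc v hv h
    have hR'' : HoldsRanks R N u := hR'.congr
      (hww 0 (by simp) (by simp) fun v _ => by omega)
      (hww 1 (by simp) (by simp) fun v _ => by omega)
    have hwit : u.word (24 + j) = t.word (24 + j) :=
      hww _ (by omega) (by omega) fun v hv hv' => hj (by
        rwa [show j = v from Fin.ext (by omega)])
    by_cases hpos : 0 < u.real 13 0
    · obtain ⟨l, hl, hl', hl''⟩ := h4 hpos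
      have hp2 := hl'' p hp
      obtain ⟨k, hk, h5, h6, h7⟩ := h2 (l p) (l p).2 hp2
      have hev : WExp.eval u (.get (24 + j) (keyExp p (.get 20 (.const p)) (A j ∩ A p).toList))
          = k := by
        simp only [WExp.eval_get, eval_keyExp hR'', WExp.eval_const, hl p hp, hwit, h5]
      refine ends_ite (n := 1) (fun _ => ends_setWord le_rfl (by rw [hev]; omega) ⟨?_, fun _ =>
        ⟨Function.update l j ⟨k, hk⟩, ?_, ?_, ?_⟩⟩) fun h' => absurd (by simpa using hpos) h'
      · rw [Mem.setWord_real, h3, joinWeight_insert c hj hp h]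
      · intro v hv
        rw [hev, Mem.setWord_word_self]
        by_cases hvj : v = j
        · simp [hvj]
        · rw [Function.update_of_ne hvj, ← hl v ((Finset.mem_insert.1 hv).resolve_left hvj),
            Function.update_of_ne (by simpa [Fin.val_inj] using hvj)]
      · rw [consistentOn_insert hp h]
        refine ⟨hl'.congr fun v hv => Function.update_of_ne (by rintro rfl; exact hj hv) _ _, ?_⟩
        rw [Function.update_self, Function.update_of_ne hjp.symm]
        exact h7
      · intro v hv
        by_cases hvj : v = j
        · subst hvj
          simpa using h6
        · have hvV := (Finset.mem_insert.1 hv).resolve_left hvj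
          rw [Function.update_of_ne hvj]
          have := hl'' v hvV
          rw [moveWeights, Function.update_apply] at this
          split_ifs at this with hvp
          · rw [hvp] at this ⊢
            refine pos_of_mul_pos_left this (Finset.sum_nonneg fun k _ => ?_)
            split_ifs <;> simp [hc0]
          · exact this
    · refine ends_ite (n := 1) (fun h' => absurd (by simpa using h') hpos) fun _ =>
        ends_skip le_rfl ⟨by rw [h3, joinWeight_insert c hj hp h], fun h' => absurd h' hpos⟩

end Cmd

/-! ### Results of the join in a box -/

section Results

variable {d m N : ℕ} {q : JoinQuery d m}

/-- The value of attribute `a` of tuple `l` of relation `j`, or `0` if there is none. -/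
noncomputable def tupleValue (D : q.Instance N) (j : Fin m) (l : ℕ) (a : Fin d) : ℝ :=
  encode (D j) (l * d + a)

theorem encode_mul_add {B : Finset (Fin d)} {n : ℕ} (x : Fin n → Pt B) (i : Fin n) (a : Fin d) :
    encode x (i * d + a) = if h : a ∈ B then x i ⟨a, h⟩ else 0 := by
  have hd : 0 < d := a.pos
  have h1 : ((i : ℕ) * d + a) / d = i := by
    rw [mul_comm, Nat.mul_add_div hd, Nat.div_eq_of_lt a.2, add_zero]
  have h2 : ((i : ℕ) * d + a) % d = a := by
    rw [mul_comm, Nat.mul_add_mod, Nat.mod_eq_of_lt a.2]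
  simp only [encode, h1, h2, i.2, a.2, exists_true_left]

theorem tupleValue_of_mem (D : q.Instance N) {j : Fin m} (l : Fin N) {a : Fin d}
    (h : a ∈ q.attrs j) : tupleValue D j l a = D j l ⟨a, h⟩ := by
  rw [tupleValue, encode_mul_add, dif_pos h]

/-- A relation that contains the attribute. -/
noncomputable def JoinQuery.relOf (q : JoinQuery d m) (a : Fin d) : Fin m := (q.covers a).choose

theorem JoinQuery.mem_relOf (q : JoinQuery d m) (a : Fin d) : a ∈ q.attrs (q.relOf a) :=
  (q.covers a).choose_spec

/-- The tuple given by a choice of tuples of the relations. -/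
noncomputable def chosenTuple (D : q.Instance N) (l : Fin m → Fin N) : Fin d → ℝ :=
  fun a => tupleValue D (q.relOf a) (l (q.relOf a)) a

/-- The ranks identify equal values. -/
def IsRanking (D : q.Instance N) (R : Fin m → ℕ → Fin d → ℕ) : Prop :=
  ∀ (j p : Fin m) (k l : Fin N) (a : Fin d),
    R j k a = R p l a ↔ tupleValue D j k a = tupleValue D p l a

variable {D : q.Instance N} {R : Fin m → ℕ → Fin d → ℕ}

theorem tupleValue_eq_of_consistent (hR : IsRanking D R) {l : Fin m → Fin N}
    (hl : ConsistentOn q.attrs R Finset.univ l) {j : Fin m} {a : Fin d} (ha : a ∈ q.attrs j) :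
    tupleValue D j (l j) a = chosenTuple D l a :=
  (hR _ _ _ _ _).1 (hl j (Finset.mem_univ _) _ (Finset.mem_univ _) a
    (Finset.mem_inter.2 ⟨ha, q.mem_relOf a⟩))

theorem proj_chosenTuple (hR : IsRanking D R) {l : Fin m → Fin N}
    (hl : ConsistentOn q.attrs R Finset.univ l) (j : Fin m) :
    proj (q.attrs j) (chosenTuple D l) = D j (l j) := by
  ext a
  rw [← tupleValue_of_mem D (l j) a.2, tupleValue_eq_of_consistent hR hl a.2]
  rfl

theorem chosenTuple_mem_results (hR : IsRanking D R) {l : Fin m → Fin N}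
    (hl : ConsistentOn q.attrs R Finset.univ l) : chosenTuple D l ∈ JoinQuery.results D :=
  fun j => ⟨l j, (proj_chosenTuple hR hl j).symm⟩

theorem exists_chosenTuple_eq (hR : IsRanking D R) {t : Fin d → ℝ} (ht : t ∈ JoinQuery.results D) :
    ∃ l : Fin m → Fin N, ConsistentOn q.attrs R Finset.univ l ∧ chosenTuple D l = t := by
  choose l hl using ht
  have hv : ∀ j, ∀ a ∈ q.attrs j, tupleValue D j (l j) a = t a := fun j a ha => by
    rw [tupleValue_of_mem D _ ha, hl j]
    rfl
  refine ⟨l, fun i _ j _ a ha => ?_, funext fun a => hv _ a (q.mem_relOf a)⟩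
  rw [Finset.mem_inter] at ha
  rw [hR, hv i a ha.1, hv j a ha.2]

/-- Tuple `l` of relation `j` is not excluded by the box. -/
def InBox (D : q.Instance N) (B : Finset (Fin d)) (ℓ : ℝ) (u : Fin d → ℝ) (j : Fin m) (l : ℕ) :
    Prop := ∀ a ∈ B ∩ q.attrs j, u a ≤ tupleValue D j l a ∧
      (tupleValue D j l a < u a + ℓ ∨ tupleValue D j l a = u a)

/-- Consistent tuples give an attribute the same value in every relation that contains it, so
testing relations separately is the same as testing the joined tuple. -/
theorem forall_inBox_iff (hR : IsRanking D R) {l : Fin m → Fin N}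
    (hl : ConsistentOn q.attrs R Finset.univ l) {B : Finset (Fin d)} {ℓ : ℝ} {u : Fin d → ℝ} :
    (∀ j, InBox D B ℓ u j (l j)) ↔ chosenTuple D l ∈ box B ℓ u := by
  constructor
  · exact fun h a ha => h (q.relOf a) a (Finset.mem_inter.2 ⟨ha, q.mem_relOf a⟩)
  · intro h j a ha
    rw [Finset.mem_inter] at ha
    rw [tupleValue_eq_of_consistent hR hl ha.2]
    exact h a ha.1

open Classical in
/-- The results of the join in a box. -/
noncomputable def resultsIn (D : q.Instance N) (B : Finset (Fin d)) (ℓ : ℝ) (u : Fin d → ℝ) :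
    Finset (Fin d → ℝ) := (JoinQuery.results_finite D).toFinset.filter (· ∈ box B ℓ u)

theorem mem_resultsIn {B : Finset (Fin d)} {ℓ : ℝ} {u t : Fin d → ℝ} :
    t ∈ resultsIn D B ℓ u ↔ t ∈ JoinQuery.results D ∧ t ∈ box B ℓ u := by
  simp [resultsIn]

-- With weights `0` and `1` a product is the indicator of the box. Consistent choices correspond to
-- results one to one, because the enumerations of the relations are injective.
open Classical in
theorem joinWeight_inBox (hR : IsRanking D R) (z : Fin N) (B : Finset (Fin d)) (ℓ : ℝ)
    (u : Fin d → ℝ) :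
    joinWeight q.attrs R z Finset.univ (fun j l => if InBox D B ℓ u j l then 1 else 0) =
      (resultsIn D B ℓ u).card := by
  rw [joinWeight]
  simp only [Finset.mem_univ, not_true, false_imp_iff, implies_true, true_and,
    Finset.prod_boole, forall_true_left]
  rw [Finset.sum_boole, Finset.filter_filter, Nat.cast_inj]
  refine Finset.card_bij (fun l _ => chosenTuple D l) ?_ ?_ ?_
  · intro l hl
    simp only [Finset.mem_filter, Finset.mem_univ, true_and] at hl
    exact mem_resultsIn.2 ⟨chosenTuple_mem_results hR hl.1, (forall_inBox_iff hR hl.1).1 hl.2⟩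
  · intro l hl l' hl' h
    simp only [Finset.mem_filter, Finset.mem_univ, true_and] at hl hl'
    funext j
    apply (D j).injective
    rw [← proj_chosenTuple hR hl.1, ← proj_chosenTuple hR hl'.1, h]
  · intro t ht
    rw [mem_resultsIn] at ht
    obtain ⟨l, hl, rfl⟩ := exists_chosenTuple_eq hR ht.1
    refine ⟨l, ?_, rfl⟩
    simp only [Finset.mem_filter, Finset.mem_univ, true_and]
    exact ⟨hl, (forall_inBox_iff hR hl).2 ht.2⟩

/-- Set the coordinates outside `B` to `0`. -/
def restrictTo (B : Finset (Fin d)) (t : Fin d → ℝ) : Fin d → ℝ := fun a => if a ∈ B then t a else 0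

/-- The second list holds, for every box of the first list that contains results of the join, one of
them and their number. -/
inductive IsSummary (D : q.Instance N) (B : Finset (Fin d)) :
    List ((Fin d → ℝ) × ℝ) → List ((Fin d → ℝ) × ℝ) → Prop
  | nil : IsSummary D B [] []
  | skip {E C : List ((Fin d → ℝ) × ℝ)} {e : (Fin d → ℝ) × ℝ} (h : IsSummary D B E C)
      (he : resultsIn D B e.2 e.1 = ∅) : IsSummary D B (E ++ [e]) C
  | push {E C : List ((Fin d → ℝ) × ℝ)} {e : (Fin d → ℝ) × ℝ} {t : Fin d → ℝ} (h : IsSummary D B E C)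
      (ht : t ∈ resultsIn D B e.2 e.1) :
      IsSummary D B (E ++ [e]) (C ++ [(restrictTo B t, ((resultsIn D B e.2 e.1).card : ℝ))])

theorem IsSummary.length_le {B : Finset (Fin d)} {E C : List ((Fin d → ℝ) × ℝ)}
    (h : IsSummary D B E C) : C.length ≤ E.length := by
  induction h with
  | nil => simp
  | skip h he ih => simp; omega
  | push h ht ih => simpa using ih

/-- The memory holds the tuples of the database and the ranks of their values. -/
structure HoldsDatabase (D : q.Instance N) (R : Fin m → ℕ → Fin d → ℕ) (s : Mem) : Prop where
  ranks : Cmd.HoldsRanks R N s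
  lt : ∀ j, ∀ l < N, ∀ a, R j l a < m * d * N
  ranking : IsRanking D R
  value : ∀ (j : Fin m), ∀ l < N, ∀ a : Fin d,
    s.real 0 (3 + Cmd.itemIdx d j l a N) = tupleValue D j l a

theorem HoldsDatabase.congr {s t : Mem} (h : HoldsDatabase D R s) (h0 : t.word 0 = s.word 0)
    (h1 : t.word 1 = s.word 1) (hr : t.real 0 = s.real 0) : HoldsDatabase D R t :=
  ⟨h.ranks.congr h0 h1, h.lt, h.ranking, by rw [hr]; exact h.value⟩

/-- The memory holds the list of weighted points. -/
structure HoldsWeighted (s : Mem) (C : List ((Fin d → ℝ) × ℝ)) : Prop where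
  num : s.word 21 0 = C.length
  point : HoldsVecs (s.real 7) (C.map Prod.fst)
  wt : ∀ (i : ℕ) (h : i < C.length), s.real 8 i = C[i].2

theorem HoldsWeighted.congr {s t : Mem} {C : List ((Fin d → ℝ) × ℝ)} (h : HoldsWeighted s C)
    (hw : t.word 21 = s.word 21) (h7 : t.real 7 = s.real 7) (h8 : t.real 8 = s.real 8) :
    HoldsWeighted t C :=
  ⟨by rw [hw, h.num], by rw [h7]; exact h.point, by rw [h8]; exact h.wt⟩

end Results

/-! ### Counting the results in the leaves. -/

namespace Cmd

variable {W : ℕ} {o : Solver} {s : Mem} {d m N : ℕ} {q : JoinQuery d m}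

/-- The corner of leaf number `18`. -/
abbrev leafCoord (a : Fin d) : RExp := .get 3 (.var 18 * .const d + .const a)

/-- The side of leaf number `18`. -/
abbrev leafSide : RExp := .get 4 (.var 18)

/-- Tuple number `19` of relation `j` is not excluded by the leaf. -/
noncomputable def inBoxTest (q : JoinQuery d m) (B : Finset (Fin d)) (j : Fin m) : Test :=
  .all (fun a => .conj (.realLe (leafCoord a) (itemVal (itemExp j (.var 19) a)))
    (.neg (.conj (.realLe (leafCoord a + leafSide) (itemVal (itemExp j (.var 19) a)))
      (.realLt (leafCoord a) (itemVal (itemExp j (.var 19) a)))))) (B ∩ q.attrs j).toList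

/-- Give weight `1` to the tuples that are not excluded by the leaf. -/
noncomputable def initWeights (q : JoinQuery d m) (B : Finset (Fin d)) (j : Fin m) : Cmd :=
  forTo 19 (.get 0 0) (.ite (inBoxTest q B j)
    (.setReal 5 (.const j * .get 0 0 + .var 19) 1) (.setReal 5 (.const j * .get 0 0 + .var 19) 0))

/-- The coordinates in `B` of the chosen result. -/
noncomputable def chosenCoord (q : JoinQuery d m) (B : Finset (Fin d)) (b : Fin d) : RExp :=
  if b ∈ B then itemVal (itemExp (q.relOf b) (.get 20 (.const (q.relOf b))) b) else 0

/-- Count the results in leaf number `18`; if there are any, append one to the weighted points. -/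
noncomputable def countLeaf (q : JoinQuery d m) (B : Finset (Fin d)) (ρ : Fin m)
    (es : List (Fin m × Fin m)) : Cmd :=
  .seq (forEach (initWeights q B) (List.finRange m)) (.seq (joinCmd q.attrs ρ es)
    (.ite (.realLt 0 (.var 13))
      (.seq (.setReal 8 (.var 21) (.var 13)) (pushVec 7 21 (chosenCoord q B))) .skip))

/-- The program tests that `corner + side ≤ value` and `corner < value` do not both hold; given
`corner ≤ value`, this is the disjunction in the definition of `InBox`, including the degenerate
case of side `0`. -/
theorem eval_inBoxTest {D : q.Instance N} {R : Fin m → ℕ → Fin d → ℕ} {B : Finset (Fin d)}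
    {E : List ((Fin d → ℝ) × ℝ)} {i l : ℕ} (hD : HoldsDatabase D R s) (hE : HoldsLeaves s E)
    (hi : i < E.length) (his : s.word 18 0 = i) (hl : l < N) (hls : s.word 19 0 = l) (j : Fin m) :
    (inBoxTest q B j).eval s ↔ InBox D B E[i].2 E[i].1 j l := by
  have hcor := hE.corner i (by simpa using hi)
  simp only [List.getElem_map] at hcor
  have hv := hD.value j l hl
  simp only [itemIdx] at hv
  simp only [inBoxTest, Test.eval_all, Finset.mem_toList, InBox]
  refine forall₂_congr fun a _ => ?_
  simp only [Test.eval_conj, Test.eval_neg, Test.eval_realLt, RExp.eval_get, WExp.eval_add,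
    WExp.eval_mul, WExp.eval_get, WExp.eval_const, WExp.eval_ofNat, his, hls, hcor, RExp.eval_add,
    hE.side i hi, hD.ranks.num, hv, not_lt, itemVal]
  constructor
  · rintro ⟨h1, h2⟩
    refine ⟨h1, ?_⟩
    by_contra! h
    exact h2 ⟨h.1, lt_of_le_of_ne h1 h.2.symm⟩
  · rintro ⟨h1, h2⟩
    refine ⟨h1, fun h => ?_⟩
    rcases h2 with h2 | h2
    · exact absurd h.1 (not_le.2 h2)
    · exact absurd h2 h.2.ne'

@[simp] theorem writesWord_initWeights {B : Finset (Fin d)} {j : Fin m} {a : ℕ} :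
    (initWeights q B j).WritesWord a ↔ a = 19 := by
  simp [initWeights]

@[simp] theorem writesReal_initWeights {B : Finset (Fin d)} {j : Fin m} {a : ℕ} :
    (initWeights q B j).WritesReal a ↔ a = 5 := by
  simp [initWeights]

open Classical in
theorem ends_initWeights {D : q.Instance N} {R : Fin m → ℕ → Fin d → ℕ} {B : Finset (Fin d)}
    {E : List ((Fin d → ℝ) × ℝ)} {i : ℕ} (hD : HoldsDatabase D R s) (hE : HoldsLeaves s E)
    (hi : i < E.length) (his : s.word 18 0 = i) (hW : N ≤ W) :
    (forEach (initWeights q B) (List.finRange m)).Ends W o s ((4 * N + 2) * m + 1) fun t =>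
      HoldsWeights (fun j l => if InBox D B E[i].2 E[i].1 j l then 1 else 0) N (t.real 5) := by
  have hw : ∀ (L : List (Fin m)) (t : Mem), (forEach (initWeights q B) L).Same s t →
      HoldsDatabase D R t ∧ HoldsLeaves t E ∧ t.word 18 0 = i := fun L t ht =>
    ⟨hD.congr (ht.1 0 (by simp [writesWord_forEach])) (ht.1 1 (by simp [writesWord_forEach]))
      (ht.2 0 (by simp [writesReal_forEach])),
    hE.congr (ht.1 17 (by simp [writesWord_forEach])) (ht.2 3 (by simp [writesReal_forEach]))
      (ht.2 4 (by simp [writesReal_forEach])), by rw [ht.1 18 (by simp [writesWord_forEach]), his]⟩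
  refine (ends_forEach (C := 4 * N + 2) (fun (L : List (Fin m)) t => ∀ j ∈ L, ∀ l < N, t.real 5 (j * N + l) =
    if InBox D B E[i].2 E[i].1 j l then 1 else 0) _ (by simp) ?_).mono (by simp) ?_
  · rintro L₁ j L₂ - t ht hI
    obtain ⟨hD', hE', hi'⟩ := hw _ t ht
    refine (ends_forTo (m := N) (C := 2) (fun n t => ∀ v ∈ L₁ ++ [j], ∀ l < N, v ≠ j ∨ l < n →
      t.real 5 (v * N + l) = if InBox D B E[i].2 E[i].1 v l then 1 else 0) (by simp)
      (fun u hu => ?_) hW ?_ ?_).mono le_rfl fun u _ h v hv l hl => h v hv l hl (Or.inr hl)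
    · simpa using (hD'.congr (hu.1 0 (by simp)) (hu.1 1 (by simp)) (hu.2 0 (by simp))).ranks.num
    · intro v hv l hl h
      simp only [not_lt_zero, or_false] at h
      simp only [List.mem_append, List.mem_singleton, h] at hv
      simpa using hI v (hv.resolve_right id) l hl
    · intro n hn u hu hun hI'
      have hDu := hD'.congr (hu.1 0 (by simp)) (hu.1 1 (by simp)) (hu.2 0 (by simp))
      have hEu := hE'.congr (hu.1 17 (by simp)) (hu.2 3 (by simp)) (hu.2 4 (by simp))
      have hiu : u.word 18 0 = i := by rw [hu.1 18 (by simp), hi']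
      have hev := eval_inBoxTest (B := B) hDu hEu hi hiu hn hun j
      have hind : ∀ x : ℝ, x = (if InBox D B E[i].2 E[i].1 j n then 1 else 0) →
          ∀ v ∈ L₁ ++ [j], ∀ l < N, v ≠ j ∨ l < n + 1 →
          Function.update (u.real 5) (j * N + n) x (v * N + l) =
            if InBox D B E[i].2 E[i].1 v l then 1 else 0 := by
        intro x hx v hv l hl h
        by_cases h1 : v = j ∧ l = n
        · rw [h1.1, h1.2, Function.update_self, hx]
        · have h2 : (v : ℕ) * N + l ≠ j * N + n := fun h' => h1 (by
            simpa [Fin.val_inj] using (mul_add_inj hl hn).1 h')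
          rw [Function.update_of_ne h2]
          refine hI' v hv l hl ?_
          by_cases hvj : v = j
          · have : l ≠ n := fun h' => h1 ⟨hvj, h'⟩
            have := h.resolve_left (not_not.2 hvj)
            exact Or.inr (by omega)
          · exact Or.inl hvj
      refine ends_ite (fun h => ends_setReal le_rfl ?_) fun h => ends_setReal le_rfl ?_
      · simpa [hDu.ranks.num, hun] using hind 1 (by rw [if_pos (hev.1 h)])
      · simpa [hDu.ranks.num, hun] using hind 0 (by rw [if_neg fun h' => h (hev.2 h')])
  · exact fun t _ h j l hl => h j (by simp) l hl

theorem writesWord_countLeaf {B : Finset (Fin d)} {ρ : Fin m} {es : List (Fin m × Fin m)}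
    (hes : EliminationOrder q.attrs Finset.univ es ρ) {a : ℕ} (h : (countLeaf q B ρ es).WritesWord a) :
    19 ≤ a := by
  simp only [countLeaf, writesWord_seq, writesWord_forEach, writesWord_initWeights, writesWord_ite,
    writesWord_setReal, writesWord_pushVec, writesWord_skip, false_or, or_false] at h
  rcases h with ⟨_, _, h⟩ | h | h
  · omega
  · rcases writesWord_joinCmd hes h with h | h | ⟨v, -, h⟩ <;> omega
  · omega

theorem writesReal_countLeaf {B : Finset (Fin d)} {ρ : Fin m} {es : List (Fin m × Fin m)} {a : ℕ}
    (h : (countLeaf q B ρ es).WritesReal a) : a = 5 ∨ a = 6 ∨ a = 7 ∨ a = 8 ∨ a = 13 := by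
  simp only [countLeaf, writesReal_seq, writesReal_forEach, writesReal_initWeights, writesReal_ite,
    writesReal_setReal, writesReal_skip, or_false] at h
  rcases h with ⟨_, _, h⟩ | h | h | h
  · omega
  · have := writesReal_joinCmd h; omega
  · omega
  · have := writesReal_pushVec h; omega

/-- The total join weight is the number of results in the leaf. If it is positive, the traced choice
has weight one everywhere, so its tuple lies in the leaf and can represent it. -/
theorem ends_countLeaf {D : q.Instance N} {R : Fin m → ℕ → Fin d → ℕ} {B : Finset (Fin d)}
    {ρ : Fin m} {es : List (Fin m × Fin m)} (hes : EliminationOrder q.attrs Finset.univ es ρ)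
    {E C : List ((Fin d → ℝ) × ℝ)} {i : ℕ} (hD : HoldsDatabase D R s) (hE : HoldsLeaves s E)
    (hi : i < E.length) (his : s.word 18 0 = i) (hN : 0 < N) (hW : N ≤ W) (hC : HoldsWeighted s C)
    (hCW : C.length + 1 ≤ W) (hS : IsSummary D B (E.take i) C) :
    (countLeaf q B ρ es).Ends W o s
      ((4 * N + 2) * m + 1 + ((14 * N + 10) * es.length + 5 * N + 3) + (d + 4)) fun t =>
      ∃ C', HoldsWeighted t C' ∧ IsSummary D B (E.take (i + 1)) C' := by
  classical
  refine ends_seq_le (ends_initWeights (B := B) hD hE hi his hW)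
    (n' := (14 * N + 10) * es.length + 5 * N + 3 + (d + 4)) (by omega) ?_
  intro t ht hwt
  have hDt := hD.congr (ht.1 0 (by simp [writesWord_forEach]))
    (ht.1 1 (by simp [writesWord_forEach])) (ht.2 0 (by simp [writesReal_forEach]))
  refine ends_seq_le (ends_joinCmd (z := (⟨0, hN⟩ : Fin N)) hes hDt.ranks hD.lt hwt
    (fun j k => by split_ifs <;> simp) hW) le_rfl ?_
  rintro u hu ⟨h1, h2⟩
  have hwu : ∀ a < 19, u.word a = t.word a := fun a ha => hu.1 a fun h => by
    rcases writesWord_joinCmd hes h with h | h | ⟨v, -, h⟩ <;> omega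
  have hDu := hDt.congr (hwu 0 (by omega)) (hwu 1 (by omega))
    (hu.2 0 fun h => by have := writesReal_joinCmd h; omega)
  have hCu : HoldsWeighted u C := by
    refine (hC.congr (t := t) (ht.1 21 (by simp [writesWord_forEach]))
      (ht.2 7 (by simp [writesReal_forEach])) (ht.2 8 (by simp [writesReal_forEach]))).congr
      (hu.1 21 fun h => ?_) (hu.2 7 fun h => ?_) (hu.2 8 fun h => ?_)
    · rcases writesWord_joinCmd hes h with h | h | ⟨v, -, h⟩ <;> omega
    · have := writesReal_joinCmd h; omega
    · have := writesReal_joinCmd h; omega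
  rw [joinWeight_inBox hD.ranking] at h1
  rw [List.take_succ_eq_append_getElem hi]
  refine ends_ite (n := d + 3) (fun h => ?_) fun h => ends_skip (by omega) ?_
  · replace h : 0 < u.real 13 0 := by simpa using h
    obtain ⟨l, hl1, hl2, hl3⟩ := h2 h
    have hbox : chosenTuple D l ∈ resultsIn D B E[i].2 E[i].1 := by
      refine mem_resultsIn.2 ⟨chosenTuple_mem_results hD.ranking hl2,
        (forall_inBox_iff hD.ranking hl2).1 fun j => ?_⟩
      have := hl3 j (Finset.mem_univ _)
      by_contra hno
      simp [hno] at this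
    have hcoord : ∀ v : Mem, v.word = u.word → v.real 0 = u.real 0 →
        (fun b => (chosenCoord q B b).eval v) = restrictTo B (chosenTuple D l) := by
      intro v hv hv0
      funext b
      have := hDu.value (q.relOf b) (l (q.relOf b)) (l _).2 b
      simp only [itemIdx] at this
      rw [chosenCoord, restrictTo]
      split_ifs
      · simp only [itemVal, RExp.eval_get, WExp.eval_add, WExp.eval_mul, WExp.eval_get,
          WExp.eval_const, WExp.eval_ofNat, hv, hv0, hDu.ranks.num, hl1 _ (Finset.mem_univ _), this]
        rfl
      · simp
    refine ends_seq_setReal (n := d + 2) (ends_pushVec (l := C.map Prod.fst) ?_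
      (by simp [hCu.num]) (by simpa using hCW) (by simpa using hCu.point) fun v h3 h4 h5 h6 => ?_)
    · intro b
      rw [chosenCoord]
      split_ifs <;> simp [itemVal]
    · refine ⟨_, ⟨?_, ?_, ?_⟩, hS.push hbox⟩
      · simpa using h5
      · rw [hcoord (u.setReal 8 _ _) rfl (by simp)] at h6
        simpa using h6
      · intro i' hi'
        rw [h4 8 (by norm_num)]
        simp only [WExp.eval_get, WExp.eval_const, hCu.num, RExp.eval_get, Mem.setReal_real_self]
        rw [List.length_append, List.length_singleton] at hi'
        rcases Nat.lt_succ_iff_lt_or_eq.1 hi' with h' | rfl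
        · rw [Function.update_of_ne h'.ne, List.getElem_append_left h', hCu.wt i' h']
        · simp [h1]
  · refine ⟨C, hCu, hS.skip ?_⟩
    replace h : ¬ 0 < u.real 13 0 := by simpa using h
    rw [h1, Nat.cast_pos, Finset.card_pos, Finset.not_nonempty_iff_eq_empty] at h
    exact h

/-- Replace the results of the join by weighted points, one for each leaf. -/
noncomputable def countStage (q : JoinQuery d m) (B : Finset (Fin d)) (ρ : Fin m)
    (es : List (Fin m × Fin m)) : Cmd :=
  .seq (.setWord 21 0 0) (forTo 18 (.var 17) (countLeaf q B ρ es))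

theorem writesWord_countStage {B : Finset (Fin d)} {ρ : Fin m} {es : List (Fin m × Fin m)}
    (hes : EliminationOrder q.attrs Finset.univ es ρ) {a : ℕ} (h : (countStage q B ρ es).WritesWord a) :
    18 ≤ a := by
  simp only [countStage, writesWord_seq, writesWord_forTo, writesWord_setWord] at h
  rcases h with h | h | h
  · omega
  · omega
  · have := writesWord_countLeaf hes h; omega

theorem writesReal_countStage {B : Finset (Fin d)} {ρ : Fin m} {es : List (Fin m × Fin m)} {a : ℕ}
    (h : (countStage q B ρ es).WritesReal a) : a = 5 ∨ a = 6 ∨ a = 7 ∨ a = 8 ∨ a = 13 := by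
  simp only [countStage, writesReal_seq, writesReal_forTo, writesReal_setWord, false_or] at h
  exact writesReal_countLeaf h

/-- Time linear in `N` for each leaf; this is the source of the leading term of the time bound. -/
theorem ends_countStage {D : q.Instance N} {R : Fin m → ℕ → Fin d → ℕ} {B : Finset (Fin d)}
    {ρ : Fin m} {es : List (Fin m × Fin m)} (hes : EliminationOrder q.attrs Finset.univ es ρ)
    {E : List ((Fin d → ℝ) × ℝ)} (hD : HoldsDatabase D R s) (hE : HoldsLeaves s E)
    (hN : 0 < N) (hW : N ≤ W) (hEW : E.length + 1 ≤ W) :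
    (countStage q B ρ es).Ends W o s
      (((4 * N + 2) * m + 1 + ((14 * N + 10) * es.length + 5 * N + 3) + (d + 6)) * E.length + 3)
      fun t => ∃ C, HoldsWeighted t C ∧ IsSummary D B E C := by
  have hww : ∀ a, a < 18 → ¬ (forTo 18 (.var 17) (countLeaf q B ρ es)).WritesWord a := by
    intro a ha h
    simp only [writesWord_forTo] at h
    rcases h with h | h
    · omega
    · have := writesWord_countLeaf hes h; omega
  refine ends_seq_setWord (by simp) ((ends_forTo (m := E.length) (C := (4 * N + 2) * m + 1 +
    ((14 * N + 10) * es.length + 5 * N + 3) + (d + 4)) (fun i t => ∃ C, HoldsWeighted t C ∧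
      IsSummary D B (E.take i) C) ?_ ?_ (by omega) ?_ ?_).mono le_rfl ?_)
  · exact fun h => by have := writesWord_countLeaf hes h; omega
  · intro t ht
    simp [ht.1 17 (hww 17 (by omega)), hE.num]
  · refine ⟨[], ⟨by simp, by simp [HoldsVecs], by simp⟩, .nil⟩
  · rintro i hi t ht hti ⟨C, hC, hS⟩
    have hDt : HoldsDatabase D R t := hD.congr (by
        rw [ht.1 0 (hww 0 (by omega))]
        simp) (by
        rw [ht.1 1 (hww 1 (by omega))]
        simp) (by
        rw [ht.2 0 fun h => ?_]
        · simp
        · have := writesReal_countLeaf (by simpa using h); omega)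
    have hEt : HoldsLeaves t E := hE.congr (by
        rw [ht.1 17 (hww 17 (by omega))]
        simp) (by
        rw [ht.2 3 fun h => ?_]
        · simp
        · have := writesReal_countLeaf (by simpa using h); omega) (by
        rw [ht.2 4 fun h => ?_]
        · simp
        · have := writesReal_countLeaf (by simpa using h); omega)
    have hlen := hS.length_le
    rw [List.length_take] at hlen
    refine (ends_countLeaf hes hDt hEt hi hti hN hW hC (by omega) hS).mono le_rfl ?_
    rintro u - ⟨C', hC', hS'⟩
    exact ⟨C', hC'.congr (by simp) rfl rfl, hS'⟩
  · rintro t - ⟨C, hC, hS⟩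
    rw [List.take_length] at hS
    exact ⟨C, hC, hS⟩

end Cmd

namespace Cmd

variable {W : ℕ} {o : Solver} {s : Mem} {d m N : ℕ} {q : JoinQuery d m}

/-! ### Reading the database -/

/-- Copy relation `j` to the list of all values. -/
def copyRelation (d : ℕ) (j : Fin m) : Cmd :=
  forTo 5 (.get 0 0 * .const d) (.setReal 0 (3 + (.const j * (.get 0 0 * .const d) + .var 5))
    (.get (j + 2) (.var 5)))

/-- Collect all values of the database and rank them. -/
def loadStage (d m : ℕ) : Cmd :=
  .seq (forEach (copyRelation (m := m) d) (List.finRange m)) (rankItems (itemCount d m))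

theorem writesWord_loadStage {a : ℕ} (h : (loadStage d m).WritesWord a) : 1 ≤ a ∧ a ≤ 10 := by
  simp only [loadStage, writesWord_seq, writesWord_forEach, copyRelation, writesWord_forTo,
    writesWord_setReal, or_false] at h
  rcases h with ⟨_, _, h⟩ | h
  · omega
  · exact writesWord_rankItems h

theorem writesReal_loadStage {a : ℕ} (h : (loadStage d m).WritesReal a) : a = 0 := by
  simp only [loadStage, writesReal_seq, writesReal_forEach, copyRelation, writesReal_forTo,
    writesReal_setReal, writesReal_rankItems, or_false] at h
  obtain ⟨_, _, h⟩ := h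
  exact h

theorem itemIdx_lt {j : Fin m} {l : ℕ} (hl : l < N) (a : Fin d) : itemIdx d j l a N < m * d * N := by
  have h1 : (j : ℕ) * N + l + 1 ≤ m * N := by
    have : ((j : ℕ) + 1) * N ≤ m * N := Nat.mul_le_mul_right _ j.2
    rw [add_mul] at this
    omega
  have h2 := Nat.mul_le_mul_right d h1
  have h3 := a.2
  rw [add_mul] at h2
  rw [itemIdx, mul_right_comm m d N]
  omega

/-- The values are stored behind the first three entries of array `0`, which keeps the parameters
intact. Entries for absent attributes are ranked along as zeros, so that addresses are uniform. -/
theorem ends_loadStage (D : q.Instance N) (hN : s.word 0 0 = N)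
    (hD : ∀ (j : Fin m), ∀ i < N * d, s.real (j + 2) i = encode (D j) i) (hNW : N * d ≤ W)
    (hW : 5 * (m * d * N) + 1 ≤ W) :
    (loadStage d m).Ends W o s ((3 * (N * d) + 2) * m + 1 +
        (8 * (m * d * N) + 7 + (13 * (m * d * N) + 6) * Nat.clog 2 (m * d * N))) fun t =>
      (∃ R, HoldsDatabase D R t) ∧ ∀ i < 3, t.real 0 i = s.real 0 i := by
  refine ends_seq_le (R := fun t => t.word 0 0 = N ∧ (∀ (j : Fin m), ∀ i < N * d,
    t.real 0 (3 + (j * (N * d) + i)) = encode (D j) i) ∧ ∀ i < 3, t.real 0 i = s.real 0 i)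
    ((ends_forEach (C := 3 * (N * d) + 2) (fun (L : List (Fin m)) t =>
      (∀ j ∈ L, ∀ i < N * d, t.real 0 (3 + (j * (N * d) + i)) = encode (D j) i) ∧
        ∀ i < 3, t.real 0 i = s.real 0 i) (List.finRange m) (by simp) ?_).mono
      (n' := (3 * (N * d) + 2) * m + 1) (by simp) ?_) le_rfl ?_
  · rintro L₁ j L₂ - t ht ⟨hI, hI3⟩
    have h0 : t.word 0 0 = N := by
      rw [ht.1 0 (by simp [writesWord_forEach, copyRelation]), hN]
    have hj : t.real (j + 2) = s.real (j + 2) :=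
      ht.2 _ (by simp [writesReal_forEach, copyRelation])
    refine (ends_forTo (m := N * d) (C := 1) (fun n t => (∀ v ∈ L₁ ++ [j], ∀ i < N * d,
      v ≠ j ∨ i < n → t.real 0 (3 + (v * (N * d) + i)) = encode (D v) i) ∧
        ∀ i < 3, t.real 0 i = s.real 0 i) (by simp) (fun u hu => ?_) hNW ⟨?_, by simpa using hI3⟩
        ?_).mono le_rfl fun u _ h => ⟨fun v hv i hi => h.1 v hv i hi (Or.inr hi), h.2⟩
    · simp [hu.1 0 (by simp), h0]
    · intro v hv i hi h
      simp only [not_lt_zero, or_false] at h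
      simp only [List.mem_append, List.mem_singleton, h] at hv
      simpa using hI v (hv.resolve_right id) i hi
    · rintro n hn u hu hun ⟨hI', hI3'⟩
      have hu0 : u.word 0 0 = N := by rw [hu.1 0 (by simp), h0]
      have huj : u.real (j + 2) = s.real (j + 2) := by rw [hu.2 _ (by simp), hj]
      refine ends_setReal le_rfl ?_
      simp only [WExp.eval_add, WExp.eval_mul, WExp.eval_get, WExp.eval_const, WExp.eval_ofNat, hun,
        hu0, huj, RExp.eval_get, Mem.setWord_real, Mem.setReal_real_self, hD j n hn]
      refine ⟨fun v hv i hi h => ?_, fun i hi => ?_⟩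
      · by_cases h1 : v = j ∧ i = n
        · rw [h1.1, h1.2, Function.update_self]
        · have h2 : 3 + ((v : ℕ) * (N * d) + i) ≠ 3 + (j * (N * d) + n) := fun h' => h1 (by
            simpa [Fin.val_inj] using (mul_add_inj hi hn).1 (Nat.add_left_cancel h'))
          rw [Function.update_of_ne h2]
          refine hI' v hv i hi ?_
          by_cases hvj : v = j
          · have : i ≠ n := fun h' => h1 ⟨hvj, h'⟩
            have := h.resolve_left (not_not.2 hvj)
            exact Or.inr (by omega)
          · exact Or.inl hvj
      · rw [Function.update_of_ne (by omega), hI3' i hi]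
  · rintro t ht ⟨h1, h2⟩
    exact ⟨by rw [ht.1 0 (by simp [writesWord_forEach, copyRelation]), hN],
      fun j => h1 j (by simp), h2⟩
  · rintro t - ⟨h0, h1, h2⟩
    refine (ends_rankItems (m := m * d * N) (V := fun i => t.real 0 (3 + i)) ?_ (fun _ => rfl)
      hW).mono le_rfl ?_
    · intro u hu
      simp [hu, h0]
    · rintro u hu ⟨h3, h4⟩
      have hu0 : u.word 0 = t.word 0 := hu.1 0 fun h => by have := writesWord_rankItems h; omega
      have hr : u.real 0 = t.real 0 := hu.2 0 (by simp)
      have hval : ∀ (j : Fin m), ∀ l < N, ∀ a : Fin d,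
          t.real 0 (3 + itemIdx d j l a N) = tupleValue D j l a := by
        intro j l hl a
        have h5 : l * d + a < N * d := by
          have := Nat.mul_le_mul_right d (Nat.succ_le_of_lt hl)
          rw [Nat.succ_mul] at this
          have := a.2
          omega
        rw [tupleValue, ← h1 j _ h5, itemIdx]
        congr 2
        ring
      -- The ranking is defined as whatever memory contains, so it needs no constraint for `l ≥ N`.
      refine ⟨⟨fun j l a => u.word 1 (itemIdx d j l a N), ⟨⟨by rw [hu0, h0], fun _ _ _ => rfl⟩,
        fun j l hl a => h3 _ (itemIdx_lt hl a), fun j p k l a => ?_, ?_⟩⟩, by rwa [hr]⟩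
      · rw [h4 _ (itemIdx_lt k.2 a) _ (itemIdx_lt l.2 a), hval j k k.2, hval p l l.2]
      · rwa [hr]

/-! ### Clustering the weighted points -/

/-- The list of weighted points, without the coordinates outside `B`. -/
noncomputable def pointList (B : Finset (Fin d)) (C : List ((Fin d → ℝ) × ℝ)) : List (Pt B × ℝ) :=
  C.map fun c => (proj B c.1, c.2)

/-- The distance from weighted point number `22` to center number `14`. -/
noncomputable def centerDist (B : Finset (Fin d)) : RExp :=
  .sqrt (.sumList (fun a : Fin d =>
    (.get 7 (.var 22 * .const d + .const a) - pointCoord a) *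
      (.get 7 (.var 22 * .const d + .const a) - pointCoord a)) B.toList)

/-- Add a point of weight `1` if there is no point. -/
def ensurePoint (d : ℕ) : Cmd :=
  .ite (.wordLt 0 (.var 21)) .skip (.seq (.setReal 8 0 1) (pushVec 7 21 fun _ : Fin d => 0))

/-- Add up the weighted distances from the points to the centers; they are `0` if there are as many
centers as points. -/
noncomputable def costStage (B : Finset (Fin d)) : Cmd :=
  .seq (.setReal 15 0 0) (.ite (.wordLt (.get 0 2) (.var 21))
    (forTo 22 (.var 21) (.seq (findMin (.get 0 2) (.wordLt 0 1) (centerDist B))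
      (.setReal 15 0 (.var 15 + .get 8 (.var 22) * .var 11)))) .skip)

/-- Cluster the weighted points and estimate the cost. -/
noncomputable def clusterStage (B : Finset (Fin d)) (err : RExp) : Cmd :=
  .seq (ensurePoint d) (.seq (.solve (.var 21) 7 8 1) (.seq (costStage B)
    (.setReal 0 0 (.var 15 + err))))

/-- The guarantees of the solver cover only nonempty inputs, but distinct centers are required even
if the join is empty. -/
theorem ends_ensurePoint {C : List ((Fin d → ℝ) × ℝ)} (hC : HoldsWeighted s C) (hW : 1 ≤ W) :
    (ensurePoint d).Ends W o s (d + 4) fun t =>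
      HoldsWeighted t (if C = [] then [(0, 1)] else C) := by
  refine ends_ite (n := d + 3) (fun h => ends_skip (by omega) ?_) fun h => ?_
  · have : C ≠ [] := by
      rintro rfl
      simp [hC.num] at h
    rwa [if_neg this]
  · have : C = [] := by
      rw [← List.length_eq_zero_iff]
      simpa [hC.num] using h
    subst this
    refine ends_seq_setReal (n := d + 2) (ends_pushVec (l := []) (by simp) (by simp [hC.num])
      (by simpa using hW) (by simp [HoldsVecs]) fun t h1 h2 h3 h4 => ?_)
    refine ⟨by simpa using h3, ?_, ?_⟩
    · simpa [Pi.zero_def] using h4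
    · simp [h2 8 (by norm_num)]

theorem decode_eq_proj {B : Finset (Fin d)} {f : ℕ → ℝ} {i : ℕ} {v : Fin d → ℝ}
    (h : ∀ b : Fin d, f (i * d + b) = v b) : decode B f i = proj B v := by
  ext a
  exact h a

theorem eval_centerDist {B : Finset (Fin d)} {i j : ℕ} {v : Fin d → ℝ} {y : Pt B}
    (hi : s.word 22 0 = i) (hj : s.word 14 0 = j) (hv : ∀ b : Fin d, s.real 7 (i * d + b) = v b)
    (hy : ∀ b : B, s.real 1 (j * d + (b : Fin d)) = y b) :
    (centerDist B).eval s = dist (proj B v) y := by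
  rw [EuclideanSpace.dist_eq, centerDist, RExp.eval_sqrt, RExp.eval_sumList, Finset.sum_map_toList,
    ← Finset.sum_coe_sort]
  congr 1
  refine Finset.sum_congr rfl fun b _ => ?_
  simp only [RExp.eval_mul, RExp.eval_sub, RExp.eval_get, WExp.eval_add, WExp.eval_mul,
    WExp.eval_get, WExp.eval_const, hi, hj, hv, hy, Real.dist_eq, sq_abs]
  rw [sq]
  rfl

theorem infDist_range_eq {E ι : Type*} [PseudoMetricSpace E] {f : ι → E} {x : E} {i : ι}
    (h : ∀ j, dist x (f i) ≤ dist x (f j)) : Metric.infDist x (Set.range f) = dist x (f i) := by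
  refine le_antisymm (Metric.infDist_le_dist_of_mem ⟨i, rfl⟩) ?_
  rw [Metric.le_infDist (Set.range_nonempty_iff_nonempty.2 ⟨i⟩)]
  rintro _ ⟨j, rfl⟩
  exact h j

/-- The number of centers is not bounded in terms of the summary. The distances are therefore
computed only if there are fewer centers than points; otherwise the estimate `0` turns out to be
right. -/
theorem ends_costStage {B : Finset (Fin d)} {C : List ((Fin d → ℝ) × ℝ)} {k : ℕ} {y : Fin k → Pt B}
    (hC : HoldsWeighted s C) (hk : s.word 0 2 = k) (hk0 : 0 < k)
    (hy : ∀ (j : Fin k) (b : B), s.real 1 (j * d + (b : Fin d)) = y j b) (hW : C.length ≤ W) :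
    (costStage B).Ends W o s ((5 * C.length + 6) * C.length + 4) fun t =>
      t.real 15 0 = if k < C.length then medianCost (Set.range y) (pointList B C) else 0 := by
  refine ends_seq_setReal (ends_ite (n := (5 * C.length + 6) * C.length + 2) (fun h => ?_)
    fun h => ends_skip (by omega) ?_)
  swap
  · simp only [Test.eval_wordLt, WExp.eval_get, WExp.eval_ofNat, WExp.eval_const,
      Mem.setReal_word, hk, hC.num] at h
    simp [h]
  simp only [Test.eval_wordLt, WExp.eval_get, WExp.eval_ofNat, WExp.eval_const,
    Mem.setReal_word, hk, hC.num] at h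
  -- Since `k < C.length`, the scans of the centers cost at most quadratic time in the size of the
  -- summary.
  have hcost : (5 * k + 6 + 2) * C.length ≤ (5 * C.length + 6) * C.length :=
    Nat.mul_le_mul_right _ (by omega)
  refine (ends_forTo (m := C.length) (C := 5 * k + 6) (fun i t =>
    t.real 15 0 = medianCost (Set.range y) (pointList B (C.take i) : Multiset (Pt B × ℝ)))
    (by simp) ?_ hW ?_ ?_).mono (by omega) ?_
  · intro t ht
    simp [ht.1 21 (by simp), hC.num]
  · simp [pointList, medianCost]
  · intro i hi t ht hti hI
    have h0 : t.word 0 2 = k := by simp [ht.1 0 (by simp), hk]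
    have h7 : t.real 7 = s.real 7 := by simpa using ht.2 7 (by simp)
    have h8 : t.real 8 = s.real 8 := by simpa using ht.2 8 (by simp)
    have h1 : t.real 1 = s.real 1 := by simpa using ht.2 1 (by simp)
    have hv : ∀ b : Fin d, t.real 7 (i * d + b) = C[i].1 b := fun b => by
      rw [h7, hC.point i (by simpa using hi)]
      simp
    refine ends_seq_le (n := 5 * k + 3) (n' := 1) (ends_findMin (m := k) (P := fun _ => True)
      (v := fun j => if h : j < k then dist (proj B C[i].1) (y ⟨j, h⟩) else 0) ?_ (by omega))
      (by omega) ?_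
    · intro u hu hur
      refine ⟨by simp [hu 0 (by omega) (by omega), h0], fun j hj huj => ⟨by simp, ?_⟩⟩
      rw [dif_pos hj]
      refine eval_centerDist (i := i) (j := j) (by simp [hu 22 (by omega) (by omega), hti]) huj
        (fun b => by rw [hur 7 (by omega), hv]) fun b => ?_
      rw [hur 1 (by omega), h1]
      exact hy ⟨j, hj⟩ b
    · rintro u hu (⟨-, h'⟩ | ⟨-, j, hj, -, h2, h3⟩)
      · exact absurd trivial (h' 0 hk0)
      rw [dif_pos hj] at h2
      have hinf : Metric.infDist (proj B C[i].1) (Set.range y) = u.real 11 0 := by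
        rw [h2]
        refine infDist_range_eq fun j' => ?_
        have := h3 j' j'.2 trivial
        rwa [dif_pos hj, dif_pos j'.2] at this
      have hsum : u.real 15 0 = t.real 15 0 := by rw [hu.2 15 (by simp)]
      have hw : u.real 8 i = C[i].2 := by rw [hu.2 8 (by simp), h8, hC.wt i hi]
      have h22 : u.word 22 0 = i := by rw [hu.1 22 (by simp), hti]
      refine ends_setReal le_rfl ?_
      rw [List.take_succ_eq_append_getElem hi]
      simp only [WExp.eval_const, WExp.eval_ofNat, RExp.eval_add, RExp.eval_mul, RExp.eval_get,
        WExp.eval_get, h22,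
        hsum, hw, ← hinf, Mem.setWord_real, Mem.setReal_real_self, Function.update_self, hI,
        pointList, medianCost, Multiset.map_coe, Multiset.sum_coe, List.map_append, List.sum_append,
        List.map_cons, List.map_nil, List.sum_singleton]
  · intro t _ ht
    rw [if_pos h, ht, List.take_length]

theorem decode_copyReal {B : Finset (Fin d)} {k : ℕ} (y : Fin k → Pt B) (j : Fin k) (b : B) :
    (s.copyReal 1 (k * d) (encode y)).real 1 (j * d + (b : Fin d)) = y j b := by
  have h1 : (j : ℕ) * d + (b : Fin d) < k * d := by
    have h2 := Nat.mul_le_mul_right d (Nat.succ_le_of_lt j.2)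
    rw [Nat.succ_mul] at h2
    have h3 := (b : Fin d).2
    omega
  simp only [Mem.copyReal, Function.update_self, if_pos h1]
  rw [encode_mul_add, dif_pos b.2]

theorem ofFn_decode_eq_pointList {B : Finset (Fin d)} {C : List ((Fin d → ℝ) × ℝ)}
    (hC : HoldsWeighted s C) {n : ℕ} (hn : n = C.length) :
    (List.ofFn fun i : Fin n => (decode B (s.real 7) i, s.real 8 i)) = pointList B C := by
  subst hn
  refine List.ext_getElem (by simp [pointList]) fun i h1 h2 => ?_
  rw [List.length_ofFn] at h1
  simp only [List.getElem_ofFn, pointList, List.getElem_map, hC.wt i h1, Prod.mk.injEq, and_true]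
  refine decode_eq_proj fun b => ?_
  rw [hC.point i (by simpa using h1)]
  simp

/-- The answer of the solver overwrites array `1`, which held `X`. Adding the error bound `δ` makes
the estimate an upper bound for the true cost. -/
theorem ends_clusterStage {B : Finset (Fin d)} {C : List ((Fin d → ℝ) × ℝ)} {k : ℕ}
    {alg : List (Pt B × ℝ) → Fin k → Pt B} {T : ℕ → ℕ} {err : RExp} {δ : ℝ}
    (hC : HoldsWeighted s C) (hk : s.word 0 2 = k) (hk0 : 0 < k)
    (herr : ∀ t, t.word 0 = s.word 0 → t.real 0 = s.real 0 → err.eval t = δ)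
    {C' : List ((Fin d → ℝ) × ℝ)} (hC' : C' = if C = [] then [(0, 1)] else C) (hW : C'.length ≤ W) :
    (clusterStage B err).Ends W (clusteringSolver alg T) s
      (T C'.length + (5 * C'.length + 6) * C'.length + d + 10) fun t =>
      outCenters B k t = alg (pointList B C') ∧
      outEstimate t = (if k < C'.length then
        medianCost (Set.range (alg (pointList B C'))) (pointList B C') else 0) + δ := by
  have hC'0 : 1 ≤ C'.length := by
    rw [hC']
    split_ifs with h
    · simp
    · exact List.length_pos_iff.2 h
  refine ends_seq_le (n' := T C'.length + (5 * C'.length + 6) * C'.length + 6)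
    (ends_ensurePoint hC (by omega)) (by omega) ?_
  rw [← hC']
  intro t ht hCt
  have ht0 : t.word 0 = s.word 0 := ht.1 0 (by simp [ensurePoint, writesWord_pushVec])
  have htr : t.real 0 = s.real 0 := ht.2 0 fun h => by
    simp only [ensurePoint, writesReal_ite, writesReal_skip, writesReal_seq, writesReal_setReal,
      false_or] at h
    rcases h with h | h
    · omega
    · have := writesReal_pushVec h; omega
  refine ends_seq_le (n := 1 + T C'.length) (n' := (5 * C'.length + 6) * C'.length + 5)
    (R := fun u => u = t.copyReal 1 (k * d) (encode (alg (pointList B C'))))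
    (ends_solve (by simp [hCt.num, clusteringSolver]) ?_) (by omega) ?_
  · simp only [clusteringSolver]
    rw [ofFn_decode_eq_pointList hCt (by simp [hCt.num])]
  · rintro u hu rfl
    refine ends_seq_le (n' := 1) (ends_costStage (y := alg (pointList B C')) (C := C') ?_
      (by rw [hu.1 0 (by simp), ht0, hk]) hk0 (decode_copyReal _) hW) le_rfl ?_
    · exact hCt.congr (hu.1 21 (by simp)) (hu.2 7 (by simp)) (hu.2 8 (by simp))
    · intro v hv hv15
      have herrv : err.eval v = δ := by
        refine herr v ?_ ?_
        · rw [hv.1 0 (by simp [costStage]), hu.1 0 (by simp), ht0]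
        · rw [hv.2 0 (by simp [costStage]), hu.2 0 (by simp), htr]
      refine ends_setReal le_rfl ⟨?_, ?_⟩
      · funext j
        ext b
        rw [outCenters, Mem.setReal_real_of_ne _ _ _ _ _ (by norm_num), hv.2 1 (by simp [costStage])]
        exact decode_copyReal _ j b
      · simp [outEstimate, hv15, herrv]

end Cmd

/-! ### Elimination orders from join trees -/

/-- Every rooted tree has a parent function and a depth function. -/
theorem SimpleGraph.IsTree.exists_parent {V : Type*} {G : SimpleGraph V} (hG : G.IsTree) (ρ : V) :
    ∃ (p : V → V) (h : V → ℕ), h ρ = 0 ∧ (∀ v, v ≠ ρ → h (p v) + 1 = h v) ∧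
      ∀ u v, G.Adj u v → (u ≠ ρ ∧ p u = v) ∨ (v ≠ ρ ∧ p v = u) := by
  classical
  -- The unique path to the root: its second vertex is the parent and its length the depth.
  choose P hP hPu using fun v => hG.existsUnique_path v ρ
  have hu : ∀ {v w : V} {x y : G.Walk v w}, x.IsPath → y.IsPath → x = y := fun {v w x y} hx hy =>
    congrArg Subtype.val ((hG.isAcyclic.subsingleton_path v w).elim ⟨x, hx⟩ ⟨y, hy⟩)
  have hroot : P ρ = SimpleGraph.Walk.nil := hu (hP ρ) .nil
  refine ⟨fun v => (P v).snd, fun v => (P v).length, by simp [hroot], ?_, ?_⟩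
  · intro v hv
    have hn : ¬ (P v).Nil := SimpleGraph.Walk.not_nil_of_ne hv
    have : P (P v).snd = (P v).tail := hu (hP _) (hP v).tail
    simp only [this]
    exact SimpleGraph.Walk.length_tail_add_one hn
  · intro u v huv
    -- If the path from `v` passes through `u`, uniqueness makes the edge its first step. Otherwise
    -- the edge followed by that path is the path from `u`.
    by_cases hmem : u ∈ (P v).support
    · right
      have hvρ : v ≠ ρ := by
        rintro rfl
        rw [hroot, SimpleGraph.Walk.support_nil, List.mem_singleton] at hmem
        exact huv.ne hmem
      refine ⟨hvρ, ?_⟩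
      have h1 : (P v).takeUntil u hmem = .cons huv.symm .nil :=
        hu ((hP v).takeUntil hmem) (by simp [huv.ne'])
      have h2 : P v = SimpleGraph.Walk.cons huv.symm ((P v).dropUntil u hmem) := by
        conv_lhs => rw [← (P v).take_spec hmem, h1]
        rfl
      simp only
      rw [h2, SimpleGraph.Walk.snd_cons]
    · left
      have h1 : P u = .cons huv (P v) := hu (hP u) ((hP v).cons hmem)
      refine ⟨?_, by simp only [h1, SimpleGraph.Walk.snd_cons]⟩
      rintro rfl
      exact hmem (P v).end_mem_support

section

variable {d m : ℕ} {A : Fin m → Finset (Fin d)}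

/-- Remove a deepest remaining relation `j` and continue. By `hA`, an attribute of `j` missing in
its parent occurs only in descendants of `j`; a proper descendant would be deeper than `j`, so no
other relation that remains contains it. -/
theorem exists_eliminationOrder_of_parent {ρ : Fin m} {p : Fin m → Fin m} {h : Fin m → ℕ}
    (hρ : h ρ = 0) (hp : ∀ v, v ≠ ρ → h (p v) + 1 = h v)
    (hA : ∀ j, j ≠ ρ → ∀ a ∈ A j, a ∉ A (p j) → ∀ i, a ∈ A i → ∃ n, p^[n] i = j ∧ h j + n ≤ h i)
    (V : Finset (Fin m)) (hρV : ρ ∈ V) (hV : ∀ v ∈ V, v ≠ ρ → p v ∈ V) :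
    ∃ es, EliminationOrder A V es ρ := by
  induction V using Finset.strongInduction with
  | H V ih =>
    by_cases hne : V = {ρ}
    · exact ⟨[], hne ▸ .root ρ⟩
    -- A deepest relation is nobody's parent, so the remaining set stays closed under parents.
    obtain ⟨j, hj, hmax⟩ := Finset.exists_max_image (V.erase ρ) h (by
      by_contra hno
      rw [Finset.not_nonempty_iff_eq_empty, Finset.erase_eq_empty_iff] at hno
      rcases hno with hno | hno
      · simp [hno] at hρV
      · exact hne hno)
    obtain ⟨hjρ, hjV⟩ := Finset.mem_erase.1 hj
    have hpj := hp j hjρ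
    have hmax' : ∀ i ∈ V, h i ≤ h j := fun i hi => by
      by_cases hiρ : i = ρ
      · rw [hiρ, hρ]
        exact Nat.zero_le _
      · exact hmax i (Finset.mem_erase.2 ⟨hiρ, hi⟩)
    obtain ⟨es, hes⟩ := ih (V.erase j) (Finset.erase_ssubset hjV)
      (Finset.mem_erase.2 ⟨hjρ.symm, hρV⟩) fun v hv hvρ => by
        have hvV := Finset.mem_of_mem_erase hv
        refine Finset.mem_erase.2 ⟨?_, hV v hvV hvρ⟩
        intro hvj
        have h1 := hp v hvρ
        have h2 := hmax' v hvV
        rw [hvj] at h1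
        omega
    refine ⟨(j, p j) :: es, ?_⟩
    rw [← Finset.insert_erase hjV]
    refine .step (Finset.notMem_erase _ _) (Finset.mem_erase.2 ⟨?_, hV j hjV hjρ⟩) ?_ hes
    · intro hpj'
      rw [hpj'] at hpj
      omega
    · intro i hi a ha
      rw [Finset.mem_inter] at ha
      by_contra hno
      obtain ⟨n, hn, hle⟩ := hA j hjρ a ha.2 hno i ha.1
      have := hmax' i (Finset.mem_of_mem_erase hi)
      obtain rfl : n = 0 := by omega
      exact Finset.ne_of_mem_erase hi hn

/-- The relations containing an attribute are connected in the tree. If the parent of `j` is not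
among them, a walk among them from `j` cannot leave the subtree below `j`, since the only way out is
through that parent. -/
theorem JoinQuery.Acyclic.exists_eliminationOrder {q : JoinQuery d m} (hq : q.Acyclic) :
    ∃ ρ es, EliminationOrder q.attrs Finset.univ es ρ := by
  obtain ⟨G, hG, hconn⟩ := hq
  obtain ⟨ρ⟩ := hG.connected.nonempty
  obtain ⟨p, h, hρ, hp, hadj⟩ := hG.exists_parent ρ
  refine ⟨ρ, exists_eliminationOrder_of_parent hρ hp ?_ _ (Finset.mem_univ _) fun _ _ _ =>
    Finset.mem_univ _⟩
  intro j hj a haj hap i hai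
  have hreach := (hconn a).preconnected ⟨j, haj⟩ ⟨i, hai⟩
  rw [SimpleGraph.reachable_iff_reflTransGen] at hreach
  suffices H : ∀ y : {j | a ∈ q.attrs j}, Relation.ReflTransGen
      (G.induce {j | a ∈ q.attrs j}).Adj ⟨j, haj⟩ y → ∃ n, p^[n] y = j ∧ h j + n ≤ h y from
    H _ hreach
  intro y hy
  induction hy with
  | refl => exact ⟨0, rfl, le_rfl⟩
  | @tail w w' _ hww ih =>
    obtain ⟨n, hn, hle⟩ := ih
    rcases hadj w w' hww with ⟨hw, hpw⟩ | ⟨hw, hpw⟩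
    · have hh := hp w hw
      rw [hpw] at hh
      -- A step towards the root taken at `j` itself would enter the excluded parent; elsewhere it
      -- shortens the distance to `j` by one.
      rcases n with _ | n
      · have hwj : (w : Fin m) = j := hn
        rw [hwj] at hpw
        exact absurd (hpw ▸ w'.2) hap
      · rw [Function.iterate_succ_apply, hpw] at hn
        exact ⟨n, hn, by omega⟩
    · have hh := hp w' hw
      rw [hpw] at hh
      refine ⟨n + 1, ?_, by omega⟩
      rw [Function.iterate_succ_apply, hpw, hn]

end

/-! ### Clustering a summary of a point set -/

section Median

variable {E : Type*}

theorem card_range_of_injective {k : ℕ} {y : Fin k → E} (hy : Function.Injective y) :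
    ∃ S : Finset E, S.card = k ∧ (S : Set E) = Set.range y :=
  ⟨Finset.univ.map ⟨y, hy⟩, by simp, by simp⟩

theorem exists_card_eq_superset_of_le_ncard {k : ℕ} {U : Set E} (hU : U.Finite) {S : Finset E}
    (hS : (S : Set E) ⊆ U) (h : S.card ≤ k) (hk : k ≤ U.ncard) :
    ∃ S' : Finset E, S ⊆ S' ∧ (S' : Set E) ⊆ U ∧ S'.card = k := by
  obtain ⟨S', h1, h2, h3⟩ := Finset.exists_subsuperset_card_eq (s := S) (t := hU.toFinset)
    (by rwa [Set.Finite.subset_toFinset]) h (by rwa [← Set.ncard_eq_toFinset_card U hU])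
  exact ⟨S', h1, by rwa [Set.Finite.subset_toFinset] at h2, h3⟩

section Pseudo

variable [PseudoMetricSpace E] {P V : Multiset (E × ℝ)} {S S' : Set E} {k : ℕ}

theorem medianCost_nonneg (hP : ∀ p ∈ P, 0 ≤ p.2) : 0 ≤ medianCost S P :=
  Multiset.sum_nonneg fun x hx => by
    obtain ⟨p, hp, rfl⟩ := Multiset.mem_map.1 hx
    exact mul_nonneg (hP p hp) Metric.infDist_nonneg

theorem medianCost_le_of_forall {c : ℝ} (hP : ∀ p ∈ P, 0 ≤ p.2)
    (h : ∀ p ∈ P, Metric.infDist p.1 S' ≤ c * Metric.infDist p.1 S) :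
    medianCost S' P ≤ c * medianCost S P := by
  rw [medianCost, medianCost, ← Multiset.sum_map_mul_left]
  refine Multiset.sum_map_le_sum_map _ _ fun p hp => ?_
  rw [mul_left_comm]
  exact mul_le_mul_of_nonneg_left (h p hp) (hP p hp)

theorem medianCost_eq_zero (h : ∀ p ∈ P, p.1 ∈ S) : medianCost S P = 0 :=
  Multiset.sum_eq_zero fun x hx => by
    obtain ⟨p, hp, rfl⟩ := Multiset.mem_map.1 hx
    rw [Metric.infDist_zero_of_mem (h p hp), mul_zero]

theorem medianOpt_le (hP : ∀ p ∈ P, 0 ≤ p.2) {S : Finset E} (hS : S.card = k) :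
    medianOpt k P ≤ medianCost S P :=
  ciInf_le (f := fun S : {S : Finset E // S.card = k} => medianCost (S : Set E) P)
    ⟨0, by rintro _ ⟨S, rfl⟩; exact medianCost_nonneg hP⟩ ⟨S, hS⟩

theorem medianOpt_nonneg (hP : ∀ p ∈ P, 0 ≤ p.2) : 0 ≤ medianOpt k P :=
  Real.iInf_nonneg fun _ => medianCost_nonneg hP

theorem medianOptDisc_le (hP : ∀ p ∈ P, 0 ≤ p.2) {S : Finset E} (hS : S.card = k)
    (hS' : ∀ x ∈ S, ∃ w, (x, w) ∈ P) : medianOptDisc k P ≤ medianCost S P :=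
  ciInf_le (f := fun S : {S : Finset E // S.card = k ∧ ∀ x ∈ S, ∃ w, (x, w) ∈ P} =>
      medianCost (S : Set E) P)
    ⟨0, by rintro _ ⟨S, rfl⟩; exact medianCost_nonneg hP⟩ ⟨S, hS, hS'⟩

/-- The set `S` shows that the infimum runs over a nonempty family; over an empty one it would be
`0`. The same holds in `le_medianOptDisc`. -/
theorem le_medianOpt {S : Finset E} (hS : S.card = k) {c : ℝ}
    (h : ∀ S : Finset E, S.card = k → c ≤ medianCost S P) : c ≤ medianOpt k P := by
  have : Nonempty {S : Finset E // S.card = k} := ⟨⟨S, hS⟩⟩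
  exact le_ciInf fun S => h S S.2

theorem le_medianOptDisc {S : Finset E} (hS : S.card = k) (hS' : ∀ x ∈ S, ∃ w, (x, w) ∈ P) {c : ℝ}
    (h : ∀ S : Finset E, S.card = k → (∀ x ∈ S, ∃ w, (x, w) ∈ P) → c ≤ medianCost S P) :
    c ≤ medianOptDisc k P := by
  have : Nonempty {S : Finset E // S.card = k ∧ ∀ x ∈ S, ∃ w, (x, w) ∈ P} := ⟨⟨S, hS, hS'⟩⟩
  exact le_ciInf fun S => h S S.2.1 S.2.2

theorem medianOpt_zero : medianOpt k (0 : Multiset (E × ℝ)) = 0 := by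
  simp [medianOpt, medianCost]

end Pseudo

variable [MetricSpace E] {P : List (E × ℝ)} {V : Multiset (E × ℝ)} {k : ℕ} {γ ε e : ℝ}
  {alg : List (E × ℝ) → Fin k → E}

/-- A good geometric clustering of a summary is a good clustering. -/
theorem geometric_estimate (hP : IsWeightedSet P) (hV : ∀ p ∈ V, 0 ≤ p.2)
    (he : ∀ S : Set E, |medianCost S P - medianCost S V| ≤ e) (halg : IsGeometricApprox k γ alg)
    (hγ : 1 ≤ γ) (heε : 3 * e ≤ ε * medianOpt k V) :
    Function.Injective (alg P) ∧
      medianCost (Set.range (alg P)) V ≤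
        (if k < P.length then medianCost (Set.range (alg P)) P else 0) + e ∧
      (if k < P.length then medianCost (Set.range (alg P)) P else 0) + e ≤
        (1 + ε) * γ * medianOpt k V := by
  classical
  obtain ⟨hinj, hcost⟩ := halg P hP
  have hP0 : ∀ p ∈ (P : Multiset (E × ℝ)), 0 ≤ p.2 := fun p hp => (hP.2.2 p hp).le
  obtain ⟨S, hS, hSr⟩ := card_range_of_injective hinj
  have hO := medianOpt_nonneg (k := k) hV
  have he0 : 0 ≤ e := (abs_nonneg _).trans (he ∅)
  -- The error bound holds for all centers at once, so it passes to the optima.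
  have hPV : medianOpt k (P : Multiset (E × ℝ)) ≤ medianOpt k V + e := by
    rw [← sub_le_iff_le_add]
    refine le_medianOpt hS fun S' hS' => ?_
    have h1 := medianOpt_le hP0 hS'
    have h2 := abs_le.1 (he S')
    linarith
  have h1 := abs_le.1 (he (Set.range (alg P)))
  have h2 : γ * medianOpt k (P : Multiset (E × ℝ)) ≤ γ * (medianOpt k V + e) :=
    mul_le_mul_of_nonneg_left hPV (by linarith)
  have h3 : e ≤ γ * e := le_mul_of_one_le_left he0 hγ
  have h4 : γ * (3 * e) ≤ γ * (ε * medianOpt k V) := mul_le_mul_of_nonneg_left heε (by linarith)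
  have h5 : 0 ≤ γ * (medianOpt k V) := mul_nonneg (by linarith) hO
  refine ⟨hinj, ?_⟩
  split_ifs with hk
  · constructor <;> nlinarith
  · have hzero : medianCost (Set.range (alg P)) P = 0 := by
      refine le_antisymm ?_ (medianCost_nonneg hP0)
      obtain ⟨S', h6, -, h7⟩ := Finset.exists_subsuperset_card_eq
        (s := (P.map Prod.fst).toFinset) (t := (P.map Prod.fst).toFinset ∪ S) (n := k)
        Finset.subset_union_left
        ((List.toFinset_card_le _).trans (by simpa using not_lt.1 hk))
        (hS.symm.le.trans (Finset.card_le_card Finset.subset_union_right))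
      have h8 := medianOpt_le hP0 h7
      rw [medianCost_eq_zero (P := (P : Multiset (E × ℝ))) (S := (S' : Set E))] at h8
      · nlinarith
      · intro p hp
        exact h6 (List.mem_toFinset.2 (List.mem_map.2 ⟨p, hp, rfl⟩))
    constructor <;> nlinarith

/-- Replace every center `y` by the point `z y` of the summary nearest to it. A summary point `p`
served by `y` is itself a candidate, so `dist y (z y) ≤ dist y p`, and the triangle inequality gives
the factor two. -/
theorem medianOptDisc_le_two_mul {S : Finset E} (hP : IsWeightedSet P) (hS : S.card = k)
    (hk0 : 0 < k) (hk : k ≤ P.length) :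
    medianOptDisc k (P : Multiset (E × ℝ)) ≤ 2 * medianCost S (P : Multiset (E × ℝ)) := by
  classical
  have hP0 : ∀ p ∈ (P : Multiset (E × ℝ)), 0 ≤ p.2 := fun p hp => (hP.2.2 p hp).le
  set Q := (P.map Prod.fst).toFinset with hQ
  have hQc : Q.card = P.length := by
    rw [hQ, List.toFinset_card_of_nodup hP.2.1, List.length_map]
  have hQne : Q.Nonempty := Finset.card_pos.1 (by omega)
  have hnear : ∀ x, ∃ z ∈ Q, ∀ p ∈ Q, dist x z ≤ dist x p := fun x => by
    obtain ⟨z, hz, h⟩ := Q.exists_min_image (fun p => dist x p) hQne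
    exact ⟨z, hz, h⟩
  choose z hzQ hz using hnear
  have hSne : S.Nonempty := Finset.card_pos.1 (by omega)
  -- Different centers may move to the same point; the set is filled up to `k` points, which only
  -- lowers the cost.
  obtain ⟨S', h1, h2, h3⟩ := exists_card_eq_superset_of_le_ncard (k := k) Q.finite_toSet
    (S := S.image z) (by
      intro x hx
      obtain ⟨y, -, rfl⟩ := Finset.mem_image.1 (Finset.mem_coe.1 hx)
      exact hzQ y) (Finset.card_image_le.trans hS.le) (by
      rwa [Set.ncard_coe_finset, hQc])
  have hmem : ∀ x ∈ Q, ∃ w, (x, w) ∈ (P : Multiset (E × ℝ)) := by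
    intro x hx
    rw [hQ, List.mem_toFinset, List.mem_map] at hx
    obtain ⟨p, hp, rfl⟩ := hx
    exact ⟨p.2, hp⟩
  refine (medianOptDisc_le hP0 h3 fun x hx => hmem x (h2 hx)).trans ?_
  refine medianCost_le_of_forall hP0 fun p hp => ?_
  have hpQ : p.1 ∈ Q := List.mem_toFinset.2 (List.mem_map.2 ⟨p, hp, rfl⟩)
  obtain ⟨y, hy, hpy⟩ := S.finite_toSet.isCompact.exists_infDist_eq_dist hSne p.1
  rw [hpy]
  refine (Metric.infDist_le_dist_of_mem (h1 (Finset.mem_image_of_mem z hy))).trans ?_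
  have h4 := dist_triangle p.1 y (z y)
  have h5 := hz y p.1 hpQ
  rw [dist_comm y p.1] at h5
  linarith

/-- A good discrete clustering of a summary by given points is a good clustering. -/
theorem discrete_estimate (hP : IsWeightedSet P) (hV : ∀ p ∈ V, 0 < p.2)
    (hPV : ∀ p ∈ P, ∃ w, (p.1, w) ∈ V)
    (he : ∀ S : Set E, |medianCost S P - medianCost S V| ≤ e) (halg : IsDiscreteApprox k γ alg)
    (hγ : 1 ≤ γ) (hε : 0 < ε) (hε1 : ε < 1) (heε : 3 * e ≤ ε * medianOpt k V) (hk0 : 0 < k)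
    (hk : k ≤ {x | ∃ w, (x, w) ∈ V}.ncard) :
    Function.Injective (alg P) ∧ (∀ i, ∃ w, (alg P i, w) ∈ V) ∧
      medianCost (Set.range (alg P)) V ≤
        (if k < P.length then medianCost (Set.range (alg P)) P else 0) + e ∧
      (if k < P.length then medianCost (Set.range (alg P)) P else 0) + e ≤
        (2 + ε) * γ * medianOptDisc k V := by
  classical
  have hP0 : ∀ p ∈ (P : Multiset (E × ℝ)), 0 ≤ p.2 := fun p hp => (hP.2.2 p hp).le
  have hV0 : ∀ p ∈ V, 0 ≤ p.2 := fun p hp => (hV p hp).le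
  set Q := (P.map Prod.fst).toFinset with hQ
  have hQc : Q.card = P.length := by
    rw [hQ, List.toFinset_card_of_nodup hP.2.1, List.length_map]
  have hQmem : ∀ p ∈ (P : Multiset (E × ℝ)), p.1 ∈ Q := fun p hp =>
    List.mem_toFinset.2 (List.mem_map.2 ⟨p, hp, rfl⟩)
  have hO := medianOpt_nonneg (k := k) hV0
  have he0 : 0 ≤ e := (abs_nonneg _).trans (he ∅)
  have hU : {x | ∃ w, (x, w) ∈ V}.Finite := by
    refine (V.toFinset.image Prod.fst).finite_toSet.subset ?_
    rintro x ⟨w, hw⟩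
    exact Finset.mem_coe.2 (Finset.mem_image.2 ⟨(x, w), Multiset.mem_toFinset.2 hw, rfl⟩)
  have hQU : (Q : Set E) ⊆ {x | ∃ w, (x, w) ∈ V} := by
    intro x hx
    obtain ⟨p, hp, rfl⟩ := List.mem_map.1 (List.mem_toFinset.1 (Finset.mem_coe.1 hx))
    exact hPV p hp
  -- If the summary had fewer than `k` points, completing it to `k` data points gives cost `0` on
  -- the summary, so `OPT ≤ e` and `3 e ≤ ε e`, which forces `e = 0`. Then the summary points have
  -- cost `0` on the data, hence contain every data point, against the hypothesis on the number of
  -- distinct points.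
  have hkP : k ≤ P.length := by
    by_contra! hlt
    obtain ⟨S, h1, -, h3⟩ := exists_card_eq_superset_of_le_ncard (k := k) hU hQU (by omega) hk
    have h4 := medianOpt_le hV0 h3
    have h5 := abs_le.1 (he S)
    rw [medianCost_eq_zero (P := (P : Multiset (E × ℝ))) fun p hp => h1 (hQmem p hp)] at h5
    have he1 : e = 0 := by nlinarith
    have h6 := abs_le.1 (he Q)
    rw [medianCost_eq_zero (P := (P : Multiset (E × ℝ))) fun p hp => hQmem p hp, he1] at h6
    have h7 : ∀ p ∈ V, p.1 ∈ Q := by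
      intro p hp
      have h8 : p.2 * Metric.infDist p.1 Q ≤ medianCost Q V :=
        Multiset.single_le_sum (by
          intro x hx
          obtain ⟨p, hp, rfl⟩ := Multiset.mem_map.1 hx
          exact mul_nonneg (hV0 p hp) Metric.infDist_nonneg) _
          (Multiset.mem_map_of_mem (fun p : E × ℝ => p.2 * Metric.infDist p.1 Q) hp)
      have h9 : Metric.infDist p.1 (Q : Set E) = 0 := by
        refine le_antisymm ?_ Metric.infDist_nonneg
        by_contra! h
        have := mul_pos (hV p hp) h
        linarith
      have hQne : (Q : Set E).Nonempty := by
        obtain ⟨p, hp⟩ := List.exists_mem_of_ne_nil _ hP.1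
        exact ⟨p.1, hQmem p hp⟩
      exact (Q.finite_toSet.isClosed.mem_iff_infDist_zero hQne).2 h9
    have h10 : {x | ∃ w, (x, w) ∈ V}.ncard ≤ Q.card := by
      rw [← Set.ncard_coe_finset Q]
      refine Set.ncard_le_ncard ?_ Q.finite_toSet
      rintro x ⟨w, hw⟩
      exact h7 _ hw
    omega
  obtain ⟨hinj, hmem, hcost⟩ := halg P hP hkP
  obtain ⟨S, hS, hSr⟩ := card_range_of_injective hinj
  have hSQ : S ⊆ Q := by
    intro x hx
    obtain ⟨i, rfl⟩ := hSr ▸ Finset.mem_coe.2 hx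
    exact List.mem_toFinset.2 (hmem i)
  have hSU : ∀ x ∈ S, ∃ w, (x, w) ∈ V := fun x hx => hQU (hSQ hx)
  have hOd : medianOpt k V ≤ medianOptDisc k V :=
    le_medianOptDisc hS hSU fun S' hS' _ => medianOpt_le hV0 hS'
  -- An optimal set for the data need not consist of summary points, so the factor two is paid for
  -- passing to the discrete optimum of the summary.
  have hPV' : medianOptDisc k (P : Multiset (E × ℝ)) / 2 ≤ medianOptDisc k V + e := by
    rw [← sub_le_iff_le_add]
    refine le_medianOptDisc hS hSU fun S' hS' _ => ?_
    have h1 := medianOptDisc_le_two_mul hP hS' hk0 hkP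
    have h2 := abs_le.1 (he S')
    linarith
  have h1 := abs_le.1 (he (Set.range (alg P)))
  have h2 : γ * medianOptDisc k (P : Multiset (E × ℝ)) ≤ γ * (2 * (medianOptDisc k V + e)) :=
    mul_le_mul_of_nonneg_left (by linarith) (by linarith)
  have h3 : e ≤ γ * e := le_mul_of_one_le_left he0 hγ
  have h4 : γ * (3 * e) ≤ γ * (ε * medianOptDisc k V) :=
    mul_le_mul_of_nonneg_left (heε.trans (mul_le_mul_of_nonneg_left hOd hε.le)) (by linarith)
  have h5 : 0 ≤ γ * (medianOptDisc k V) := mul_nonneg (by linarith) (hO.trans hOd)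
  refine ⟨hinj, fun i => hQU (List.mem_toFinset.2 (hmem i)), ?_⟩
  split_ifs with hk'
  · constructor <;> nlinarith
  -- Here `k = P.length`, so the centers are all points of the summary.
  · have hzero : medianCost (Set.range (alg P)) P = 0 := by
      refine medianCost_eq_zero fun p hp => ?_
      rw [← hSr, Finset.eq_of_subset_of_card_le hSQ (by omega)]
      exact hQmem p hp
    constructor <;> nlinarith

end Median

/-! ### The error of the summary -/

section Summary

variable {d m N : ℕ} {q : JoinQuery d m} {D : q.Instance N} {B : Finset (Fin d)}

theorem proj_restrictTo (t : Fin d → ℝ) : proj B (restrictTo B t) = proj B t := by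
  ext a
  exact if_pos a.2

theorem restrictTo_mem_box {ℓ : ℝ} {u t : Fin d → ℝ} : restrictTo B t ∈ box B ℓ u ↔ t ∈ box B ℓ u :=
  forall₂_congr fun b hb => by rw [restrictTo, if_pos hb]

/-- The factor could be the square root of the dimension; `d` is enough for constants. -/
theorem dist_proj_le {c : ℝ} (hc : 0 ≤ c) {t t' : Fin d → ℝ} (h : ∀ b ∈ B, |t b - t' b| ≤ c) :
    dist (proj B t) (proj B t') ≤ d * c := by
  have hd : (B.card : ℝ) ≤ d := by
    exact_mod_cast (Finset.card_le_univ B).trans (by simp)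
  rw [EuclideanSpace.dist_eq]
  refine Real.sqrt_le_iff.2 ⟨by positivity, ?_⟩
  calc ∑ i : B, dist (proj B t i) (proj B t' i) ^ 2 ≤ ∑ _i : B, c ^ 2 :=
        Finset.sum_le_sum fun i _ => pow_le_pow_left₀ dist_nonneg (h i i.2) 2
    _ = B.card * c ^ 2 := by simp
    _ ≤ d * c ^ 2 := by gcongr
    _ ≤ (d * c) ^ 2 := by
        rw [mul_pow]
        refine mul_le_mul_of_nonneg_right ?_ (sq_nonneg c)
        exact_mod_cast Nat.le_self_pow two_ne_zero d

theorem abs_sub_le_of_mem_box {ℓ : ℝ} {u t t' : Fin d → ℝ} (h : t ∈ box B ℓ u) (h' : t' ∈ box B ℓ u)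
    {b : Fin d} (hb : b ∈ B) : |t b - t' b| ≤ max ℓ 0 := by
  obtain ⟨h1, h2⟩ := h b hb
  obtain ⟨h3, h4⟩ := h' b hb
  have h5 := le_max_left ℓ 0
  have h6 := le_max_right ℓ 0
  rw [abs_le]
  rcases h2 with h2 | h2 <;> rcases h4 with h4 | h4 <;> constructor <;> linarith

/-- Sums over the results of the join in disjoint boxes that cover them. -/
theorem sum_resultsIn_eq {E : List ((Fin d → ℝ) × ℝ)}
    (hE : E.Pairwise fun u v => Disjoint (box B u.2 u.1) (box B v.2 v.1))
    (hcov : ∀ t ∈ JoinQuery.results D, ∃ v ∈ E, t ∈ box B v.2 v.1) (F : (Fin d → ℝ) → ℝ) :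
    (E.map fun e => ∑ t ∈ resultsIn D B e.2 e.1, F t).sum =
      ∑ t ∈ (JoinQuery.results_finite D).toFinset, F t := by
  classical
  have key : (E.map fun e => ∑ t ∈ resultsIn D B e.2 e.1, F t).sum =
      ∑ t ∈ (JoinQuery.results_finite D).toFinset.filter (fun t => ∃ v ∈ E, t ∈ box B v.2 v.1),
        F t := by
    clear hcov
    induction E with
    | nil => simp
    | cons e E ih =>
      rw [List.pairwise_cons] at hE
      rw [List.map_cons, List.sum_cons, ih hE.2, ← Finset.sum_union]
      · refine Finset.sum_congr ?_ fun _ _ => rfl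
        ext t
        simp only [Finset.mem_union, mem_resultsIn, Finset.mem_filter, Set.Finite.mem_toFinset,
          List.mem_cons, exists_eq_or_imp, and_or_left]
      · rw [Finset.disjoint_left]
        intro t ht ht'
        obtain ⟨v, hv, htv⟩ := (Finset.mem_filter.1 ht').2
        exact Set.disjoint_left.1 (hE.1 v hv) (mem_resultsIn.1 ht).2 htv
  rw [key, Finset.filter_true_of_mem fun t ht => hcov t (by simpa using ht)]

/-- In each box the values of `g` at the results are replaced by its value at the representative.
The error is measured by `δ` at the replaced result, not at the representative, so that the errors
add up to a sum over all results. -/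
theorem IsSummary.abs_sub_le {E C : List ((Fin d → ℝ) × ℝ)} (h : IsSummary D B E C) {g : Pt B → ℝ}
    {δ : (Fin d → ℝ) → ℝ}
    (hδ : ∀ e ∈ E, ∀ t ∈ resultsIn D B e.2 e.1, ∀ t' ∈ resultsIn D B e.2 e.1,
      |g (proj B t') - g (proj B t)| ≤ δ t) :
    |((Cmd.pointList B C).map fun c => c.2 * g c.1).sum -
        (E.map fun e => ∑ t ∈ resultsIn D B e.2 e.1, g (proj B t)).sum| ≤
      (E.map fun e => ∑ t ∈ resultsIn D B e.2 e.1, δ t).sum := by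
  induction h with
  | nil => simp [Cmd.pointList]
  | skip h he ih =>
    simp only [List.map_append, List.map_cons, List.map_nil, List.sum_append, List.sum_singleton, he,
      Finset.sum_empty, add_zero]
    exact ih fun e he' => hδ e (List.mem_append_left _ he')
  | @push E C e t h ht ih =>
    have h1 := ih fun e he' => hδ e (List.mem_append_left _ he')
    have h2 : |((resultsIn D B e.2 e.1).card : ℝ) * g (proj B t) -
        ∑ t' ∈ resultsIn D B e.2 e.1, g (proj B t')| ≤ ∑ t' ∈ resultsIn D B e.2 e.1, δ t' := by
      rw [← nsmul_eq_mul, ← Finset.sum_const, ← Finset.sum_sub_distrib]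
      exact (Finset.abs_sum_le_sum_abs _ _).trans (Finset.sum_le_sum fun t' ht' =>
        hδ e (by simp) t' ht' t ht)
    simp only [Cmd.pointList, List.map_append, List.map_cons, List.map_nil, List.sum_append,
      List.sum_singleton, proj_restrictTo] at h1 ⊢
    rw [add_sub_add_comm]
    exact (abs_add_le _ _).trans (add_le_add h1 h2)

theorem IsSummary.exists_box {E C : List ((Fin d → ℝ) × ℝ)} (h : IsSummary D B E C) :
    ∀ c ∈ C, (∃ e ∈ E, c.1 ∈ box B e.2 e.1) ∧ (∃ t ∈ JoinQuery.results D, proj B c.1 = proj B t) ∧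
      0 < c.2 := by
  induction h with
  | nil => simp
  | skip h he ih =>
    intro c hc
    obtain ⟨⟨e, h1, h2⟩, h3⟩ := ih c hc
    exact ⟨⟨e, List.mem_append_left _ h1, h2⟩, h3⟩
  | @push E C e t h ht ih =>
    intro c hc
    rw [List.mem_append, List.mem_singleton] at hc
    rcases hc with hc | rfl
    · obtain ⟨⟨e, h1, h2⟩, h3⟩ := ih c hc
      exact ⟨⟨e, List.mem_append_left _ h1, h2⟩, h3⟩
    · refine ⟨⟨e, by simp, restrictTo_mem_box.2 (mem_resultsIn.1 ht).2⟩,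
        ⟨t, (mem_resultsIn.1 ht).1, proj_restrictTo t⟩, ?_⟩
      simpa using Finset.card_pos.2 ⟨t, ht⟩

/-- Representatives lie in disjoint boxes, and membership in a box depends only on the coordinates
in `B`. -/
theorem IsSummary.nodup {E C : List ((Fin d → ℝ) × ℝ)} (h : IsSummary D B E C)
    (hE : E.Pairwise fun u v => Disjoint (box B u.2 u.1) (box B v.2 v.1)) :
    ((Cmd.pointList B C).map Prod.fst).Nodup := by
  induction h with
  | nil => simp [Cmd.pointList]
  | skip h he ih => exact ih (List.pairwise_append.1 hE).1
  | @push E C e t h ht ih =>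
    obtain ⟨h1, -, h2⟩ := List.pairwise_append.1 hE
    simp only [Cmd.pointList, List.map_append, List.map_cons, List.map_nil]
    rw [List.nodup_append]
    refine ⟨by simpa [Cmd.pointList] using ih h1, by simp, ?_⟩
    intro x hx y hy hxy
    simp only [List.mem_singleton] at hy
    simp only [List.mem_map] at hx
    obtain ⟨_, ⟨c, hc, rfl⟩, rfl⟩ := hx
    obtain ⟨⟨v, hv, hcv⟩, -⟩ := h.exists_box c hc
    refine Set.disjoint_left.1 (h2 v hv e (by simp)) hcv ?_
    have h3 := restrictTo_mem_box.2 (mem_resultsIn.1 ht).2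
    intro b hb
    have h4 : c.1 b = restrictTo B t b := by
      have := congrArg (fun z : Pt B => z ⟨b, hb⟩) (hxy.trans hy)
      simpa [proj] using this
    rw [h4]
    exact h3 b hb

theorem IsSummary.ne_nil {E C : List ((Fin d → ℝ) × ℝ)} (h : IsSummary D B E C)
    (hcov : ∀ t ∈ JoinQuery.results D, ∃ v ∈ E, t ∈ box B v.2 v.1)
    (hne : (JoinQuery.results D).Nonempty) : C ≠ [] := by
  obtain ⟨t, ht⟩ := hne
  obtain ⟨v, hv, htv⟩ := hcov t ht
  have key : (∀ e ∈ E, resultsIn D B e.2 e.1 = ∅) ∨ C ≠ [] := by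
    clear hv hcov
    induction h with
    | nil => simp
    | skip h he ih =>
      rcases ih with ih | ih
      · left
        intro e' he'
        rw [List.mem_append, List.mem_singleton] at he'
        rcases he' with he' | rfl
        · exact ih e' he'
        · exact he
      · exact Or.inr ih
    | push h ht ih => simp
  refine key.resolve_left fun h' => ?_
  have := h' v hv
  rw [Finset.eq_empty_iff_forall_notMem] at this
  exact this t (mem_resultsIn.2 ⟨ht, htv⟩)

theorem medianCost_data (S : Set (Pt B)) : medianCost S (JoinQuery.data D B) =
    ∑ t ∈ (JoinQuery.results_finite D).toFinset, Metric.infDist (proj B t) S := by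
  simp only [medianCost, JoinQuery.data, JoinQuery.projected, Multiset.map_map, Function.comp_apply,
    one_mul]
  rfl

theorem mem_data {p : Pt B × ℝ} : p ∈ JoinQuery.data D B ↔
    p.2 = 1 ∧ ∃ t ∈ JoinQuery.results D, proj B t = p.1 := by
  obtain ⟨x, w⟩ := p
  simp only [JoinQuery.data, JoinQuery.projected, Multiset.mem_map, Finset.mem_val,
    Set.Finite.mem_toFinset, Prod.mk.injEq]
  constructor
  · rintro ⟨_, ⟨t, ht, rfl⟩, rfl, rfl⟩
    exact ⟨rfl, t, ht, rfl⟩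
  · rintro ⟨rfl, t, ht, rfl⟩
    exact ⟨_, ⟨t, ht, rfl⟩, rfl, rfl⟩

theorem mem_projected {x : Pt B} : x ∈ JoinQuery.projected D B ↔ ∃ w, (x, w) ∈ JoinQuery.data D B := by
  simp only [mem_data, JoinQuery.projected, Multiset.mem_map, Finset.mem_val,
    Set.Finite.mem_toFinset]
  simp

theorem card_results_le (D : q.Instance N) :
    (JoinQuery.results_finite D).toFinset.card ≤ N ^ m := by
  classical
  have h : (JoinQuery.results_finite D).toFinset ⊆
      Finset.univ.image fun l : Fin m → Fin N => chosenTuple D l := by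
    intro t ht
    rw [Set.Finite.mem_toFinset] at ht
    choose l hl using ht
    refine Finset.mem_image.2 ⟨l, Finset.mem_univ _, funext fun a => ?_⟩
    rw [chosenTuple, tupleValue_of_mem D _ (q.mem_relOf a), hl]
    rfl
  exact (Finset.card_le_card h).trans (Finset.card_image_le.trans (by simp))

/-- The distance of one result to `X` is a single summand of the cost, hence at most `r`. -/
theorem exists_abs_sub_le {n : ℕ} (hn : 0 < n) {X : Fin n → Pt B} {r : ℝ}
    (hr : medianCost (Set.range X) (JoinQuery.data D B) ≤ r) {t : Fin d → ℝ}
    (ht : t ∈ JoinQuery.results D) : ∃ i, dist (proj B t) (X i) ≤ r := by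
  have hne : (Set.range X).Nonempty := ⟨_, ⟨⟨0, hn⟩, rfl⟩⟩
  obtain ⟨_, ⟨i, rfl⟩, hi⟩ := (Set.finite_range X).isCompact.exists_infDist_eq_dist hne (proj B t)
  refine ⟨i, hi ▸ le_trans ?_ hr⟩
  rw [medianCost_data]
  exact Finset.single_le_sum (f := fun t => Metric.infDist (proj B t) (Set.range X))
    (fun _ _ => Metric.infDist_nonneg) (by simpa using ht)

/-- The summary changes the cost of any set of centers only a little. -/
theorem IsSummary.abs_medianCost_sub_le {E C : List ((Fin d → ℝ) × ℝ)} (h : IsSummary D B E C)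
    {n : ℕ} (hn : 0 < n) {X : Fin n → Pt B} {x : ℕ → Fin d → ℝ}
    (hx : ∀ (i : Fin n) (b : B), x i b = X i b) {r α ε : ℝ} (hα : 0 < α) (hε : 0 < ε)
    (hN : 0 < N) (hr : medianCost (Set.range X) (JoinQuery.data D B) ≤ r)
    (hE : Cmd.IsLeafList x n r B (6 * d * α / ε) (6 * d * α * N ^ m) (ε * r) E) (S : Set (Pt B)) :
    |medianCost S (Cmd.pointList B C : Multiset (Pt B × ℝ)) - medianCost S (JoinQuery.data D B)| ≤
      ε * r / (3 * α) := by
  have hcov : ∀ t ∈ JoinQuery.results D, ∃ v ∈ E, t ∈ box B v.2 v.1 := fun t ht => by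
    obtain ⟨i, hi⟩ := exists_abs_sub_le hn hr ht
    refine hE.cover t ⟨i, i.2, fun b hb => ?_⟩
    refine le_trans ?_ hi
    have := PiLp.norm_apply_le (proj B t - X i) ⟨b, hb⟩
    rw [← dist_eq_norm] at this
    rwa [hx i ⟨b, hb⟩]
  have hXne : (Set.range X).Nonempty := ⟨_, ⟨⟨0, hn⟩, rfl⟩⟩
  have hr0 : 0 ≤ r := le_trans (by
    rw [medianCost_data]
    exact Finset.sum_nonneg fun _ _ => Metric.infDist_nonneg) hr
  have hNm : (0 : ℝ) < N ^ m := by positivity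
  -- The first summand pays for leaves far from `X`, the second for small leaves.
  set δ : (Fin d → ℝ) → ℝ := fun t =>
    ε / (6 * α) * Metric.infDist (proj B t) (Set.range X) + ε * r / (6 * α * N ^ m) with hδ
  have hδ0 : ∀ t, 0 ≤ δ t := fun t => add_nonneg
    (mul_nonneg (by positivity) Metric.infDist_nonneg) (by positivity)
  have hdist : ∀ e ∈ E, ∀ t ∈ resultsIn D B e.2 e.1, ∀ t' ∈ resultsIn D B e.2 e.1,
      dist (proj B t') (proj B t) ≤ δ t := by
    intro e he t ht t' ht'
    have h1 := dist_proj_le (le_max_right e.2 0) fun b hb =>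
      abs_sub_le_of_mem_box (mem_resultsIn.1 ht').2 (mem_resultsIn.1 ht).2 hb
    refine h1.trans ?_
    rcases le_total e.2 0 with h0 | h0
    · rw [max_eq_right h0, mul_zero]
      exact hδ0 t
    rw [max_eq_left h0]
    rcases hE.far e he with hfar | hsmall
    · refine le_trans ?_ (le_add_of_nonneg_right (by positivity))
      -- A point of `X` closer than this to a result in the leaf would be near the leaf in every
      -- direction.
      have h2 : 6 * d * α / ε * e.2 ≤ Metric.infDist (proj B t) (Set.range X) := by
        rw [Metric.le_infDist hXne]
        rintro _ ⟨i, rfl⟩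
        by_contra! hlt
        refine hfar ⟨i, i.2, fun b hb => ?_⟩
        have h3 := PiLp.norm_apply_le (proj B t - X i) ⟨b, hb⟩
        rw [← dist_eq_norm] at h3
        have h4 : |t b - x i b| ≤ 6 * d * α / ε * e.2 := by
          rw [hx i ⟨b, hb⟩]
          exact le_trans h3 hlt.le
        rw [abs_le] at h4
        obtain ⟨h5, h6⟩ := (mem_resultsIn.1 ht).2 b hb
        constructor
        · linarith
        · rcases h6 with h6 | h6 <;> linarith
      calc (d : ℝ) * e.2 = ε / (6 * α) * (6 * d * α / ε * e.2) := by field_simp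
        _ ≤ _ := mul_le_mul_of_nonneg_left h2 (by positivity)
    · refine le_trans ?_ (le_add_of_nonneg_left (mul_nonneg (by positivity) Metric.infDist_nonneg))
      rw [le_div_iff₀ (by positivity)]
      linarith
  have key := h.abs_sub_le (g := fun p => Metric.infDist p S) (δ := δ) fun e he t ht t' ht' => by
    refine le_trans ?_ (hdist e he t ht t' ht')
    simpa [Real.dist_eq] using (Metric.lipschitz_infDist_pt S).dist_le_mul (proj B t') (proj B t)
  rw [sum_resultsIn_eq hE.disj hcov, sum_resultsIn_eq hE.disj hcov, ← medianCost_data] at key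
  refine key.trans ?_
  rw [Finset.sum_add_distrib, ← Finset.mul_sum, ← medianCost_data, Finset.sum_const, nsmul_eq_mul]
  have h1 : ε / (6 * α) * medianCost (Set.range X) (JoinQuery.data D B) ≤ ε / (6 * α) * r :=
    mul_le_mul_of_nonneg_left hr (by positivity)
  have h2 : ((JoinQuery.results_finite D).toFinset.card : ℝ) * (ε * r / (6 * α * N ^ m)) ≤
      N ^ m * (ε * r / (6 * α * N ^ m)) :=
    mul_le_mul_of_nonneg_right (by exact_mod_cast card_results_le D) (by positivity)
  calc _ ≤ ε / (6 * α) * r + N ^ m * (ε * r / (6 * α * N ^ m)) := add_le_add h1 h2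
    _ = ε * r / (3 * α) := by field_simp; ring

end Summary

/-! ### The time bound -/

section Bounds

/-- For `N ≥ 2` the summand `1` is at most the binary logarithm, and `2 / log 2 < 3`. -/
theorem log_add_one_le {N : ℕ} (hN : 2 ≤ N) : ((Nat.log 2 N + 1 : ℕ) : ℝ) ≤ 3 * Real.log N := by
  have h1 : (Nat.log 2 N : ℝ) * Real.log 2 ≤ Real.log N := by
    rw [← Real.log_pow]
    refine Real.log_le_log (by positivity) ?_
    exact_mod_cast Nat.pow_log_le_self 2 (by omega)
  have h2 : (1 : ℝ) ≤ Nat.log 2 N := by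
    exact_mod_cast Nat.log_pos (by norm_num) hN
  have h3 := Real.log_two_gt_d9
  push_cast
  nlinarith

/-- The minimum may vanish for `s = 1`, because then `log s = 0`; in that case `log N ≤ N` lets the
first term absorb the left side. For `s ≥ 2` all logarithms are at least `1 / 2`, which explains the
power of two. -/
theorem log_sq_le {N s dᵤ : ℕ} (hN : 2 ≤ N) (hs : 1 ≤ s) :
    (s : ℝ) ^ 2 * Real.log N ^ 2 ≤ s * N * Real.log N + 2 ^ (dᵤ + 1) *
      (s ^ 2 * Real.log N ^ 3 * min (Real.log s ^ dᵤ) (s * Real.log N)) := by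
  have h2 := Real.log_two_gt_d9
  have hN' : Real.log 2 ≤ Real.log N := Real.log_le_log (by norm_num) (by exact_mod_cast hN)
  have hs' : 0 ≤ Real.log s := Real.log_nonneg (by exact_mod_cast hs)
  have hlog : 0 < Real.log N := by linarith
  have hmin : 0 ≤ min (Real.log s ^ dᵤ) (s * Real.log N) := le_min (by positivity) (by positivity)
  rcases hs.eq_or_lt with rfl | hs
  · refine le_trans ?_ (le_add_of_nonneg_right (by positivity))
    have := Real.log_le_self (x := N) (by positivity)
    push_cast
    nlinarith
  · refine le_trans ?_ (le_add_of_nonneg_left (by positivity))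
    have hs2 : Real.log 2 ≤ Real.log s := Real.log_le_log (by norm_num) (by exact_mod_cast hs)
    have h3 : (1 / 2 : ℝ) ^ dᵤ ≤ min (Real.log s ^ dᵤ) (s * Real.log N) := by
      refine le_min (pow_le_pow_left₀ (by norm_num) (by linarith) _) ?_
      refine (pow_le_one₀ (by norm_num) (by norm_num)).trans ?_
      have : (2 : ℝ) ≤ s := by exact_mod_cast hs
      nlinarith
    have h4 : 1 ≤ 2 ^ (dᵤ + 1) * (Real.log N * min (Real.log s ^ dᵤ) (s * Real.log N)) := by
      calc (1 : ℝ) = 2 ^ (dᵤ + 1) * (1 / 2 * (1 / 2) ^ dᵤ) := by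
            rw [← pow_succ', ← mul_pow]; norm_num
        _ ≤ _ := by
            refine mul_le_mul_of_nonneg_left ?_ (by positivity)
            exact mul_le_mul (by linarith) h3 (by positivity) hlog.le
    calc (s : ℝ) ^ 2 * Real.log N ^ 2 = s ^ 2 * Real.log N ^ 2 * 1 := by ring
      _ ≤ s ^ 2 * Real.log N ^ 2 *
          (2 ^ (dᵤ + 1) * (Real.log N * min (Real.log s ^ dᵤ) (s * Real.log N))) :=
        mul_le_mul_of_nonneg_left h4 (by positivity)
      _ = _ := by ring

/-- Passing to natural logarithms costs a factor `3`, squared `9`; together with `log_sq_le` this is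
at most `12 * 2 ^ (dᵤ + 1)` times the first two terms. The part `3 * b` of the constant makes the
argument of `T` in the bound at least `n`. -/
theorem exists_le_timeBound (dᵤ a b : ℕ) : ∃ K₀ : ℕ, ∀ K, K₀ ≤ K → ∀ (N s n : ℕ) (T : ℕ → ℕ),
    2 ≤ N → 1 ≤ s → Monotone T → n ≤ b * (s * (Nat.log 2 N + 1)) →
    a * (s * N * (Nat.log 2 N + 1) + (s * (Nat.log 2 N + 1)) ^ 2) + T n ≤
      ⌊timeBound K dᵤ N s T⌋₊ := by
  refine ⟨a * (12 * 2 ^ (dᵤ + 1)) + 3 * b + 1, fun K hK N s n T hN hs hT hn => ?_⟩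
  have hL := log_add_one_le hN
  have hL0 : (0 : ℝ) ≤ ((Nat.log 2 N + 1 : ℕ) : ℝ) := Nat.cast_nonneg _
  have hlog : 0 ≤ Real.log N := by linarith
  have hs' : 0 ≤ Real.log s := Real.log_nonneg (by exact_mod_cast hs)
  have hmin : 0 ≤ min (Real.log s ^ dᵤ) (s * Real.log N) := le_min (by positivity) (by positivity)
  have hsq := log_sq_le (dᵤ := dᵤ) hN hs
  set A : ℝ := s * N * Real.log N with hA
  set C : ℝ := s ^ 2 * Real.log N ^ 3 * min (Real.log s ^ dᵤ) (s * Real.log N) with hC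
  have hA0 : 0 ≤ A := by positivity
  have hC0 : 0 ≤ C := by positivity
  have hK1 : ((a * (12 * 2 ^ (dᵤ + 1)) + 3 * b + 1 : ℕ) : ℝ) ≤ K := by exact_mod_cast hK
  push_cast at hK1
  have hp : (1 : ℝ) ≤ 2 ^ (dᵤ + 1) := one_le_pow₀ (by norm_num)
  have hTn : T n ≤ T ⌈K * (s * Real.log N)⌉₊ := by
    refine hT ?_
    have h1 : (n : ℝ) ≤ K * (s * Real.log N) := by
      calc (n : ℝ) ≤ (b * (s * (Nat.log 2 N + 1)) : ℕ) := by exact_mod_cast hn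
        _ = b * (s * ((Nat.log 2 N + 1 : ℕ) : ℝ)) := by push_cast; ring
        _ ≤ b * (s * (3 * Real.log N)) := by gcongr
        _ = (3 * b) * (s * Real.log N) := by ring
        _ ≤ _ := by
          refine mul_le_mul_of_nonneg_right ?_ (by positivity)
          have : (0 : ℝ) ≤ a * (12 * 2 ^ (dᵤ + 1)) := by positivity
          linarith
    exact_mod_cast h1.trans (Nat.le_ceil _)
  refine Nat.le_floor ?_
  rw [timeBound, ← hA, ← hC, mul_add (K : ℝ)]
  push_cast
  have hK' : (a * (12 * 2 ^ (dᵤ + 1)) : ℝ) ≤ K := by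
    have : (0 : ℝ) ≤ 3 * b := by positivity
    linarith
  have hK'' : (1 : ℝ) ≤ K := by
    have : (0 : ℝ) ≤ a * (12 * 2 ^ (dᵤ + 1)) + 3 * b := by positivity
    linarith
  refine add_le_add ?_ ?_
  · push_cast at hL
    calc (a : ℝ) * (s * N * (Nat.log 2 N + 1) + (s * (Nat.log 2 N + 1)) ^ 2)
        ≤ a * (s * N * (3 * Real.log N) + (s * (3 * Real.log N)) ^ 2) := by gcongr
      _ = a * (3 * A + 9 * (s ^ 2 * Real.log N ^ 2)) := by rw [hA]; ring
      _ ≤ a * (12 * 2 ^ (dᵤ + 1) * (A + C)) := by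
          refine mul_le_mul_of_nonneg_left ?_ (Nat.cast_nonneg a)
          nlinarith
      _ = a * (12 * 2 ^ (dᵤ + 1)) * (A + C) := by ring
      _ ≤ K * (A + C) := mul_le_mul_of_nonneg_right hK' (by positivity)
  · calc (T n : ℝ) ≤ T ⌈K * (s * Real.log N)⌉₊ := by exact_mod_cast hTn
      _ ≤ _ := le_mul_of_one_le_left (Nat.cast_nonneg _) hK''

/-- The base is at least `2`, so a constant factor `a ≤ 2 ^ a` is absorbed by the exponent. -/
theorem exists_le_pow (a : ℕ) : ∃ K₀ : ℕ, ∀ K, K₀ ≤ K → ∀ N s k : ℕ, 2 ≤ N → 1 ≤ s →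
    a * (s * N) ≤ (N + s + k) ^ K := by
  refine ⟨a + 2, fun K hK N s k hN hs => ?_⟩
  calc a * (s * N) ≤ 2 ^ a * (s * N) := Nat.mul_le_mul_right _ Nat.lt_two_pow_self.le
    _ ≤ (N + s + k) ^ a * ((N + s + k) * (N + s + k)) := by
        gcongr <;> omega
    _ = (N + s + k) ^ (a + 2) := by ring
    _ ≤ (N + s + k) ^ K := Nat.pow_le_pow_right (by omega) hK

end Bounds

/-! ### The algorithm

The values of all tuples are collected in real array `0` (behind the parameters) and ranked in word
array `1`. The space around the given centers is covered by cells (real arrays `2`, `12`), which are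
subdivided into leaves (real arrays `3`, `4`) that are small or far from the centers. For every leaf, the
results of the join in it are counted along the elimination order, with weights in real array `5` and
tables in real array `6` and word arrays `24 + j`; one of them, weighted with their number, goes to
real arrays `7` and `8`, the input of the solver. -/

namespace Cmd

variable {W : ℕ} {o : Solver} {d m N : ℕ} {q : JoinQuery d m}

/-- Cells near a point are subdivided if they are within this many side lengths of it. -/
def nearExp (d : ℕ) : RExp := .ofWord (.const (6 * d)) * .get 0 0 / .get 0 1

/-- Cells are subdivided if their side times this factor exceeds `fineExp`. -/
def scaleExp (d m : ℕ) : RExp :=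
  .ofWord (.const (6 * d)) * .get 0 0 * .ofWord (WExp.power (.get 0 0) m)

/-- The bound for the scaled side of small cells. -/
def fineExp : RExp := .get 0 1 * .get 0 2

/-- The bound for the error of the summary. -/
def errorExp : RExp := .get 0 1 * .get 0 2 / (3 * .get 0 0)

/-- Compute a summary of the projected results of the join. -/
noncomputable def summarize (q : JoinQuery d m) (B : Finset (Fin d)) (ρ : Fin m)
    (es : List (Fin m × Fin m)) : Cmd :=
  .seq (loadStage d m) (.seq (rootStage B.toList)
    (.seq (levelStage B.toList (nearExp d) (scaleExp d m) fineExp) (countStage q B ρ es)))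

/-- Compute a summary and cluster it. -/
noncomputable def clusterJoin (q : JoinQuery d m) (B : Finset (Fin d)) (ρ : Fin m)
    (es : List (Fin m × Fin m)) : Cmd :=
  .seq (summarize q B ρ es) (clusterStage B errorExp)

/-- The number of steps of `summarize` if there are at most `M` cells at each of at most `J`
levels. -/
def summarizeCost (d m b e N n M J : ℕ) : ℕ :=
  (3 * (N * d) + 2) * m + 1 +
      (8 * (m * d * N) + 7 + (13 * (m * d * N) + 6) * Nat.clog 2 (m * d * N)) +
    (((5 * n + d + 12) * (2 * (n * 4 ^ b)) + 3 * (n * 4 ^ b * d) + 7) * b + 1 +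
    ((((5 * n + 7 + (d + 3) * 2 ^ b) * M + 3 * (M * d) + 8) * J + (d + 5) * M + 5) +
    (((4 * N + 2) * m + 1 + ((14 * N + 10) * e + 5 * N + 3) + (d + 6)) * ((J + 1) * M) + 3)))

/-- All parameters enter as expressions in the input, so the program is the same for all `α` and
`ε`. The numbers `J`, `t` and `M` appear only in the analysis. -/
theorem ends_summarize (D : q.Instance N) {B : Finset (Fin d)} {ρ : Fin m}
    {es : List (Fin m × Fin m)} (hes : EliminationOrder q.attrs Finset.univ es ρ) {n k : ℕ}
    (X : Fin n → Pt B) {α ε r : ℝ} (hε : 0 < ε) (hr : 0 ≤ r) (hn : 0 < n) (hN : 0 < N)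
    {J t M : ℕ} (hJ : 6 * d * α * N ^ m * 3 ≤ ε * 2 ^ J) (ht : 6 * d * α / ε ≤ t) (ht1 : 1 ≤ t)
    (hM : M = 2 ^ B.card * (n * (2 * t + 2) ^ B.card)) (hNW : N ≤ W) (hNdW : N * d ≤ W)
    (hW1 : 5 * (m * d * N) + 1 ≤ W) (hW2 : 2 * (n * 4 ^ B.card * (d + 1)) + n + 2 ≤ W)
    (hW3 : n + M * (d + 1) + 2 ^ B.card + (J + 1) * M + 1 ≤ W) :
    (summarize q B ρ es).Ends W o (JoinQuery.input D X k α ε r)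
      (summarizeCost d m B.card es.length N n M J) fun u => ∃ E C,
        HoldsWeighted u C ∧ IsSummary D B E C ∧ E.length ≤ (J + 1) * M ∧
        IsLeafList (fun i b => encode X (i * d + (b : Fin d))) n r B (6 * d * α / ε)
          (6 * d * α * N ^ m) (ε * r) E ∧
        (u.word 0 0 = N ∧ u.word 0 2 = k) ∧ u.real 0 0 = α ∧ u.real 0 1 = ε ∧ u.real 0 2 = r := by
  have hW4 : (J + 1) * M + 1 ≤ W :=
    (Nat.add_le_add_right (Nat.le_add_left _ _) 1).trans hW3
  set s := JoinQuery.input D X k α ε r with hs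
  have hs0 : s.word 0 0 = N ∧ s.word 0 1 = n ∧ s.word 0 2 = k := by simp [hs, JoinQuery.input]
  have hs3 : s.real 0 0 = α ∧ s.real 0 1 = ε ∧ s.real 0 2 = r := by simp [hs, JoinQuery.input]
  have hlen : B.toList.length = B.card := Finset.length_toList B
  refine ends_seq (ends_loadStage D hs0.1 ?_ hNdW hW1) ?_
  · intro j i _
    simp only [hs, JoinQuery.input, Nat.add_eq_zero_iff, OfNat.ofNat_ne_zero, and_false, if_false,
      Nat.reduceEqDiff, Nat.add_sub_cancel, j.2, dif_pos]
    rfl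
  rintro s₁ hs₁ ⟨⟨R, hD₁⟩, hr₁⟩
  have hw₁ : s₁.word 0 = s.word 0 := hs₁.1 0 fun h => by have := writesWord_loadStage h; omega
  have hx₁ : HoldsPoints (fun i b => encode X (i * d + (b : Fin d))) n r s₁ := by
    refine ⟨by rw [hw₁, hs0.2.1], by rw [hr₁ 2 (by omega), hs3.2.2], fun i _ b => ?_⟩
    rw [hs₁.2 1 fun h => by have := writesReal_loadStage h; omega]
    simp [hs, JoinQuery.input]
  have hp₁ : s₁.real 0 0 = α ∧ s₁.real 0 1 = ε ∧ s₁.real 0 2 = r := by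
    rw [hr₁ 0 (by omega), hr₁ 1 (by omega), hr₁ 2 (by omega)]
    exact hs3
  refine ends_seq (n := ((5 * n + d + 12) * (2 * (n * 4 ^ B.card)) + 3 * (n * 4 ^ B.card * d) + 7) *
    B.card + 1) (by
      have := ends_rootStage (W := W) (o := o) (l := B.toList) (Finset.nodup_toList B) hx₁ hn hr
        (by rwa [hlen])
      rwa [hlen, Finset.toList_toFinset] at this) ?_
  rintro s₂ hs₂ ⟨L, hL1, hL2, hL3⟩
  have hw₂ : s₂.word 0 = s₁.word 0 := hs₂.1 0 fun h => by have := writesWord_rootStage h; omega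
  have hw₂' : s₂.word 1 = s₁.word 1 := hs₂.1 1 fun h => by have := writesWord_rootStage h; omega
  have hr₂ : s₂.real 0 = s₁.real 0 := hs₂.2 0 fun h => by have := writesReal_rootStage h; omega
  have hr₂' : s₂.real 1 = s₁.real 1 := hs₂.2 1 fun h => by have := writesReal_rootStage h; omega
  have hN₂ : s₂.word 0 0 = N := by rw [hw₂, hw₁, hs0.1]
  refine ends_seq (n := ((5 * n + 7 + (d + 3) * 2 ^ B.card) * M + 3 * (M * d) + 8) * J +
    (d + 5) * M + 5) (by
      have := ends_levelStage (W := W) (o := o) (l := B.toList) (s := s₂) (κe := nearExp d)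
        (μe := scaleExp d m) (τe := fineExp) (κ := 6 * d * α / ε) (μ := 6 * d * α * N ^ m)
        (τ := ε * r) (J := J) (t := t) (m := M) (L := L) (hx₁.congr hw₂ hr₂ hr₂') hr (by positivity)
        (fun u _ h => by simp [nearExp, h, hr₂, hp₁])
        (fun u h' h => by simp [scaleExp, h, h', hr₂, hp₁, hN₂])
        (fun u _ h => by simp [fineExp, h, hr₂, hp₁]) ?_ ht ht1 (by rwa [hlen]) (by rwa [hlen])
        hL1 hL2 (by rwa [Finset.toList_toFinset])
      · rwa [hlen, Finset.toList_toFinset] at this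
      · calc 6 * d * α * N ^ m * (3 * r) = 6 * d * α * N ^ m * 3 * r := by ring
          _ ≤ ε * 2 ^ J * r := mul_le_mul_of_nonneg_right hJ hr
          _ = _ := by ring) ?_
  rintro s₃ hs₃ ⟨E, hE1, hE2, hE3⟩
  have hw₃ : s₃.word 0 = s₂.word 0 := hs₃.1 0 fun h => by have := writesWord_levelStage h; omega
  have hw₃' : s₃.word 1 = s₂.word 1 := hs₃.1 1 fun h => by have := writesWord_levelStage h; omega
  have hr₃ : s₃.real 0 = s₂.real 0 := hs₃.2 0 fun h => by have := writesReal_levelStage h; omega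
  have hD₃ : HoldsDatabase D R s₃ := hD₁.congr (hw₃.trans hw₂) (hw₃'.trans hw₂') (hr₃.trans hr₂)
  refine (ends_countStage (B := B) hes hD₃ hE1 hN hNW
    ((Nat.succ_le_succ hE2).trans hW4)).mono (by gcongr) ?_
  rintro u hu ⟨C, hC, hS⟩
  have hwu : u.word 0 = s.word 0 :=
    (hu.1 0 fun h => by have := writesWord_countStage hes h; omega).trans
      (hw₃.trans (hw₂.trans hw₁))
  have hru : u.real 0 = s₁.real 0 :=
    (hu.2 0 fun h => by have := writesReal_countStage h; omega).trans (hr₃.trans hr₂)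
  refine ⟨E, C, hC, hS, hE2, hE3, by rw [hwu]; exact ⟨hs0.1, hs0.2.2⟩, by rw [hru]; exact hp₁⟩

theorem ends_clusterJoin (D : q.Instance N) {B : Finset (Fin d)} {ρ : Fin m}
    {es : List (Fin m × Fin m)} (hes : EliminationOrder q.attrs Finset.univ es ρ) {n k : ℕ}
    (X : Fin n → Pt B) {α ε r : ℝ} (hε : 0 < ε) (hr : 0 ≤ r) (hn : 0 < n) (hN : 0 < N)
    (hk : 0 < k)
    {J t M : ℕ} (hJ : 6 * d * α * N ^ m * 3 ≤ ε * 2 ^ J) (ht : 6 * d * α / ε ≤ t) (ht1 : 1 ≤ t)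
    (hM : M = 2 ^ B.card * (n * (2 * t + 2) ^ B.card)) (hNW : N ≤ W) (hNdW : N * d ≤ W)
    (hW1 : 5 * (m * d * N) + 1 ≤ W) (hW2 : 2 * (n * 4 ^ B.card * (d + 1)) + n + 2 ≤ W)
    (hW3 : n + M * (d + 1) + 2 ^ B.card + (J + 1) * M + 1 ≤ W)
    {alg : List (Pt B × ℝ) → Fin k → Pt B} {T : ℕ → ℕ} (hT : Monotone T) :
    (clusterJoin q B ρ es).Ends W (clusteringSolver alg T) (JoinQuery.input D X k α ε r)
      (summarizeCost d m B.card es.length N n M J + (T ((J + 1) * M) +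
        (5 * ((J + 1) * M) + 6) * ((J + 1) * M) + d + 10)) fun u => ∃ E C,
        IsSummary D B E C ∧
        IsLeafList (fun i b => encode X (i * d + (b : Fin d))) n r B (6 * d * α / ε)
          (6 * d * α * N ^ m) (ε * r) E ∧
        outCenters B k u = alg (pointList B (if C = [] then [(0, 1)] else C)) ∧
        outEstimate u = (if k < (if C = [] then [(0, 1)] else C).length then
          medianCost (Set.range (alg (pointList B (if C = [] then [(0, 1)] else C))))
            (pointList B (if C = [] then [(0, 1)] else C)) else 0) + ε * r / (3 * α) := by
  have hW4 : (J + 1) * M + 1 ≤ W :=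
    (Nat.add_le_add_right (Nat.le_add_left _ _) 1).trans hW3
  have hM1 : 1 ≤ (J + 1) * M := by
    rw [hM]
    exact Nat.mul_pos (by omega) (by positivity)
  refine ends_seq (ends_summarize D hes X hε hr hn hN hJ ht ht1 hM hNW hNdW hW1 hW2 hW3) ?_
  rintro s - ⟨E, C, hC, hS, hE, hEl, ⟨-, hsk⟩, hs0, hs1, hs2⟩
  have hlen : (if C = [] then [(0, 1)] else C).length ≤ (J + 1) * M := by
    split_ifs
    · simpa using hM1
    · exact hS.length_le.trans hE
  refine (ends_clusterStage (err := errorExp) (δ := ε * r / (3 * α)) hC hsk hk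
    (fun t _ h => by simp [errorExp, h, hs0, hs1, hs2]) rfl
    ((hlen.trans (Nat.le_succ _)).trans hW4)).mono ?_ ?_
  · have := hT hlen
    gcongr
  · rintro u - ⟨h1, h2⟩
    exact ⟨E, C, hS, hEl, h1, h2⟩

end Cmd

/-! ### Uniform constants for steps, word sizes and numbers of levels. -/

section Bounds

/-- The number of steps is bounded by the leading terms of the time bound. -/
theorem exists_summarizeCost_le (d m b e M₀ J₀ : ℕ) : ∃ K, ∀ N n M J L : ℕ, 1 ≤ N → 1 ≤ n → 1 ≤ L →
    N ≤ 2 ^ L → M ≤ M₀ * n → J + 1 ≤ J₀ * L →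
    Cmd.summarizeCost d m b e N n M J + ((5 * ((J + 1) * M) + 6) * ((J + 1) * M) + d + 10) ≤
      K * (n * N * L + (n * L) ^ 2) := by
  refine ⟨((3 * d + 2) * m + 1 + (8 * (m * d) + 7 + (13 * (m * d) + 6) * (m * d + 1))) +
    (((5 + d + 12) * (2 * 4 ^ b) + 3 * (4 ^ b * d) + 7) * b + 1 +
    (((5 + 7 + (d + 3) * 2 ^ b) * M₀ + 3 * (M₀ * d) + 8) * J₀ + (d + 5) * M₀ + 5) +
    ((((4 + 2) * m + 1 + ((14 + 10) * e + 5 + 3) + (d + 6)) * (J₀ * M₀)) + 3)) +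
    ((5 * (J₀ * M₀) + 6) * (J₀ * M₀) + d + 10), fun N n M J L hN hn hL hNL hM hJ => ?_⟩
  set Q := n * N * L + (n * L) ^ 2 with hQ
  have hJ' : J ≤ J₀ * L := by omega
  have hJM : (J + 1) * M ≤ J₀ * M₀ * (n * L) := by
    calc (J + 1) * M ≤ J₀ * L * (M₀ * n) := Nat.mul_le_mul hJ hM
      _ = _ := by ring
  have hnL : 1 ≤ n * L := Nat.mul_pos hn hL
  have hNL1 : 1 ≤ N * L := Nat.mul_pos hN hL
  have hq1 : N * L ≤ Q := by
    calc N * L ≤ n * (N * L) := Nat.le_mul_of_pos_left _ hn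
      _ = n * N * L := by ring
      _ ≤ Q := Nat.le_add_right _ _
  have hq2 : (n * L) ^ 2 ≤ Q := Nat.le_add_left _ _
  have hn2 : n ^ 2 * L ≤ (n * L) ^ 2 := by
    calc n ^ 2 * L ≤ n ^ 2 * L * L := Nat.le_mul_of_pos_right _ hL
      _ = _ := by ring
  have hn2' : n ^ 2 ≤ n ^ 2 * L := Nat.le_mul_of_pos_right _ hL
  have hnn : n ≤ n ^ 2 := Nat.le_self_pow two_ne_zero n
  have hclog : Nat.clog 2 (m * d * N) ≤ m * d + L := by
    refine (Nat.clog_le_iff_le_pow (by norm_num)).2 ?_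
    calc m * d * N ≤ 2 ^ (m * d) * 2 ^ L := Nat.mul_le_mul Nat.lt_two_pow_self.le hNL
      _ = 2 ^ (m * d + L) := (pow_add _ _ _).symm
  have h1 : (3 * (N * d) + 2) * m + 1 +
      (8 * (m * d * N) + 7 + (13 * (m * d * N) + 6) * Nat.clog 2 (m * d * N)) ≤
      ((3 * d + 2) * m + 1 + (8 * (m * d) + 7 + (13 * (m * d) + 6) * (m * d + 1))) * Q := by
    refine le_trans ?_ (Nat.mul_le_mul_left _ hq1)
    have hNN : N ≤ N * L := Nat.le_mul_of_pos_right _ hL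
    calc _ ≤ (3 * (N * d) + 2 * N) * m + N * L + (8 * (m * d * N) + 7 * (N * L) +
          (13 * (m * d * N) + 6 * N) * (m * d * L + L)) := by
          gcongr
          · omega
          · omega
          · omega
          · refine hclog.trans (Nat.add_le_add_right (Nat.le_mul_of_pos_right _ hL) _)
      _ = ((3 * d + 2) * m + 8 * (m * d)) * N + (1 + 7 + (13 * (m * d) + 6) * (m * d + 1)) * (N * L)
          := by ring
      _ ≤ ((3 * d + 2) * m + 8 * (m * d)) * (N * L) +
          (1 + 7 + (13 * (m * d) + 6) * (m * d + 1)) * (N * L) := by gcongr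
      _ = _ := by ring
  have h2 : ((5 * n + d + 12) * (2 * (n * 4 ^ b)) + 3 * (n * 4 ^ b * d) + 7) * b + 1 ≤
      (((5 + d + 12) * (2 * 4 ^ b) + 3 * (4 ^ b * d) + 7) * b + 1) * Q := by
    refine le_trans ?_ (Nat.mul_le_mul_left _ ((hn2'.trans hn2).trans hq2))
    calc _ ≤ ((5 * n + d * n + 12 * n) * (2 * (n * 4 ^ b)) + 3 * (n ^ 2 * 4 ^ b * d) + 7 * n ^ 2) * b
          + n ^ 2 := by
          gcongr
          · exact Nat.le_mul_of_pos_right _ hn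
          · omega
          · nlinarith
          · nlinarith
      _ = _ := by ring
  have h3 : (((5 * n + 7 + (d + 3) * 2 ^ b) * M + 3 * (M * d) + 8) * J + (d + 5) * M + 5) ≤
      (((5 + 7 + (d + 3) * 2 ^ b) * M₀ + 3 * (M₀ * d) + 8) * J₀ + (d + 5) * M₀ + 5) * Q := by
    refine le_trans ?_ (Nat.mul_le_mul_left _ hq2)
    have hn1 : 1 ≤ n ^ 2 := Nat.one_le_pow _ _ hn
    have hnL2 : n ≤ (n * L) ^ 2 := by omega
    calc _ ≤ ((5 * n + 7 * n + (d + 3) * (2 ^ b * n)) * (M₀ * n) + 3 * (M₀ * n ^ 2 * d) + 8 * n ^ 2) *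
          (J₀ * L) + (d + 5) * (M₀ * (n * L) ^ 2) + 5 * (n * L) ^ 2 := by
          have e1 := hM.trans (Nat.mul_le_mul_left M₀ hnn)
          have e2 := hM.trans (Nat.mul_le_mul_left M₀ hnL2)
          gcongr <;> first
            | omega
            | exact Nat.le_mul_of_pos_right _ hn
      _ = ((5 + 7 + (d + 3) * 2 ^ b) * M₀ + 3 * (M₀ * d) + 8) * J₀ * (n ^ 2 * L) +
          ((d + 5) * M₀ + 5) * (n * L) ^ 2 := by ring
      _ ≤ ((5 + 7 + (d + 3) * 2 ^ b) * M₀ + 3 * (M₀ * d) + 8) * J₀ * (n * L) ^ 2 +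
          ((d + 5) * M₀ + 5) * (n * L) ^ 2 := by gcongr
      _ = _ := by ring
  have h4 : ((4 * N + 2) * m + 1 + ((14 * N + 10) * e + 5 * N + 3) + (d + 6)) * ((J + 1) * M) + 3 ≤
      ((((4 + 2) * m + 1 + ((14 + 10) * e + 5 + 3) + (d + 6)) * (J₀ * M₀)) + 3) * Q := by
    have hq3 : n * N * L ≤ Q := Nat.le_add_right _ _
    have hq4 : 1 ≤ n * N * L := Nat.mul_pos (Nat.mul_pos hn hN) hL
    refine le_trans ?_ (Nat.mul_le_mul_left _ hq3)
    calc _ ≤ ((4 * N + 2 * N) * m + N + ((14 * N + 10 * N) * e + 5 * N + 3 * N) + (d * N + 6 * N)) *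
          (J₀ * M₀ * (n * L)) + 3 * (n * N * L) := by
          gcongr
          · omega
          · omega
          · omega
          · exact Nat.le_mul_of_pos_right _ hN
          · omega
          · omega
      _ = _ := by ring
  have h5 : (5 * ((J + 1) * M) + 6) * ((J + 1) * M) + d + 10 ≤
      ((5 * (J₀ * M₀) + 6) * (J₀ * M₀) + d + 10) * Q := by
    have hn1 : 1 ≤ (n * L) ^ 2 := Nat.one_le_pow _ _ hnL
    refine le_trans ?_ (Nat.mul_le_mul_left _ hq2)
    calc _ ≤ (5 * (J₀ * M₀ * (n * L)) + 6 * (n * L)) * (J₀ * M₀ * (n * L)) + d * (n * L) ^ 2 +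
          10 * (n * L) ^ 2 := by
          gcongr
          · omega
          · exact Nat.le_mul_of_pos_right _ hn1
          · omega
      _ = _ := by ring
  rw [Cmd.summarizeCost]
  calc _ ≤ _ := Nat.add_le_add (Nat.add_le_add h1 (Nat.add_le_add h2 (Nat.add_le_add h3 h4))) h5
    _ = _ := by ring

/-- The words that the algorithm stores are small. -/
theorem exists_wordBound (d m b M₀ J₀ : ℕ) : ∃ K₀, ∀ K, K₀ ≤ K → ∀ N n k M J : ℕ, 2 ≤ N → 1 ≤ n →
    M ≤ M₀ * n → J + 1 ≤ J₀ * (Nat.log 2 N + 1) →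
    N ≤ (N + n + k) ^ K ∧ N * d ≤ (N + n + k) ^ K ∧ 5 * (m * d * N) + 1 ≤ (N + n + k) ^ K ∧
    2 * (n * 4 ^ b * (d + 1)) + n + 2 ≤ (N + n + k) ^ K ∧
    n + M * (d + 1) + 2 ^ b + (J + 1) * M + 1 ≤ (N + n + k) ^ K := by
  obtain ⟨K₀, hK₀⟩ := exists_le_pow (1 + d + (5 * (m * d) + 1) + (2 * (4 ^ b * (d + 1)) + 3) +
    (1 + M₀ * (d + 1) + 2 ^ b + J₀ * M₀ + 1))
  refine ⟨K₀, fun K hK N n k M J hN hn hM hJ => ?_⟩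
  have h := hK₀ K hK N n k hN hn
  have hL : Nat.log 2 N + 1 ≤ N := Nat.log_lt_self 2 (by omega)
  have hJM : (J + 1) * M ≤ J₀ * M₀ * (n * N) := by
    calc (J + 1) * M ≤ J₀ * N * (M₀ * n) :=
          Nat.mul_le_mul (hJ.trans (Nat.mul_le_mul_left _ hL)) hM
      _ = _ := by ring
  have h1 : N ≤ n * N := Nat.le_mul_of_pos_left _ hn
  have h2 : n ≤ n * N := Nat.le_mul_of_pos_right _ (by omega)
  have h3 : 1 ≤ n * N := hn.trans h2
  have hM' : M ≤ M₀ * (n * N) := hM.trans (Nat.mul_le_mul_left _ h2)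
  set P := n * N with hP
  have g1 : N * d ≤ d * P := by rw [mul_comm]; gcongr
  have g2 : 5 * (m * d * N) + 1 ≤ (5 * (m * d) + 1) * P := by
    calc 5 * (m * d * N) + 1 ≤ 5 * (m * d * P) + P := by gcongr
      _ = _ := by ring
  have g3 : 2 * (n * 4 ^ b * (d + 1)) + n + 2 ≤ (2 * (4 ^ b * (d + 1)) + 3) * P := by
    calc 2 * (n * 4 ^ b * (d + 1)) + n + 2 ≤ 2 * (P * 4 ^ b * (d + 1)) + P + 2 * P := by
          gcongr
          omega
      _ = _ := by ring
  have g4 : n + M * (d + 1) + 2 ^ b + (J + 1) * M + 1 ≤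
      (1 + M₀ * (d + 1) + 2 ^ b + J₀ * M₀ + 1) * P := by
    calc n + M * (d + 1) + 2 ^ b + (J + 1) * M + 1 ≤
          P + M₀ * P * (d + 1) + 2 ^ b * P + J₀ * M₀ * P + P := by
          gcongr
          exact Nat.le_mul_of_pos_right _ h3
      _ = _ := by ring
  rw [add_mul, add_mul, add_mul, add_mul, one_mul] at h
  refine ⟨?_, ?_, ?_, ?_, ?_⟩ <;> refine le_trans ?_ h
  · exact h1.trans (by simp only [add_assoc]; exact Nat.le_add_right _ _)
  · exact g1.trans (by simp only [add_assoc]; exact (Nat.le_add_right _ _).trans (Nat.le_add_left _ _))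
  · exact g2.trans ((Nat.le_add_left _ _).trans ((Nat.le_add_right _ _).trans (Nat.le_add_right _ _)))
  · exact g3.trans ((Nat.le_add_left _ _).trans (Nat.le_add_right _ _))
  · exact g4.trans (Nat.le_add_left _ _)

/-- Logarithmically many levels suffice. -/
theorem exists_levels (c : ℝ) {ε : ℝ} (hε : 0 < ε) (m : ℕ) : ∃ J₀ : ℕ, ∀ N : ℕ, ∃ J : ℕ,
    J + 1 ≤ J₀ * (Nat.log 2 N + 1) ∧ c * N ^ m ≤ ε * 2 ^ J := by
  obtain ⟨a, ha⟩ := pow_unbounded_of_one_lt (c / ε) (by norm_num : (1 : ℝ) < 2)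
  -- The first `a` halvings pay for `c / ε`, and each block of `log₂ N + 1` halvings pays for one
  -- factor `N`.
  refine ⟨a + m + 1, fun N => ⟨a + m * (Nat.log 2 N + 1), ?_, ?_⟩⟩
  · nlinarith [Nat.zero_le (a * Nat.log 2 N)]
  · have h1 : (N : ℝ) ≤ 2 ^ (Nat.log 2 N + 1) := by
      exact_mod_cast (Nat.lt_pow_succ_log_self (by norm_num) N).le
    rw [div_lt_iff₀ hε] at ha
    calc c * N ^ m ≤ 2 ^ a * ε * N ^ m := mul_le_mul_of_nonneg_right ha.le (by positivity)
      _ ≤ 2 ^ a * ε * (2 ^ (Nat.log 2 N + 1)) ^ m := by gcongr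
      _ = _ := by rw [pow_add (2 : ℝ) a, ← pow_mul, mul_comm m]; ring

end Bounds

/-! ### Correctness of the output, and the theorem. -/

section Main

variable {d m : ℕ} {q : JoinQuery d m} {B : Finset (Fin d)}

/-- What `clusterJoin` computes. -/
def IsClusterOutput {N n k : ℕ} (D : q.Instance N) (B : Finset (Fin d)) (X : Fin n → Pt B)
    (α ε r : ℝ) (alg : List (Pt B × ℝ) → Fin k → Pt B) (u : Mem) : Prop :=
  ∃ E C, IsSummary D B E C ∧
    Cmd.IsLeafList (fun i b => encode X (i * d + (b : Fin d))) n r B (6 * d * α / ε)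
      (6 * d * α * N ^ m) (ε * r) E ∧
    outCenters B k u = alg (Cmd.pointList B (if C = [] then [(0, 1)] else C)) ∧
    outEstimate u = (if k < (if C = [] then [(0, 1)] else C).length then
      medianCost (Set.range (alg (Cmd.pointList B (if C = [] then [(0, 1)] else C))))
        (Cmd.pointList B (if C = [] then [(0, 1)] else C)) else 0) + ε * r / (3 * α)

/-- The constants `t`, `M₀`, `J₀` and hence `K` depend only on the query, `B`, `α` and `ε`. One
exponent serves for both the time and the word size, since both bounds hold for all larger values of
`K`. -/
theorem exists_clusterJoin_ends {ρ : Fin m} {es : List (Fin m × Fin m)}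
    (hes : EliminationOrder q.attrs Finset.univ es ρ) (B : Finset (Fin d)) {α ε : ℝ}
    (hε : 0 < ε) : ∃ K : ℕ, ∀ (N : ℕ) (D : q.Instance N) (n : ℕ) (X : Fin n → Pt B) (k : ℕ) (r : ℝ),
      2 ≤ N → 1 ≤ n → 1 ≤ k → 0 ≤ r → ∀ (alg : List (Pt B × ℝ) → Fin k → Pt B) (T : ℕ → ℕ),
        Monotone T → (Cmd.clusterJoin q B ρ es).Ends ((N + n + k) ^ K) (clusteringSolver alg T)
          (JoinQuery.input D X k α ε r) ⌊timeBound K B.card N n T⌋₊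
          (IsClusterOutput D B X α ε r alg) := by
  set t := ⌈6 * d * α / ε⌉₊ + 1 with ht
  set M₀ := 2 ^ B.card * (2 * t + 2) ^ B.card with hM₀
  obtain ⟨J₀, hJ₀⟩ := exists_levels (6 * d * α * 3) hε m
  obtain ⟨a, ha⟩ := exists_summarizeCost_le d m B.card es.length M₀ J₀
  obtain ⟨K₁, hK₁⟩ := exists_le_timeBound B.card a (J₀ * M₀)
  obtain ⟨K₂, hK₂⟩ := exists_wordBound d m B.card M₀ J₀
  refine ⟨max K₁ K₂, fun N D n X k r hN hn hk hr alg T hT => ?_⟩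
  obtain ⟨J, hJ, hJ'⟩ := hJ₀ N
  have hM : M₀ * n = 2 ^ B.card * (n * (2 * t + 2) ^ B.card) := by rw [hM₀]; ring
  obtain ⟨w1, w2, w3, w4, w5⟩ := hK₂ _ (le_max_right K₁ K₂) N n k (M₀ * n) J hN hn le_rfl hJ
  refine (Cmd.ends_clusterJoin D hes X hε hr (by omega) (by omega) (by omega) (J := J) (t := t)
    (M := M₀ * n) ?_ ?_ (by omega) hM w1 w2 w3 w4 w5 (alg := alg) hT).mono ?_ fun _ _ h => h
  · calc 6 * d * α * N ^ m * 3 = 6 * d * α * 3 * N ^ m := by ring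
      _ ≤ _ := hJ'
  · rw [ht]
    push_cast
    linarith [Nat.le_ceil (6 * d * α / ε)]
  · have h1 := ha N n (M₀ * n) J (Nat.log 2 N + 1) (by omega) hn (by omega)
      (Nat.lt_pow_succ_log_self (by norm_num) N).le le_rfl hJ
    have h2 := hK₁ _ (le_max_left K₁ K₂) N n ((J + 1) * (M₀ * n)) T hN hn hT (by
      calc (J + 1) * (M₀ * n) ≤ J₀ * (Nat.log 2 N + 1) * (M₀ * n) := Nat.mul_le_mul_right _ hJ
        _ = _ := by ring)
    omega

variable {N n k : ℕ} {D : q.Instance N} {X : Fin n → Pt B} {α ε r γ : ℝ}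
  {alg : List (Pt B × ℝ) → Fin k → Pt B} {u : Mem}

theorem IsSummary.isWeightedSet {E C : List ((Fin d → ℝ) × ℝ)} (h : IsSummary D B E C)
    (hE : E.Pairwise fun u v => Disjoint (box B u.2 u.1) (box B v.2 v.1)) (hC : C ≠ []) :
    IsWeightedSet (Cmd.pointList B C) := by
  refine ⟨by simpa [Cmd.pointList] using hC, h.nodup hE, fun p hp => ?_⟩
  obtain ⟨c, hc, rfl⟩ := List.mem_map.1 hp
  exact (h.exists_box c hc).2.2

/-- If the join has a result, the output is based on a good summary. -/
theorem IsClusterOutput.exists_summary (hu : IsClusterOutput D B X α ε r alg u) (hn : 0 < n)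
    (hN : 0 < N) (hα : 0 < α) (hε : 0 < ε)
    (hr : medianCost (Set.range X) (JoinQuery.data D B) ≤ r)
    (hne : (JoinQuery.results D).Nonempty) :
    ∃ P : List (Pt B × ℝ), IsWeightedSet P ∧ (∀ p ∈ P, ∃ w, (p.1, w) ∈ JoinQuery.data D B) ∧
      (∀ S : Set (Pt B), |medianCost S (P : Multiset (Pt B × ℝ)) -
        medianCost S (JoinQuery.data D B)| ≤ ε * r / (3 * α)) ∧
      outCenters B k u = alg P ∧
      outEstimate u = (if k < P.length then medianCost (Set.range (alg P)) P else 0) +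
        ε * r / (3 * α) := by
  obtain ⟨E, C, hS, hE, h1, h2⟩ := hu
  have hx : ∀ (i : Fin n) (b : B), encode X (i * d + (b : Fin d)) = X i b := fun i b => by
    rw [encode_mul_add, dif_pos b.2]
  have hC : C ≠ [] := by
    refine hS.ne_nil (fun t ht => ?_) hne
    obtain ⟨i, hi⟩ := exists_abs_sub_le hn hr ht
    refine hE.cover t ⟨i, i.2, fun b hb => ?_⟩
    have := PiLp.norm_apply_le (proj B t - X i) ⟨b, hb⟩
    rw [← dist_eq_norm] at this
    rw [hx i ⟨b, hb⟩]
    exact this.trans hi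
  rw [if_neg hC] at h1 h2
  have hlen : (Cmd.pointList B C).length = C.length := by simp [Cmd.pointList]
  refine ⟨Cmd.pointList B C, hS.isWeightedSet hE.disj hC, fun p hp => ?_,
    fun S => hS.abs_medianCost_sub_le hn hx hα hε hN hr hE S, h1, by rw [h2, hlen]⟩
  obtain ⟨c, hc, rfl⟩ := List.mem_map.1 hp
  obtain ⟨t, ht, htc⟩ := (hS.exists_box c hc).2.1
  exact ⟨1, mem_data.2 ⟨rfl, t, ht, htc.symm⟩⟩

theorem weight_data_pos : ∀ p ∈ JoinQuery.data D B, 0 < p.2 := fun p hp => by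
  rw [(mem_data.1 hp).1]
  exact one_pos

/-- If the join is empty, then `r = 0` and the summary is empty; the solver runs on the artificial
point, its `k ≥ 1` centers are distinct, and the estimate is `0`. Otherwise the output comes from a
genuine summary. -/
theorem IsClusterOutput.geometric (hu : IsClusterOutput D B X α ε r alg u) (hn : 0 < n)
    (hN : 0 < N) (hk : 0 < k) (hα : 0 < α) (hε : 0 < ε)
    (hr : medianCost (Set.range X) (JoinQuery.data D B) ≤ r)
    (hr' : r ≤ α * medianOpt k (JoinQuery.data D B)) (hγ : 1 ≤ γ)
    (halg : IsGeometricApprox k γ alg) :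
    Function.Injective (outCenters B k u) ∧
      medianCost (Set.range (outCenters B k u)) (JoinQuery.data D B) ≤ outEstimate u ∧
      outEstimate u ≤ (1 + ε) * γ * medianOpt k (JoinQuery.data D B) := by
  rcases (JoinQuery.results D).eq_empty_or_nonempty with hemp | hne
  · have hdata : JoinQuery.data D B = 0 := Multiset.eq_zero_of_forall_notMem fun p hp => by
      obtain ⟨-, t, ht, -⟩ := mem_data.1 hp
      simp [hemp] at ht
    rw [hdata] at hr hr' ⊢
    have hr0 : r = 0 := by
      rw [medianOpt_zero, mul_zero] at hr'
      rw [medianCost, Multiset.map_zero, Multiset.sum_zero] at hr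
      exact le_antisymm hr' hr
    obtain ⟨E, C, hS, -, h1, h2⟩ := hu
    have hC : C = [] := by
      refine List.eq_nil_iff_forall_not_mem.2 fun c hc => ?_
      obtain ⟨t, ht, -⟩ := (hS.exists_box c hc).2.1
      simp [hemp] at ht
    have hk1 : ¬ k < 1 := by omega
    simp only [hC, if_true, List.length_singleton, hk1, if_false, hr0] at h1 h2
    have h3 := (halg (Cmd.pointList B [(0, 1)]) ⟨by simp [Cmd.pointList], by simp [Cmd.pointList],
      by simp [Cmd.pointList]⟩).1
    rw [h1, h2, medianOpt_zero]
    refine ⟨h3, ?_, ?_⟩ <;> simp [medianCost]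
  · obtain ⟨P, hP, -, he, h1, h2⟩ := hu.exists_summary hn hN hα hε hr hne
    rw [h1, h2]
    refine geometric_estimate hP (fun p hp => (weight_data_pos p hp).le) he halg hγ ?_
    -- This is where `r ≤ α OPT` makes the error small compared with the optimum.
    calc 3 * (ε * r / (3 * α)) = ε * (r / α) := by field_simp
      _ ≤ _ := mul_le_mul_of_nonneg_left ((div_le_iff₀' hα).2 hr') hε.le

theorem IsClusterOutput.discrete (hu : IsClusterOutput D B X α ε r alg u) (hn : 0 < n)
    (hN : 0 < N) (hk : 0 < k) (hα : 0 < α) (hε : 0 < ε) (hε1 : ε < 1)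
    (hk' : k ≤ {x | x ∈ JoinQuery.projected D B}.ncard)
    (hr : medianCost (Set.range X) (JoinQuery.data D B) ≤ r)
    (hr' : r ≤ α * medianOpt k (JoinQuery.data D B)) (hγ : 1 ≤ γ)
    (halg : IsDiscreteApprox k γ alg) :
    Function.Injective (outCenters B k u) ∧ (∀ i, outCenters B k u i ∈ JoinQuery.projected D B) ∧
      medianCost (Set.range (outCenters B k u)) (JoinQuery.data D B) ≤ outEstimate u ∧
      outEstimate u ≤ (2 + ε) * γ * medianOptDisc k (JoinQuery.data D B) := by
  -- There are at least `k ≥ 1` distinct projected points, so the artificial point is never used.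
  have hne : (JoinQuery.results D).Nonempty := by
    obtain ⟨x, hx⟩ := Set.nonempty_of_ncard_ne_zero (s := {x | x ∈ JoinQuery.projected D B})
      (by omega)
    obtain ⟨w, hw⟩ := mem_projected.1 hx
    obtain ⟨-, t, ht, -⟩ := mem_data.1 hw
    exact ⟨t, ht⟩
  obtain ⟨P, hP, hPD, he, h1, h2⟩ := hu.exists_summary hn hN hα hε hr hne
  rw [h1, h2]
  simp only [mem_projected] at hk' ⊢
  refine discrete_estimate hP weight_data_pos hPD he halg hγ hε hε1 ?_ hk hk'
  calc 3 * (ε * r / (3 * α)) = ε * (r / α) := by field_simp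
    _ ≤ _ := mul_le_mul_of_nonneg_left ((div_le_iff₀' hα).2 hr') hε.le

theorem medianCost_data_nonneg (S : Set (Pt B)) : 0 ≤ medianCost S (JoinQuery.data D B) :=
  medianCost_nonneg fun p hp => (weight_data_pos p hp).le

end Main

theorem mainTheorem4 {d m : ℕ} (q : JoinQuery d m) (hq : q.Acyclic) (Aᵤ : Finset (Fin d))
    (c : ℕ) :
    (∃ p : Cmd, ∀ α ε : ℝ, 1 < α → 0 < ε → ε < 1 → ∃ K : ℕ,
      ∀ (N : ℕ) (D : q.Instance N) (s : ℕ) (X : Fin s ↪ Pt Aᵤ) (k : ℕ) (r : ℝ),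
        2 ≤ N → 1 ≤ s → 1 ≤ k →
        medianCost (Set.range X) (JoinQuery.data D Aᵤ) ≤ r →
        r ≤ α * medianOpt k (JoinQuery.data D Aᵤ) →
        ∀ (γ : ℝ) (alg : List (Pt Aᵤ × ℝ) → Fin k → Pt Aᵤ) (T : ℕ → ℕ),
          1 ≤ γ → IsGeometricApprox k γ alg → Monotone T →
          p.Succeeds ((N + s + k) ^ K) (clusteringSolver alg T)
            ⌊timeBound K Aᵤ.card N s T⌋₊ (JoinQuery.input D X k α ε r) (1 / (N : ℝ) ^ c)
            (fun out =>
              Function.Injective (outCenters Aᵤ k out) ∧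
              medianCost (Set.range (outCenters Aᵤ k out)) (JoinQuery.data D Aᵤ)
                ≤ outEstimate out ∧
              outEstimate out ≤ (1 + ε) * γ * medianOpt k (JoinQuery.data D Aᵤ))) ∧
    (∃ p : Cmd, ∀ α ε : ℝ, 1 < α → 0 < ε → ε < 1 → ∃ K : ℕ,
      ∀ (N : ℕ) (D : q.Instance N) (s : ℕ) (X : Fin s ↪ Pt Aᵤ) (k : ℕ) (r : ℝ),
        2 ≤ N → 1 ≤ s → 1 ≤ k →
        k ≤ {x | x ∈ JoinQuery.projected D Aᵤ}.ncard →
        medianCost (Set.range X) (JoinQuery.data D Aᵤ) ≤ r →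
        r ≤ α * medianOpt k (JoinQuery.data D Aᵤ) →
        ∀ (γ : ℝ) (alg : List (Pt Aᵤ × ℝ) → Fin k → Pt Aᵤ) (T : ℕ → ℕ),
          1 ≤ γ → IsDiscreteApprox k γ alg → Monotone T →
          p.Succeeds ((N + s + k) ^ K) (clusteringSolver alg T)
            ⌊timeBound K Aᵤ.card N s T⌋₊ (JoinQuery.input D X k α ε r) (1 / (N : ℝ) ^ c)
            (fun out =>
              Function.Injective (outCenters Aᵤ k out) ∧
              (∀ i, outCenters Aᵤ k out i ∈ JoinQuery.projected D Aᵤ) ∧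
              medianCost (Set.range (outCenters Aᵤ k out)) (JoinQuery.data D Aᵤ)
                ≤ outEstimate out ∧
              outEstimate out ≤ (2 + ε) * γ * medianOptDisc k (JoinQuery.data D Aᵤ))) := by
  obtain ⟨ρ, es, hes⟩ := hq.exists_eliminationOrder
  constructor
  -- The program is fixed by the query and its elimination order before `α` and `ε` are given; the
  -- same one serves in the discrete case.
  · refine ⟨Cmd.clusterJoin q Aᵤ ρ es, fun α ε hα hε _ => ?_⟩
    have hα0 : 0 < α := by linarith
    obtain ⟨K, hK⟩ := exists_clusterJoin_ends hes Aᵤ hε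
    refine ⟨K, fun N D s X k r hN hs hk hr hr' γ alg T hγ halg hT => ?_⟩
    -- The run is deterministic, so any nonnegative failure probability is allowed.
    refine ((hK N D s X k r hN hs hk ((medianCost_data_nonneg _).trans hr) alg T hT).mono le_rfl
      fun u _ hu => ?_).succeeds (by positivity)
    exact hu.geometric hs (by omega) hk hα0 hε hr hr' hγ halg
  · refine ⟨Cmd.clusterJoin q Aᵤ ρ es, fun α ε hα hε hε1 => ?_⟩
    have hα0 : 0 < α := by linarith
    obtain ⟨K, hK⟩ := exists_clusterJoin_ends hes Aᵤ hε
    refine ⟨K, fun N D s X k r hN hs hk hk' hr hr' γ alg T hγ halg hT => ?_⟩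
    refine ((hK N D s X k r hN hs hk ((medianCost_data_nonneg _).trans hr) alg T hT).mono le_rfl
      fun u _ hu => ?_).succeeds (by positivity)
    exact hu.discrete hs (by omega) hk hα0 hε hε1 hk' hr hr' hγ halg
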